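/- Let $C=\{k\in C([0,1];\mathbb R): k_0=0\}$ with Wiener measure $\mu$, the law of a standard Brownian motion $B$ on $[0,1]$; write $\mathbb E[F(B)]=\int F\,d\mu$. Let $L=L^2(0,1)$ with scalar product $\langle\cdot,\cdot\rangle$, and let $\mathrm{Exp}(C)$ be the linear span of the functions $\exp(\langle\cdot,k\rangle)$, $k\in C$. Let $\nabla$ be the closure in $L^2(\mu)$ of the Fréchet gradient in $L$ defined on $\mathrm{Exp}(C)$, $\mathrm{Dom}(\mathcal E)$ its domain, and $\mathcal E(F,G)=\frac12\mathbb E[\langle\nabla F(B),\nabla G(B)\rangle]$; $\mathrm{Dom}(\mathcal E)$ is a Hilbert space for the inner product $\mathbb E[F(B)G(B)]+\mathcal E(F,G)$. Let $A=\frac12\frac{d^2}{d\theta^2}$ with boundary conditions $h(0)=h'(1)=0$, with eigenfunctions $e_i(\theta)=\sqrt2\sin(\sqrt{\lambda_i}\,\theta)$, $Ae_i=-\frac{\lambda_i}2e_i$, $\lambda_i=\frac{\pi^2}4(2i-1)^2$, $i\ge1$. For $z\in C$ and $t>0$ let $z(t,\cdot)=e^{tA}z$, let $c^t_{0,\theta}=\sum_{i\ge1}\frac{e^{-\lambda_it}}{\lambda_i}|e_i'(\theta)|^2$,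 and let $P_tG(z)=\int G(y)\,\mathcal N(e^{tA}z,Q_t)(dy)$ with $Q_t=\int_0^te^{2sA}\,ds$ be the Ornstein–Uhlenbeck semigroup associated with $\mathcal E$. Put $\mathcal RG=\int_0^\infty(P_tG-\mu(G))\,dt$. Let $\rho\in C_c^\infty(-1,1)$ be nonnegative and even with $\int_{\mathbb R}\rho\,dx=1$, and $\rho_\epsilon=\epsilon^{-1}\rho(\cdot/\epsilon)$. Extend each path $\ell\in C$ to $\mathbb R$ by $\ell_\sigma=0$ for $\sigma<0$ and $\ell_\sigma=\ell_1$ for $\sigma>1$, and for $\epsilon>0$ and $\theta\in[0,1]$ let $\ell_{\epsilon,\theta}=\int_{\mathbb R}\rho_\epsilon(\sigma-\theta)\,\ell_\sigma\,d\sigma$, $\dot\ell_{\epsilon,\theta}=\frac{d}{d\theta}\ell_{\epsilon,\theta}$, and $$:\!\dot B^2_{\epsilon,\theta}\!:\;=(\dot B_{\epsilon,\theta})^2-\mathbb E[(\dot B_{\epsilon,\theta})^2],\qquad \mathcal G_\epsilon(B)=\int_0^1:\!\dot B^2_{\epsilon,\theta}\!:\,d\theta .$$ Then $\mathcal G_\epsilon\in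 L^2(\mu)$ and $\mathcal R\mathcal G_\epsilon\in\mathrm{Dom}(\mathcal E)$ for every $\epsilon>0$. The formula $$\mathcal R\mathcal G_0(z)=\int_0^\infty\int_0^1\left[\left(\frac{\partial z(t,\theta)}{\partial\theta}\right)^2-c^t_{0,\theta}\right]d\theta\,dt,\qquad \mu\text{-a.e. }z\in C,$$ where the integral converges absolutely for $\mu$-a.e. $z$, defines an element of $\mathrm{Dom}(\mathcal E)$, and $\mathcal R\mathcal G_\epsilon$ converges weakly to $\mathcal R\mathcal G_0$ in $\mathrm{Dom}(\mathcal E)$ as $\epsilon\to0$. For all $F\in\mathrm{Dom}(\mathcal E)$ the limit below exists and $$\mathbb E[\langle\nabla F(B),B\rangle]=\lim_{\epsilon\to0}\mathbb E\left[F(B)\int_0^1:\!\dot B^2_{\epsilon,\theta}\!:\,d\theta\right]=\mathcal E(F,\mathcal R\mathcal G_0).$$ -/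

import Mathlib

open MeasureTheory ProbabilityTheory Filter Topology
open scoped unitInterval

noncomputable section

/-- The path space `C`: continuous `k : [0,1] → ℝ` with `k 0 = 0`, with the supremum norm. -/
def wienerPaths : Submodule ℝ C(I, ℝ) where
  carrier := {k | k 0 = 0}
  add_mem' := by
    intro a b ha hb
    simp only [Set.mem_ofPred_eq] at ha hb ⊢
    simp [ha, hb]
  zero_mem' := by simp
  smul_mem' := by
    intro c a ha
    simp only [Set.mem_ofPred_eq] at ha ⊢
    simp [ha]

/-- `C` as a type. -/
abbrev WienerPath : Type := wienerPaths

instance instMeasurableSpaceWienerPath : MeasurableSpace WienerPath := borel WienerPath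

instance instBorelSpaceWienerPath : BorelSpace WienerPath := ⟨rfl⟩

/-- The Hilbert space `L = L²(0,1)`. -/
abbrev L2unit : Type := Lp ℝ 2 (volume : Measure I)

/-- The inclusion of `C` in `L`. -/
def toL (k : WienerPath) : L2unit := ContinuousMap.toLp 2 (volume : Measure I) ℝ (k : C(I, ℝ))

/-- `⟨h, k⟩ = ∫₀¹ h k dθ` for paths `h`, `k`. -/
def pairing (h k : WienerPath) : ℝ := inner ℝ (toL h) (toL k)

/-- The path `k` as a function on the whole line, constant on `(-∞, 0]` (equal to `k 0 = 0`)
and on `[1, ∞)` (equal to `k 1`). -/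
def extend (k : WienerPath) (x : ℝ) : ℝ := (k : C(I, ℝ)) (Set.projIcc 0 1 zero_le_one x)

/-- `μ` is the Wiener measure on `C`: under `μ` the coordinate process is a standard Brownian
motion on `[0,1]`, i.e. the centred Gaussian process with covariance `θ ∧ θ'`. -/
structure IsWienerMeasure (μ : Measure WienerPath) : Prop where
  gaussian : IsGaussianProcess (fun (θ : I) (ω : WienerPath) => (ω : C(I, ℝ)) θ) μ
  mean : ∀ θ : I, ∫ ω : WienerPath, (ω : C(I, ℝ)) θ ∂μ = 0
  cov : ∀ θ θ' : I,
    ∫ ω : WienerPath, (ω : C(I, ℝ)) θ * (ω : C(I, ℝ)) θ' ∂μ = min (θ : ℝ) (θ' : ℝ)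

/-! ### The gradient and the Dirichlet form -/

/-- `Exp(C)`: the span of the functions `exp ⟨·, k⟩`, `k ∈ C`, seen as functions on `L`. -/
def expSpace : Submodule ℝ (L2unit → ℝ) :=
  Submodule.span ℝ (Set.range fun (k : WienerPath) (x : L2unit) => Real.exp (inner ℝ x (toL k)))

/-- The graph, in `L²(μ) × L²(μ; L)`, of `f ↦ ∇f` on `Exp(C)`, where `∇f` is the Fréchet
gradient in `L`. -/
def expGraph (μ : Measure WienerPath) : Submodule ℝ (Lp ℝ 2 μ × Lp L2unit 2 μ) :=
  Submodule.span ℝ {p | ∃ f ∈ expSpace,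
    (p.1 : WienerPath → ℝ) =ᵐ[μ] (fun ω => f (toL ω)) ∧
    (p.2 : WienerPath → L2unit) =ᵐ[μ] (fun ω => gradient f (toL ω))}

/-- The closure of `∇` in `L²(μ)`: its graph is the closure of the graph of `∇` on `Exp(C)`. -/
def gradOp (μ : Measure WienerPath) : Lp ℝ 2 μ →ₗ.[ℝ] Lp L2unit 2 μ :=
  (expGraph μ).topologicalClosure.toLinearPMap

/-- `Dom(𝓔)`. -/
abbrev DomE (μ : Measure WienerPath) : Submodule ℝ (Lp ℝ 2 μ) := (gradOp μ).domain

/-- The Dirichlet form `𝓔(F, G) = ½ 𝔼[⟨∇F(B), ∇G(B)⟩]`. -/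
def energy (μ : Measure WienerPath) (F G : DomE μ) : ℝ :=
  (1 / 2) * ∫ ω, inner ℝ (gradOp μ F ω) (gradOp μ G ω) ∂μ

/-- The Hilbert space inner product of `Dom(𝓔)`: `𝔼[F(B) G(B)] + 𝓔(F, G)`. -/
def formInner (μ : Measure WienerPath) (F G : DomE μ) : ℝ :=
  (∫ ω, (F : Lp ℝ 2 μ) ω * (G : Lp ℝ 2 μ) ω ∂μ) + energy μ F G

/-! ### The Ornstein–Uhlenbeck semigroup associated with `𝓔` -/

/-- The eigenvalues `λ_i = π²/4 (2i-1)²`, `i ≥ 1`; the index is shifted to start from `0`. -/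
def eigval (i : ℕ) : ℝ := Real.pi ^ 2 / 4 * (2 * (i : ℝ) + 1) ^ 2

/-- The eigenfunctions `e_i(θ) = √2 sin(√λ_i θ)`. -/
def eigfun (i : ℕ) (x : ℝ) : ℝ := Real.sqrt 2 * Real.sin (Real.sqrt (eigval i) * x)

/-- `e_i` as an element of `C`. -/
def eigPath (i : ℕ) : WienerPath :=
  ⟨⟨fun θ : I => eigfun i (θ : ℝ), by unfold eigfun; fun_prop⟩, by
    change eigfun i ((0 : I) : ℝ) = 0
    simp [eigfun]⟩

/-- The heat semigroup `e^{tA} z`, i.e. `z(t, ·)`, for `A = ½ d²/dθ²` with the boundary conditions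
`h(0) = h'(1) = 0`. As `A e_i = -(λ_i/2) e_i` and `(e_i)` is a complete orthonormal system of `L`,
it is the sum of `e^{-λ_i t/2} ⟨z, e_i⟩ e_i`, which converges in `C` for `t > 0`. -/
def heat (t : ℝ) (z : WienerPath) : WienerPath :=
  ∑' i : ℕ, (Real.exp (-(eigval i * t / 2)) * pairing z (eigPath i)) • eigPath i

/-- The operator `(I - e^{2tA})^{1/2}` on `C`, for `t > 0`, written as the identity minus
the sum of `(1 - (1 - e^{-λ_i t})^{1/2}) ⟨y, e_i⟩ e_i`, which converges in `C`. -/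
def noiseOp (t : ℝ) (y : WienerPath) : WienerPath :=
  y - ∑' i : ℕ,
    ((1 - Real.sqrt (1 - Real.exp (-(eigval i * t)))) * pairing y (eigPath i)) • eigPath i

/-- The Gaussian measure `𝓝(e^{tA} z, Q_t)` on `C`, for `t > 0` and `μ` the Wiener measure.
Since `μ = 𝓝(0, Q)`, with `Q = (-2A)⁻¹`, and `Q_t = (I - e^{2tA}) Q`, it is the law under `μ(dy)`
of `e^{tA} z + (I - e^{2tA})^{1/2} y`. -/
def ouKernel (μ : Measure WienerPath) (t : ℝ) (z : WienerPath) : Measure WienerPath :=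
  μ.map (fun y => heat t z + noiseOp t y)

/-- `P_t G(z) = ∫ G(y) 𝓝(e^{tA} z, Q_t)(dy)`. -/
def ouSemigroup (μ : Measure WienerPath) (t : ℝ) (G : WienerPath → ℝ) (z : WienerPath) : ℝ :=
  ∫ y, G y ∂(ouKernel μ t z)

/-- `𝓡G(z) = ∫₀^∞ (P_t G(z) - μ(G)) dt`. -/
def potential (μ : Measure WienerPath) (G : WienerPath → ℝ) (z : WienerPath) : ℝ :=
  ∫ t in Set.Ioi (0 : ℝ), (ouSemigroup μ t G z - ∫ y, G y ∂μ)

/-! ### The regularized square of the white noise -/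

/-- Smooth symmetric mollifiers: `ρ ∈ C_c^∞(-1,1)`, `ρ ≥ 0`, `∫ ρ = 1`, `ρ(x) = ρ(-x)`. -/
structure IsMollifier (ρ : ℝ → ℝ) : Prop where
  smooth : ContDiff ℝ (⊤ : ℕ∞) ρ
  support : tsupport ρ ⊆ Set.Ioo (-1) 1
  nonneg : ∀ x, 0 ≤ ρ x
  integral : ∫ x, ρ x = 1
  symm : ∀ x, ρ x = ρ (-x)

/-- `ω_{ε,θ} = (ρ_ε * ω)_θ`, with `ρ_ε = ε⁻¹ ρ(·/ε)` and `ω` continued by constants outside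
`[0,1]`, so that `ω'_{ε,·}` is the mollification by `ρ_ε` of the white noise `dω` on `[0,1]`. -/
def mollify (ρ : ℝ → ℝ) (ε : ℝ) (ω : WienerPath) (θ : ℝ) : ℝ :=
  ∫ s : ℝ, (1 / ε * ρ ((s - θ) / ε)) * extend ω s

/-- `𝓖_ε(ω) = ∫₀¹ ((ω'_{ε,θ})² - 𝔼[(B'_{ε,θ})²]) dθ`. -/
def renSquare (μ : Measure WienerPath) (ρ : ℝ → ℝ) (ε : ℝ) (ω : WienerPath) : ℝ :=
  ∫ θ in (0 : ℝ)..1,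
    ((deriv (mollify ρ ε ω) θ) ^ 2 - ∫ ω', (deriv (mollify ρ ε ω') θ) ^ 2 ∂μ)

/-- `c^t_{0,θ} = ∑_i e^{-λ_i t} / λ_i |e_i'(θ)|²`. -/
def cZero (t θ : ℝ) : ℝ :=
  ∑' i : ℕ, Real.exp (-(eigval i * t)) / eigval i * (deriv (eigfun i) θ) ^ 2

/-- `(∂_θ z(t,θ))² - c^t_{0,θ}`. -/
def limitDensity (z : WienerPath) (t θ : ℝ) : ℝ :=
  (deriv (extend (heat t z)) θ) ^ 2 - cZero t θ

end

noncomputable section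

/-! ### The path space as a Banach space -/

/-! The limit has a closed form: 𝓡𝓖_0(z) = ‖z‖²_L − ∑ 1/λ_i, whose gradient is 2z, so 𝓔(F, 𝓡𝓖_0) =
𝔼⟨∇F(B), B⟩. The closed form comes from an isometry. Write f_i = √2 cos(√λ_i ·), so that e_i = √λ_i
∫₀^· f_i. The heat flow of e_i has θ-derivative √λ_i e^{-λ_i t/2} f_i, and λ_i ∫₀^∞ e^{-λ_i t} dt =
1. Hence z ↦ (t ↦ ∂_θ z(t,·)) is an isometry of L into L²((0,∞); L) (`heatLift`).

The regularized functionals are handled by the same device. For a bounded operator V : C → L let G =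
‖V ω‖² − 𝔼‖V B‖² (`centredSquare`), let T = V ∘ `primitive`, and let S = `quadLift T` be the
operator z ↦ (t ↦ T ∂_θ z(t,·)). Expanding the square under the Ornstein–Uhlenbeck kernel gives P_t
G(z) = ‖T ∂_θ z(t,·)‖² − ∑ e^{-λ_i t} ‖T f_i‖². Integrating in time gives 𝓡G = ‖S z‖² − const
(`potential_centredSquare`). This is a bounded quadratic form on L, so it lies in Dom(𝓔) with
gradient 2 S*S z (`hasClosedGrad_norm_sq`).

The identity 𝔼[F G] = 𝔼⟨∇F, S*S B⟩ = 𝓔(F, 𝓡G) is first checked on F = exp⟨k,·⟩. With Q the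
covariance operator, so that Q e_i = e_i/λ_i, a Gaussian tilt makes the two sides ‖V Q k‖² and ⟨S k,
S Q k⟩ times the same constant. These agree by a Lyapunov identity, verified on the eigenbasis
(`two_mul_inner_map_covOp`). Continuity extends the formula to the closure of the graph
(`integral_mul_centredSquare`). The same scheme, with the vector fields e^m e_i in place of S*S B,
shows that ∇ is closable (`closable`).

For V = V_ε, the mollified derivative, T_ε is mollification of functions in L. It is a contraction
and tends to the identity on each f_i, so `quadLift T_ε` tends strongly to the isometry `heatLift`
(`tendsto_quadLift`). Dominated convergence then gives both 𝓔(F, 𝓡𝓖_ε) → 𝔼⟨∇F, B⟩ and 𝔼[F 𝓡𝓖_ε] →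
𝔼[F 𝓡𝓖_0]. -/

instance instNormedAddCommGroupWienerPath : NormedAddCommGroup WienerPath :=
  Submodule.normedAddCommGroup wienerPaths

instance instNormedSpaceWienerPath : NormedSpace ℝ WienerPath :=
  Submodule.normedSpace wienerPaths

/-- Evaluation of a path at `θ`. -/
def evalPath (θ : I) : WienerPath →L[ℝ] ℝ :=
  (ContinuousMap.evalCLM ℝ θ).comp wienerPaths.subtypeL

@[simp] lemma evalPath_apply (θ : I) (k : WienerPath) : evalPath θ k = (k : C(I, ℝ)) θ := rfl

lemma isClosed_wienerPaths : IsClosed (wienerPaths : Set C(I, ℝ)) := by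
  have : (wienerPaths : Set C(I, ℝ)) = {k | ContinuousMap.evalCLM ℝ (0 : I) k = 0} := rfl
  rw [this]
  exact isClosed_eq (ContinuousLinearMap.continuous _) continuous_const

instance instCompleteSpaceWienerPath : CompleteSpace WienerPath :=
  isClosed_wienerPaths.completeSpace_coe

instance instSecondCountableWienerPath : SecondCountableTopology WienerPath :=
  TopologicalSpace.Subtype.secondCountableTopology _

/-- The inclusion of `C` in `L` as a continuous linear map. -/
def toLCLM : WienerPath →L[ℝ] L2unit :=
  (ContinuousMap.toLp 2 (volume : Measure I) ℝ).comp wienerPaths.subtypeL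

@[simp] lemma toLCLM_apply (k : WienerPath) : toLCLM k = toL k := rfl

lemma path_ext {k l : WienerPath} (h : ∀ θ, (k : C(I, ℝ)) θ = (l : C(I, ℝ)) θ) : k = l :=
  Subtype.ext (ContinuousMap.ext h)

lemma abs_path_le_norm (k : WienerPath) (θ : I) : |(k : C(I, ℝ)) θ| ≤ ‖k‖ :=
  (k : C(I, ℝ)).norm_coe_le_norm θ

lemma norm_toL_le (k : WienerPath) : ‖toL k‖ ≤ ‖k‖ := by
  have h := ContinuousMap.toLp_norm_le (p := 2) (μ := (volume : Measure I)) (𝕜 := ℝ) (E := ℝ)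
  have h2 := (ContinuousMap.toLp (E := ℝ) 2 (volume : Measure I) ℝ).le_of_opNorm_le h (k : C(I, ℝ))
  have h3 : ((measureUnivNNReal (volume : Measure I)) : ℝ) = 1 := by
    simp [measureUnivNNReal]
  simpa [toL, h3] using h2

/-! ### Gaussianity -/

/-- An almost sure limit of real Gaussian variables is Gaussian (centred case). -/
lemma exists_gaussianReal_of_tendsto {Ω : Type*} [MeasurableSpace Ω] {μ : Measure Ω}
    [IsProbabilityMeasure μ] {X : ℕ → Ω → ℝ} {Y : Ω → ℝ} (hY : Measurable Y)
    (hX : ∀ n, Measurable (X n))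
    (hlaw : ∀ n, ∃ v : NNReal, μ.map (X n) = gaussianReal 0 v)
    (hlim : ∀ ω, Tendsto (fun n => X n ω) atTop (𝓝 (Y ω))) :
    ∃ v : NNReal, μ.map Y = gaussianReal 0 v := by
  choose v hv using hlaw
  have hchar : ∀ t : ℝ, Tendsto (fun n => charFun (μ.map (X n)) t) atTop
      (𝓝 (charFun (μ.map Y) t)) := by
    intro t
    simp only [charFun_apply_real]
    rw [integral_map hY.aemeasurable (by fun_prop)]
    have : ∀ n, ∫ x, Complex.exp (t * x * Complex.I) ∂(μ.map (X n))
        = ∫ ω, Complex.exp (t * X n ω * Complex.I) ∂μ := fun n =>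
      integral_map (hX n).aemeasurable (by fun_prop)
    simp only [this]
    refine tendsto_integral_of_dominated_convergence (fun _ => (1 : ℝ)) (fun n => ?_)
      (integrable_const _) (fun n => ae_of_all _ fun ω => ?_) (ae_of_all _ fun ω => ?_)
    · have := hX n
      fun_prop
    · rw [← Complex.ofReal_mul, Complex.norm_exp_ofReal_mul_I]
    · exact (Continuous.tendsto (f := fun x : ℝ => Complex.exp (t * x * Complex.I))
        (by fun_prop) _).comp (hlim ω)
  have hreal : ∀ t : ℝ, Tendsto (fun n => Real.exp (-(v n * t ^ 2 / 2))) atTop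
      (𝓝 (charFun (μ.map Y) t).re) := by
    intro t
    have h1 := (Complex.continuous_re.tendsto _).comp (hchar t)
    refine h1.congr fun n => ?_
    rw [Function.comp, hv n, charFun_gaussianReal]
    rw [← Complex.exp_ofReal_re]
    congr 2
    push_cast; ring
  have hchar' : ∀ t : ℝ, charFun (μ.map Y) t = ((charFun (μ.map Y) t).re : ℂ) := by
    intro t
    refine tendsto_nhds_unique (hchar t) ?_
    refine ((Complex.continuous_ofReal.tendsto _).comp (hreal t)).congr fun n => ?_
    rw [Function.comp, hv n, charFun_gaussianReal]
    push_cast; congr 1; ring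
  -- The variances v n are recovered from one value: each characteristic function is φ(t) =
  -- φ(1)^{t²}, and this relation passes to the limit.
  set a : ℝ := (charFun (μ.map Y) 1).re with ha
  have ha0 : 0 ≤ a := ge_of_tendsto' (hreal 1) fun n => (Real.exp_pos _).le
  have hpow : ∀ t : ℝ, t ≠ 0 → (charFun (μ.map Y) t).re = a ^ (t ^ 2) := by
    intro t ht
    refine tendsto_nhds_unique (hreal t) ?_
    have := (hreal 1).rpow_const (p := t ^ 2) (Or.inr (by positivity))
    refine this.congr fun n => ?_
    rw [← Real.exp_mul]; congr 1; ring
  have hprob : IsProbabilityMeasure (μ.map Y) := Measure.isProbabilityMeasure_map hY.aemeasurable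
  -- The case a = 0 would mean that the variances escape to infinity. The limit characteristic
  -- function would then vanish off 0, against its continuity at 0.
  have hapos : 0 < a := by
    refine lt_of_le_of_ne ha0 fun h0 => ?_
    have hc : Tendsto (fun t : ℝ => (charFun (μ.map Y) t).re) (𝓝[≠] 0) (𝓝 1) := by
      have : Continuous fun t : ℝ => (charFun (μ.map Y) t).re :=
        Complex.continuous_re.comp continuous_charFun
      have h := this.tendsto 0
      simp only [charFun_zero, probReal_univ, Complex.ofReal_one, Complex.one_re] at h
      exact h.mono_left nhdsWithin_le_nhds
    have hz : Tendsto (fun t : ℝ => (charFun (μ.map Y) t).re) (𝓝[≠] 0) (𝓝 0) := by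
      refine tendsto_const_nhds.congr' ?_
      filter_upwards [self_mem_nhdsWithin] with t ht
      rw [hpow t ht, ← h0, Real.zero_rpow (pow_ne_zero 2 ht)]
    exact zero_ne_one (tendsto_nhds_unique hz hc)
  have ha1 : a ≤ 1 := le_of_tendsto' (hreal 1) fun n => by
    rw [Real.exp_le_one_iff]; have := (v n).2; simp only [one_pow]
    linarith [NNReal.coe_nonneg (v n)]
  obtain ⟨w, hw⟩ : ∃ w : NNReal, (w : ℝ) = -2 * Real.log a :=
    ⟨⟨-2 * Real.log a, by nlinarith [Real.log_nonpos ha0 ha1]⟩, rfl⟩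
  refine ⟨w, Measure.ext_of_charFun (funext fun t => ?_)⟩
  rw [hchar' t, charFun_gaussianReal]
  by_cases ht : t = 0
  · simp [ht]
  · rw [hpow t ht, Real.rpow_def_of_pos hapos]
    push_cast; congr 1
    have : ((w : ℝ) : ℂ) = -2 * Real.log a := by rw [hw]; norm_cast
    rw [this]; ring

variable {μ : Measure WienerPath}

lemma IsWienerMeasure.isProbabilityMeasure (hμ : IsWienerMeasure μ) : IsProbabilityMeasure μ :=
  hμ.gaussian.isProbabilityMeasure

lemma IsWienerMeasure.map_sum_eval (hμ : IsWienerMeasure μ) (n : ℕ) (p : Fin n → I)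
    (c : Fin n → ℝ) : ∃ v : NNReal,
      μ.map (fun ω : WienerPath => ∑ i, c i * (ω : C(I, ℝ)) (p i)) = gaussianReal 0 v := by
  classical
  have h1 : IsGaussianProcess (fun (i : Fin n) (ω : WienerPath) => c i • (ω : C(I, ℝ)) (p i)) μ :=
    (hμ.gaussian.comp_right p).smul c
  have h2 : HasGaussianLaw (fun ω : WienerPath => ∑ i ∈ Finset.univ, c i • (ω : C(I, ℝ)) (p i)) μ :=
    h1.hasGaussianLaw_fun_sum
  have h3 := h2.map_eq_gaussianReal
  have hi : ∀ i, Integrable (fun ω : WienerPath => (ω : C(I, ℝ)) (p i)) μ := fun i =>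
    (hμ.gaussian.hasGaussianLaw_eval (p i)).integrable
  have h4 : ∫ ω : WienerPath, (∑ i, c i • (ω : C(I, ℝ)) (p i)) ∂μ = 0 := by
    rw [integral_finsetSum (f := fun i (ω : WienerPath) => c i • (ω : C(I, ℝ)) (p i)) _
      fun i _ => (hi i).smul (c i)]
    simp [integral_const_mul, hμ.mean]
  rw [h4] at h3
  exact ⟨_, h3⟩

/-- Extend ℓ to all continuous functions by Hahn–Banach. On Bernstein approximations the extension
is a finite combination of point evaluations, hence Gaussian, and it converges to ℓ at every path.
-/
lemma IsWienerMeasure.exists_map_dual (hμ : IsWienerMeasure μ) (ℓ : StrongDual ℝ WienerPath) :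
    ∃ v : NNReal, μ.map ℓ = gaussianReal 0 v := by
  have := hμ.isProbabilityMeasure
  obtain ⟨g, hg, -⟩ : ∃ g : StrongDual ℝ C(I, ℝ), (∀ x : wienerPaths, g x = ℓ x) ∧ ‖g‖ = ‖ℓ‖ :=
    exists_extension_norm_eq wienerPaths ℓ
  have key : ∀ (n : ℕ) (ω : WienerPath), g (bernsteinApproximation n (ω : C(I, ℝ)))
      = ∑ k : Fin (n + 1), g (bernstein n k) * evalPath (bernstein.z k) ω := by
    intro n ω
    rw [bernsteinApproximation, map_sum]
    refine Finset.sum_congr rfl fun k _ => ?_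
    rw [mul_comm, ← smul_eq_mul, ← map_smul]
    congr 1
    ext x
    simp [mul_comm]
  refine exists_gaussianReal_of_tendsto (Y := ℓ)
    (X := fun n (ω : WienerPath) => g (bernsteinApproximation n (ω : C(I, ℝ))))
    ℓ.continuous.measurable (fun n => ?_) (fun n => ?_) (fun ω => ?_)
  · simp only [key]
    fun_prop
  · simp only [key]
    exact hμ.map_sum_eval _ _ _
  · rw [← hg ω]
    exact (g.continuous.tendsto _).comp (bernsteinApproximation_uniform _)

lemma IsWienerMeasure.isGaussian (hμ : IsWienerMeasure μ) : IsGaussian μ :=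
  isGaussian_of_map_eq_gaussianReal fun ℓ => ⟨0, hμ.exists_map_dual ℓ⟩

/-! ### Moments -/

lemma IsWienerMeasure.integral_id (hμ : IsWienerMeasure μ) : ∫ ω, ω ∂μ = 0 := by
  have := hμ.isGaussian
  refine path_ext fun θ => ?_
  have h := IsGaussian.integral_dual (μ := μ) (evalPath θ)
  rw [evalPath_apply] at h
  rw [← h]
  simpa using hμ.mean θ

lemma IsWienerMeasure.integral_dual (hμ : IsWienerMeasure μ) (ℓ : WienerPath →L[ℝ] ℝ) :
    ∫ ω, ℓ ω ∂μ = 0 := by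
  have := hμ.isGaussian
  have h := IsGaussian.integral_dual (μ := μ) ℓ
  rw [hμ.integral_id, map_zero] at h
  exact h

/-- Fernique's theorem. Integrability of functionals of polynomial growth is reduced to this. -/
lemma IsWienerMeasure.memLp_norm (hμ : IsWienerMeasure μ) (p : ENNReal) (hp : p ≠ ⊤) :
    MemLp (fun ω : WienerPath => ‖ω‖) p μ := by
  have := hμ.isGaussian
  exact (IsGaussian.memLp_id μ p hp).norm

lemma IsWienerMeasure.memLp_norm_pow (hμ : IsWienerMeasure μ) (n : ℕ) (p : ENNReal) (hp : p ≠ ⊤) :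
    MemLp (fun ω : WienerPath => ‖ω‖ ^ n) p μ := by
  have := hμ.isProbabilityMeasure
  rcases Nat.eq_zero_or_pos n with rfl | hn
  · simp only [pow_zero]
    exact memLp_const 1
  have e : (n : ENNReal) * p / n = p := by
    rw [ENNReal.mul_div_right_comm, ENNReal.div_self (Nat.cast_ne_zero.2 hn.ne')
      (ENNReal.natCast_ne_top n), one_mul]
  have h := (hμ.memLp_norm (n * p)
    (ENNReal.mul_ne_top (ENNReal.natCast_ne_top n) hp)).norm_rpow_div (n : ENNReal)
  rw [e] at h
  refine h.congr_norm (by fun_prop) (ae_of_all _ fun ω => ?_)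
  simp only [norm_norm, ENNReal.toReal_natCast, Real.rpow_natCast]

lemma IsWienerMeasure.memLp_of_le_norm_pow {E : Type*} [NormedAddCommGroup E]
    (hμ : IsWienerMeasure μ) {f : WienerPath → E}
    (hf : AEStronglyMeasurable f μ) (n : ℕ) (C : ℝ) (h : ∀ ω, ‖f ω‖ ≤ C * ‖ω‖ ^ n)
    (p : ENNReal) (hp : p ≠ ⊤) : MemLp f p μ := by
  refine ((hμ.memLp_norm_pow n p hp).const_mul C).mono hf (ae_of_all _ fun ω => ?_)
  exact (h ω).trans (le_abs_self _)

lemma IsWienerMeasure.integrable_of_le_norm_pow {E : Type*} [NormedAddCommGroup E]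
    (hμ : IsWienerMeasure μ) {f : WienerPath → E}
    (hf : AEStronglyMeasurable f μ) (n : ℕ) (C : ℝ) (h : ∀ ω, ‖f ω‖ ≤ C * ‖ω‖ ^ n) :
    Integrable f μ :=
  memLp_one_iff_integrable.1 (hμ.memLp_of_le_norm_pow hf n C h 1 (by simp))

/-! ### Exponential moments and Gaussian tilts. -/

lemma IsWienerMeasure.map_dual (hμ : IsWienerMeasure μ) (ℓ : WienerPath →L[ℝ] ℝ) :
    μ.map ℓ = gaussianReal 0 (∫ ω, ℓ ω ^ 2 ∂μ).toNNReal := by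
  have := hμ.isGaussian
  rw [IsGaussian.map_eq_gaussianReal ℓ, hμ.integral_dual ℓ,
    variance_of_integral_eq_zero (by fun_prop) (hμ.integral_dual ℓ)]

lemma IsWienerMeasure.integrable_exp_dual (hμ : IsWienerMeasure μ) (ℓ : WienerPath →L[ℝ] ℝ) :
    Integrable (fun ω => Real.exp (ℓ ω)) μ := by
  have h := integrable_exp_mul_gaussianReal (μ := 0) (v := (∫ ω, ℓ ω ^ 2 ∂μ).toNNReal) 1
  rw [← hμ.map_dual ℓ] at h
  have := h.comp_measurable (by fun_prop : Measurable ℓ)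
  simpa [Function.comp_def] using this

lemma IsWienerMeasure.integral_exp_dual (hμ : IsWienerMeasure μ) (ℓ : WienerPath →L[ℝ] ℝ) :
    ∫ ω, Real.exp (ℓ ω) ∂μ = Real.exp ((∫ ω, ℓ ω ^ 2 ∂μ) / 2) := by
  have h := mgf_gaussianReal (hμ.map_dual ℓ) 1
  have h0 : 0 ≤ ∫ ω, ℓ ω ^ 2 ∂μ := integral_nonneg fun ω => sq_nonneg _
  simpa [mgf, h0] using h

lemma IsWienerMeasure.memLp_exp_dual (hμ : IsWienerMeasure μ) (ℓ : WienerPath →L[ℝ] ℝ)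
    (n : ℕ) (hn : n ≠ 0) :
    MemLp (fun ω => Real.exp (ℓ ω)) n μ := by
  have h : Integrable (fun ω => ‖Real.exp (ℓ ω)‖ ^ n) μ := by
    have := hμ.integrable_exp_dual ((n : ℝ) • ℓ)
    refine this.congr (ae_of_all _ fun ω => ?_)
    simp [← Real.exp_nat_mul]
  have h2 := (integrable_norm_rpow_iff (f := fun ω => Real.exp (ℓ ω)) (μ := μ) (p := n)
    (by fun_prop) (by exact_mod_cast hn) (by simp)).1
  exact h2 (by simpa using h)

lemma IsWienerMeasure.integrable_dual_mul (hμ : IsWienerMeasure μ) (ℓ m : WienerPath →L[ℝ] ℝ) :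
    Integrable (fun ω => ℓ ω * m ω) μ := by
  refine hμ.integrable_of_le_norm_pow (by fun_prop) 2 (‖ℓ‖ * ‖m‖) fun ω => ?_
  rw [norm_mul]
  calc ‖ℓ ω‖ * ‖m ω‖ ≤ (‖ℓ‖ * ‖ω‖) * (‖m‖ * ‖ω‖) := by
        gcongr <;> exact ContinuousLinearMap.le_opNorm _ _
    _ = _ := by ring

/-- The moment generating function of a dual functional under an exponential tilt. -/
lemma IsWienerMeasure.integral_exp_add (hμ : IsWienerMeasure μ) (m ℓ : WienerPath →L[ℝ] ℝ) (s : ℝ) :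
    ∫ ω, Real.exp (s * ℓ ω) * Real.exp (m ω) ∂μ
      = Real.exp ((∫ ω, m ω ^ 2 ∂μ) / 2)
        * Real.exp ((∫ ω, m ω * ℓ ω ∂μ) * s + (∫ ω, ℓ ω ^ 2 ∂μ) * s ^ 2 / 2) := by
  have h := hμ.integral_exp_dual (m + s • ℓ)
  have e1 : ∀ ω, Real.exp (s * ℓ ω) * Real.exp (m ω) = Real.exp ((m + s • ℓ) ω) := fun ω => by
    rw [← Real.exp_add]; simp [add_comm]
  simp only [e1]
  rw [h, ← Real.exp_add]
  congr 1
  have e2 : ∀ ω, (m + s • ℓ) ω ^ 2 = m ω * m ω + 2 * s * (m ω * ℓ ω) + s ^ 2 * (ℓ ω * ℓ ω) :=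
    fun ω => by simp; ring
  simp only [e2]
  have i1 := hμ.integrable_dual_mul m m
  have i2 := hμ.integrable_dual_mul m ℓ
  have i3 := hμ.integrable_dual_mul ℓ ℓ
  have i12 : Integrable (fun ω => m ω * m ω + 2 * s * (m ω * ℓ ω)) μ := i1.add (i2.const_mul _)
  rw [integral_add i12 (i3.const_mul _), integral_add i1 (i2.const_mul _),
    integral_const_mul, integral_const_mul]
  simp only [pow_two]
  ring

/-- Under the tilt by `exp m`, a dual functional `ℓ` is Gaussian with mean `𝔼[m ℓ]` and
unchanged variance. -/
lemma IsWienerMeasure.map_tilted (hμ : IsWienerMeasure μ) (m ℓ : WienerPath →L[ℝ] ℝ) :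
    (μ.tilted m).map ℓ = gaussianReal (∫ ω, m ω * ℓ ω ∂μ) (∫ ω, ℓ ω ^ 2 ∂μ).toNNReal := by
  have := hμ.isProbabilityMeasure
  have hp : IsProbabilityMeasure (μ.tilted m) :=
    isProbabilityMeasure_tilted (hμ.integrable_exp_dual m)
  have h0 : 0 ≤ ∫ ω, ℓ ω ^ 2 ∂μ := integral_nonneg fun ω => sq_nonneg _
  have hmgf : mgf ℓ (μ.tilted m)
      = mgf id (gaussianReal (∫ ω, m ω * ℓ ω ∂μ) (∫ ω, ℓ ω ^ 2 ∂μ).toNNReal) := by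
    ext s
    rw [mgf_id_gaussianReal, mgf, integral_tilted]
    simp only [smul_eq_mul]
    have : ∀ ω, Real.exp (m ω) / (∫ x, Real.exp (m x) ∂μ) * Real.exp (s * ℓ ω)
        = (∫ x, Real.exp (m x) ∂μ)⁻¹ * (Real.exp (s * ℓ ω) * Real.exp (m ω)) := fun ω => by ring
    simp only [this]
    rw [integral_const_mul, hμ.integral_exp_add, hμ.integral_exp_dual, ← mul_assoc,
      inv_mul_cancel₀ (Real.exp_pos _).ne', one_mul, Real.coe_toNNReal _ h0]
  -- The moment generating functions agree on all of ℝ and are finite there, so their complex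
  -- extensions agree on the whole plane and determine the law.
  have hset := integrableExpSet_eq_of_mgf hmgf
  have hE := eqOn_complexMGF_of_mgf hmgf
  rw [hset, integrableExpSet_id_gaussianReal] at hE
  have h := Measure.ext_of_complexMGF_eq (X := ℓ) (Y := id) (μ := μ.tilted m)
    (μ' := gaussianReal (∫ ω, m ω * ℓ ω ∂μ) (∫ ω, ℓ ω ^ 2 ∂μ).toNNReal)
    (by fun_prop) aemeasurable_id (funext fun z => hE (by simp))
  simpa using h

/-- Cameron–Martin: tilting by exp m shifts the mean of ℓ to its covariance with m. The next lemma
reads off the second moment in the same way. -/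
lemma IsWienerMeasure.integral_dual_mul_exp (hμ : IsWienerMeasure μ) (m ℓ : WienerPath →L[ℝ] ℝ) :
    ∫ ω, ℓ ω * Real.exp (m ω) ∂μ = (∫ ω, m ω * ℓ ω ∂μ) * ∫ ω, Real.exp (m ω) ∂μ := by
  have h := integral_map (μ := μ.tilted m) (φ := ℓ) (by fun_prop) (f := fun x => x) (by fun_prop)
  rw [hμ.map_tilted, integral_id_gaussianReal, integral_tilted] at h
  rw [h, ← integral_mul_const]
  refine integral_congr_ae (ae_of_all _ fun ω => ?_)
  have : (∫ ω, Real.exp (m ω) ∂μ) ≠ 0 := by rw [hμ.integral_exp_dual]; exact (Real.exp_pos _).ne'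
  simp only [smul_eq_mul]; field_simp

lemma IsWienerMeasure.integral_dual_sq_mul_exp (hμ : IsWienerMeasure μ)
    (m ℓ : WienerPath →L[ℝ] ℝ) :
    ∫ ω, ℓ ω ^ 2 * Real.exp (m ω) ∂μ
      = ((∫ ω, m ω * ℓ ω ∂μ) ^ 2 + ∫ ω, ℓ ω ^ 2 ∂μ) * ∫ ω, Real.exp (m ω) ∂μ := by
  have h0 : 0 ≤ ∫ ω, ℓ ω ^ 2 ∂μ := integral_nonneg fun ω => sq_nonneg _
  have h := integral_map (μ := μ.tilted m) (φ := ℓ) (by fun_prop) (f := fun x => x ^ 2)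
    (by fun_prop)
  have hv := variance_eq_sub (memLp_id_gaussianReal' (μ := ∫ ω, m ω * ℓ ω ∂μ)
    (v := (∫ ω, ℓ ω ^ 2 ∂μ).toNNReal) 2 (by simp))
  rw [variance_id_gaussianReal, Real.coe_toNNReal _ h0] at hv
  simp only [Pi.pow_apply, id, integral_id_gaussianReal] at hv
  rw [hμ.map_tilted, integral_tilted] at h
  have h2 : (∫ ω, m ω * ℓ ω ∂μ) ^ 2 + ∫ ω, ℓ ω ^ 2 ∂μ = ∫ y,
      y ^ 2 ∂(gaussianReal (∫ ω, m ω * ℓ ω ∂μ) (∫ ω, ℓ ω ^ 2 ∂μ).toNNReal) := by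
    linarith
  rw [h2, h, ← integral_mul_const]
  refine integral_congr_ae (ae_of_all _ fun ω => ?_)
  have : (∫ ω, Real.exp (m ω) ∂μ) ≠ 0 := by rw [hμ.integral_exp_dual]; exact (Real.exp_pos _).ne'
  simp only [smul_eq_mul]; field_simp

/-! ### The covariance operator -/

lemma IsWienerMeasure.integrable_inner_smul (hμ : IsWienerMeasure μ) (h : L2unit) :
    Integrable (fun ω : WienerPath => inner ℝ h (toL ω) • ω) μ := by
  refine hμ.integrable_of_le_norm_pow (n := 2) (C := ‖h‖) ?_ fun ω => ?_
  · have : Continuous fun ω : WienerPath => inner ℝ h (toLCLM ω) • ω := by fun_prop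
    exact this.aestronglyMeasurable
  · rw [norm_smul]
    calc ‖inner ℝ h (toL ω)‖ * ‖ω‖ ≤ (‖h‖ * ‖toL ω‖) * ‖ω‖ := by
          gcongr; exact norm_inner_le_norm _ _
      _ ≤ (‖h‖ * ‖ω‖) * ‖ω‖ := by gcongr; exact norm_toL_le ω
      _ = _ := by ring

/-- The covariance operator `Q h = 𝔼[⟨h, B⟩ B]`. -/
def IsWienerMeasure.covOp (hμ : IsWienerMeasure μ) : L2unit →L[ℝ] WienerPath :=
  LinearMap.mkContinuous
    { toFun := fun h => ∫ ω : WienerPath, inner ℝ h (toL ω) • ω ∂μ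
      map_add' := fun h k => by
        rw [← integral_add (hμ.integrable_inner_smul h) (hμ.integrable_inner_smul k)]
        simp only [inner_add_left, add_smul]
      map_smul' := fun c h => by
        simp only [real_inner_smul_left, mul_smul, RingHom.id_apply]
        rw [integral_smul] }
    (∫ ω : WienerPath, ‖ω‖ ^ 2 ∂μ) fun h => by
      have hi : Integrable (fun ω : WienerPath => ‖ω‖ ^ 2) μ :=
        memLp_one_iff_integrable.1 (hμ.memLp_norm_pow 2 1 (by simp))
      refine (norm_integral_le_integral_norm _).trans ?_
      rw [← integral_mul_const]
      refine integral_mono (hμ.integrable_inner_smul h).norm (hi.mul_const _) fun ω => ?_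
      simp only [norm_smul]
      calc ‖inner ℝ h (toL ω)‖ * ‖ω‖ ≤ (‖h‖ * ‖toL ω‖) * ‖ω‖ := by
            gcongr; exact norm_inner_le_norm _ _
        _ ≤ (‖h‖ * ‖ω‖) * ‖ω‖ := by gcongr; exact norm_toL_le ω
        _ = _ := by ring

lemma IsWienerMeasure.covOp_apply (hμ : IsWienerMeasure μ) (h : L2unit) :
    hμ.covOp h = ∫ ω : WienerPath, inner ℝ h (toL ω) • ω ∂μ := rfl

lemma IsWienerMeasure.map_covOp {E : Type*} [NormedAddCommGroup E] [NormedSpace ℝ E]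
    [CompleteSpace E] (hμ : IsWienerMeasure μ) (V : WienerPath →L[ℝ] E) (h : L2unit) :
    V (hμ.covOp h) = ∫ ω, inner ℝ h (toL ω) • V ω ∂μ := by
  rw [hμ.covOp_apply, ← V.integral_comp_comm (hμ.integrable_inner_smul h)]
  simp

lemma IsWienerMeasure.dual_covOp (hμ : IsWienerMeasure μ) (ℓ : WienerPath →L[ℝ] ℝ) (h : L2unit) :
    ℓ (hμ.covOp h) = ∫ ω, inner ℝ h (toL ω) * ℓ ω ∂μ := by
  simpa using hμ.map_covOp ℓ h

/-- The functional `⟨h, ·⟩` on `C`. -/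
def innerDual (h : L2unit) : WienerPath →L[ℝ] ℝ := (innerSL ℝ h).comp toLCLM

@[simp] lemma innerDual_apply (h : L2unit) (ω : WienerPath) :
    innerDual h ω = inner ℝ h (toL ω) := rfl

section Hilbert

variable {H : Type*} [NormedAddCommGroup H] [InnerProductSpace ℝ H]

lemma continuous_toL : Continuous toL := toLCLM.continuous

lemma IsWienerMeasure.integrable_norm_sq_mul_exp (hμ : IsWienerMeasure μ) (V : WienerPath →L[ℝ] H)
    (m : WienerPath →L[ℝ] ℝ) :
    Integrable (fun ω => ‖V ω‖ ^ 2 * Real.exp (m ω)) μ := by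
  have h1 : MemLp (fun ω => ‖V ω‖ ^ 2) 2 μ :=
    hμ.memLp_of_le_norm_pow (by fun_prop) 2 (‖V‖ ^ 2) (fun ω => by
      rw [norm_pow, norm_norm, ← mul_pow]
      gcongr
      exact V.le_opNorm ω) 2 (by simp)
  have h2 : MemLp (fun ω => Real.exp (m ω)) 2 μ := by
    simpa using hμ.memLp_exp_dual m 2 (by simp)
  exact h1.integrable_mul h2

lemma HilbertBasis.hasSum_norm_sq {ι : Type*} (b : HilbertBasis ι ℝ H) (x : H) :
    HasSum (fun i => (inner ℝ (b i) x) ^ 2) (‖x‖ ^ 2) := by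
  have h := b.hasSum_inner_mul_inner x x
  rw [real_inner_self_eq_norm_sq] at h
  refine h.congr_fun fun i => ?_
  rw [pow_two, real_inner_comm x (b i)]

/-- Parseval reduces this to the scalar second moment under a tilt, coordinate by coordinate. The
untilted moment on the right is the case of the zero tilt, so one summation argument serves both. -/
lemma IsWienerMeasure.integral_norm_sq_mul_exp (hμ : IsWienerMeasure μ) {ι : Type*} [Countable ι]
    (b : HilbertBasis ι ℝ H)
    (V : WienerPath →L[ℝ] H) (h : L2unit) :
    ∫ ω, ‖V ω‖ ^ 2 * Real.exp (inner ℝ h (toL ω)) ∂μ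
      = (‖V (hμ.covOp h)‖ ^ 2 + ∫ ω, ‖V ω‖ ^ 2 ∂μ) * ∫ ω, Real.exp (inner ℝ h (toL ω)) ∂μ := by
  have key : ∀ k : L2unit, HasSum
      (fun i => ∫ ω, (inner ℝ (b i) (V ω)) ^ 2 * Real.exp (innerDual k ω) ∂μ)
      (∫ ω, ‖V ω‖ ^ 2 * Real.exp (innerDual k ω) ∂μ) := by
    intro k
    have hint : ∀ i, Integrable
        (fun ω => (inner ℝ (b i) (V ω)) ^ 2 * Real.exp (innerDual k ω)) μ := fun i => by
      have := hμ.integrable_norm_sq_mul_exp ((innerSL ℝ (b i)).comp V) (innerDual k)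
      simpa using this
    have hs : ∀ ω, HasSum (fun i => (inner ℝ (b i) (V ω)) ^ 2 * Real.exp (innerDual k ω))
        (‖V ω‖ ^ 2 * Real.exp (innerDual k ω)) := fun ω =>
      (b.hasSum_norm_sq (V ω)).mul_right _
    have hn : ∀ i, ∫ ω, ‖(inner ℝ (b i) (V ω)) ^ 2 * Real.exp (innerDual k ω)‖ ∂μ
        = ∫ ω, (inner ℝ (b i) (V ω)) ^ 2 * Real.exp (innerDual k ω) ∂μ := fun i =>
      integral_congr_ae (ae_of_all _ fun ω => by
        simp only [norm_mul, norm_pow, Real.norm_eq_abs, sq_abs, Real.abs_exp])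
    have hsum := hasSum_integral_of_summable_integral_norm hint (by
      simp only [hn]
      refine summable_of_sum_le (c := ∫ ω, ‖V ω‖ ^ 2 * Real.exp (innerDual k ω) ∂μ)
        (fun i => integral_nonneg fun ω => by positivity) fun u => ?_
      rw [← integral_finsetSum _ fun i _ => hint i]
      refine integral_mono (integrable_finsetSum _ fun i _ => hint i)
        (hμ.integrable_norm_sq_mul_exp V _) fun ω => ?_
      exact sum_le_hasSum _ (fun i _ => by positivity) (hs ω))
    have he : ∀ ω, ∑' i, (inner ℝ (b i) (V ω)) ^ 2 * Real.exp (innerDual k ω)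
      = ‖V ω‖ ^ 2 * Real.exp (innerDual k ω) := fun ω => (hs ω).tsum_eq
    simpa only [he] using hsum
  have h0 := key 0
  have hh := key h
  simp only [innerDual_apply, inner_zero_left, Real.exp_zero, mul_one] at h0 hh
  refine hh.unique ?_
  have hc := ((b.hasSum_norm_sq (V (hμ.covOp h))).add h0).mul_right
    (∫ ω, Real.exp (inner ℝ h (toL ω)) ∂μ)
  refine hc.congr_fun fun i => ?_
  have h1 := hμ.integral_dual_sq_mul_exp (innerDual h) ((innerSL ℝ (b i)).comp V)
  have h2 := hμ.dual_covOp ((innerSL ℝ (b i)).comp V) h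
  simp only [ContinuousLinearMap.comp_apply, innerSL_apply_apply, innerDual_apply] at h1 h2
  rw [h1, ← h2]

end Hilbert

/-! ### The eigenbasis -/

lemma eigval_pos (i : ℕ) : 0 < eigval i := by
  unfold eigval; positivity

lemma sqrt_eigval (i : ℕ) : Real.sqrt (eigval i) = Real.pi / 2 * (2 * i + 1) := by
  have : eigval i = (Real.pi / 2 * (2 * i + 1)) ^ 2 := by unfold eigval; ring
  rw [this, Real.sqrt_sq (by positivity)]

lemma sqrt_eigval_pos (i : ℕ) : 0 < Real.sqrt (eigval i) := Real.sqrt_pos.2 (eigval_pos i)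

/-- The frequency `√λ_i`. -/
abbrev freq (i : ℕ) : ℝ := Real.sqrt (eigval i)

lemma summable_inv_eigval : Summable fun i : ℕ => (eigval i)⁻¹ := by
  have h : Summable fun i : ℕ => 1 / ((i : ℝ) + 1) ^ 2 := by
    have := (summable_nat_add_iff 1).2 (Real.summable_one_div_nat_pow.2 (by norm_num : 1 < 2))
    simpa using this
  refine Summable.of_nonneg_of_le (fun i => (inv_pos.2 (eigval_pos i)).le) (fun i => ?_) h
  rw [one_div]
  refine inv_anti₀ (by positivity) ?_
  unfold eigval
  have h3 : (3 : ℝ) < Real.pi := Real.pi_gt_three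
  have hi : (0 : ℝ) ≤ i := i.cast_nonneg
  nlinarith [mul_pos (show (0:ℝ) < Real.pi - 3 by linarith) (show (0:ℝ) < Real.pi by linarith)]

lemma cos_freq (i : ℕ) : Real.cos (freq i) = 0 := by
  rw [Real.cos_eq_zero_iff]
  exact ⟨i, by rw [freq, sqrt_eigval]; push_cast; ring⟩

/-- The functions `√2 cos(√λ_i θ)`. -/
def cosFun (i : ℕ) (x : ℝ) : ℝ := Real.sqrt 2 * Real.cos (freq i * x)

/-- `√2 cos(√λ_i θ)` as a continuous function on `[0,1]`. -/
def cosMap (i : ℕ) : C(I, ℝ) := ⟨fun θ => cosFun i θ, by unfold cosFun; fun_prop⟩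

/-- `√2 cos(√λ_i θ)` as an element of `L`. -/
def cosL (i : ℕ) : L2unit := ContinuousMap.toLp 2 (volume : Measure I) ℝ (cosMap i)

/-- `e_i` as an element of `L`. -/
abbrev eigL (i : ℕ) : L2unit := toL (eigPath i)

lemma integral_unitInterval (f : ℝ → ℝ) :
    ∫ θ : I, f θ = ∫ x in (0 : ℝ)..1, f x := by
  rw [intervalIntegral.integral_of_le zero_le_one, ← integral_Icc_eq_integral_Ioc]
  exact integral_subtype measurableSet_Icc f

lemma inner_toLp (f g : C(I, ℝ)) :
    inner ℝ (ContinuousMap.toLp (E := ℝ) 2 (volume : Measure I) ℝ f)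
      (ContinuousMap.toLp (E := ℝ) 2 (volume : Measure I) ℝ g) = ∫ θ : I, f θ * g θ := by
  rw [ContinuousMap.inner_toLp]
  simp [mul_comm]

lemma integral_cos_int_mul_pi {n : ℤ} (hn : n ≠ 0) :
    ∫ x in (0 : ℝ)..1, Real.cos (n * Real.pi * x) = 0 := by
  have hc : (n : ℝ) * Real.pi ≠ 0 := mul_ne_zero (by exact_mod_cast hn) Real.pi_ne_zero
  rw [intervalIntegral.integral_comp_mul_left (fun x => Real.cos x) hc]
  simp [integral_cos, Real.sin_int_mul_pi]

lemma integral_cos_sub (i j : ℕ) :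
    ∫ x in (0 : ℝ)..1, Real.cos (freq i * x - freq j * x) = if i = j then 1 else 0 := by
  split_ifs with h
  · subst h; simp
  · have := integral_cos_int_mul_pi (n := (i : ℤ) - j) (by omega)
    rw [← this]
    congr 1; ext x; congr 1
    rw [freq, freq, sqrt_eigval, sqrt_eigval]; push_cast; ring

lemma integral_cos_add (i j : ℕ) :
    ∫ x in (0 : ℝ)..1, Real.cos (freq i * x + freq j * x) = 0 := by
  have := integral_cos_int_mul_pi (n := (i : ℤ) + j + 1) (by omega)
  rw [← this]
  congr 1; ext x; congr 1
  rw [freq, freq, sqrt_eigval, sqrt_eigval]; push_cast; ring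

lemma inner_eigL (i j : ℕ) : inner ℝ (eigL i) (eigL j) = if i = j then (1 : ℝ) else 0 := by
  rw [eigL, eigL, toL, toL, inner_toLp]
  change ∫ θ : I, eigfun i θ * eigfun j θ = _
  rw [integral_unitInterval (fun x => eigfun i x * eigfun j x)]
  have : ∀ x, eigfun i x * eigfun j x
      = Real.cos (freq i * x - freq j * x) - Real.cos (freq i * x + freq j * x) := fun x => by
    have h2 : Real.sqrt 2 * Real.sqrt 2 = 2 := Real.mul_self_sqrt (by norm_num)
    rw [Real.cos_sub, Real.cos_add, eigfun, eigfun, freq, freq]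
    linear_combination Real.sin (√(eigval i) * x) * Real.sin (√(eigval j) * x) * h2
  simp only [this]
  rw [intervalIntegral.integral_sub (by apply Continuous.intervalIntegrable; fun_prop)
    (by apply Continuous.intervalIntegrable; fun_prop), integral_cos_sub, integral_cos_add,
    sub_zero]

lemma inner_cosL (i j : ℕ) : inner ℝ (cosL i) (cosL j) = if i = j then (1 : ℝ) else 0 := by
  rw [cosL, cosL, inner_toLp]
  change ∫ θ : I, cosFun i θ * cosFun j θ = _
  rw [integral_unitInterval (fun x => cosFun i x * cosFun j x)]
  have : ∀ x, cosFun i x * cosFun j x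
      = Real.cos (freq i * x - freq j * x) + Real.cos (freq i * x + freq j * x) := fun x => by
    have h2 : Real.sqrt 2 * Real.sqrt 2 = 2 := Real.mul_self_sqrt (by norm_num)
    rw [Real.cos_sub, Real.cos_add, cosFun, cosFun, freq, freq]
    linear_combination Real.cos (√(eigval i) * x) * Real.cos (√(eigval j) * x) * h2
  simp only [this]
  rw [intervalIntegral.integral_add (by apply Continuous.intervalIntegrable; fun_prop)
    (by apply Continuous.intervalIntegrable; fun_prop), integral_cos_sub, integral_cos_add,
    add_zero]

lemma orthonormal_eigL : Orthonormal ℝ eigL := by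
  rw [orthonormal_iff_ite]; exact inner_eigL

lemma orthonormal_cosL : Orthonormal ℝ cosL := by
  rw [orthonormal_iff_ite]; exact inner_cosL

/-- `θ ↦ cos(πθ)` on `[0,1]`. -/
def cosPi : C(I, ℝ) := ⟨fun θ => Real.cos (Real.pi * θ), by fun_prop⟩

/-- Stone–Weierstrass applies because cos(π·) is injective on [0,1]. -/
lemma adjoin_cosPi_dense : (Algebra.adjoin ℝ {cosPi}).topologicalClosure = ⊤ := by
  refine ContinuousMap.subalgebra_topologicalClosure_eq_top_of_separatesPoints _ ?_
  intro x y hxy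
  refine ⟨cosPi, ⟨cosPi, Algebra.subset_adjoin rfl, rfl⟩, fun h => hxy ?_⟩
  have hx := x.2; have hy := y.2
  have hpi := Real.pi_pos
  have h1 := Real.injOn_cos ⟨by nlinarith [hx.1], by nlinarith [hx.2]⟩
    ⟨by nlinarith [hy.1], by nlinarith [hy.2]⟩
    (show Real.cos (Real.pi * x) = Real.cos (Real.pi * y) from h)
  exact Subtype.ext (mul_left_cancel₀ hpi.ne' h1)

/-- Multiplication by cos(π·) shifts the index by ±1, so it preserves the span of the e_i. The case
i = 0 is separate because the formula would involve e_{-1} = −e_0. -/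
lemma eigfun_mul_cos (i : ℕ) (x : ℝ) : Real.cos (Real.pi * x) * eigfun i x
    = if i = 0 then (eigfun 1 x - eigfun 0 x) / 2
      else (eigfun (i + 1) x + eigfun (i - 1) x) / 2 := by
  have hf : ∀ j : ℕ, √(eigval j) * x = Real.pi * x * j + Real.pi * x / 2 := fun j => by
    rw [sqrt_eigval]; ring
  rcases i with _ | i
  · simp only [if_true, eigfun, hf]
    have e1 : Real.pi * x * ((1 : ℕ) : ℝ) + Real.pi * x / 2 = Real.pi * x + Real.pi * x / 2 := by
      push_cast; ring
    have e0 : Real.pi * x * ((0 : ℕ) : ℝ) + Real.pi * x / 2 = Real.pi * x - Real.pi * x / 2 := by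
      push_cast; ring
    rw [e1]
    have : Real.sin (Real.pi * x * ((0 : ℕ) : ℝ) + Real.pi * x / 2)
        = Real.sin (Real.pi * x / 2) := by
      simp
    rw [this]
    have h2 := Real.sin_add (Real.pi * x) (Real.pi * x / 2)
    have h3 := Real.sin_sub (Real.pi * x) (Real.pi * x / 2)
    rw [show Real.pi * x - Real.pi * x / 2 = Real.pi * x / 2 by ring] at h3
    linear_combination (-√2 / 2) * h2 + (√2 / 2) * h3
  · simp only [Nat.add_eq_zero_iff, one_ne_zero, and_false, if_false, eigfun, hf,
      Nat.add_sub_cancel]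
    have e1 : Real.pi * x * ((i + 1 + 1 : ℕ) : ℝ) + Real.pi * x / 2
      = (Real.pi * x * ((i + 1 : ℕ) : ℝ) + Real.pi * x / 2) + Real.pi * x := by push_cast; ring
    have e2 : Real.pi * x * (i : ℝ) + Real.pi * x / 2
      = (Real.pi * x * ((i + 1 : ℕ) : ℝ) + Real.pi * x / 2) - Real.pi * x := by push_cast; ring
    rw [e1, e2, Real.sin_add _ (Real.pi * x), Real.sin_sub _ (Real.pi * x)]
    ring

/-- Multiplication by a continuous function, tested against `h`. -/
def testFunctional (h : L2unit) (g : C(I, ℝ)) : C(I, ℝ) →L[ℝ] ℝ :=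
  ((innerSL ℝ h).comp (ContinuousMap.toLp (E := ℝ) 2 (volume : Measure I) ℝ)).comp
    (ContinuousLinearMap.mul ℝ C(I, ℝ) g)

lemma testFunctional_apply (h : L2unit) (g f : C(I, ℝ)) :
    testFunctional h g f
      = inner ℝ h (ContinuousMap.toLp (E := ℝ) 2 (volume : Measure I) ℝ (g * f)) :=
  rfl

/-- `e_i` as a continuous function. -/
abbrev eigMap (i : ℕ) : C(I, ℝ) := (eigPath i : C(I, ℝ))

lemma cosPi_mul_eigMap (i : ℕ) : cosPi * eigMap i = if i = 0 then
    (1 / 2 : ℝ) • (eigMap 1 - eigMap 0) else (1 / 2 : ℝ) • (eigMap (i + 1) + eigMap (i - 1)) := by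
  ext θ
  have h := eigfun_mul_cos i θ
  change Real.cos (Real.pi * θ) * eigfun i θ = _
  rw [h]
  split_ifs
  · change _ = (1 / 2 : ℝ) * (eigfun 1 θ - eigfun 0 θ); ring
  · change _ = (1 / 2 : ℝ) * (eigfun (i + 1) θ + eigfun (i - 1) θ); ring

/-- Completeness of the sine system. Orthogonality to the e_i propagates to p(cos π·) e_0 for every
polynomial p, then by density to f e_0 for every continuous f. So h e_0 = 0, and e_0 > 0 away from θ
= 0. -/
lemma eq_zero_of_inner_eigL_eq_zero (h : L2unit) (hh : ∀ i, inner ℝ h (eigL i) = 0) : h = 0 := by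
  -- all products `p(cos π·) e_i` are orthogonal to `h`
  have hadj : ∀ f ∈ Algebra.adjoin ℝ {cosPi}, ∀ i, testFunctional h (eigMap i) f = 0 := by
    intro f hf
    rw [Algebra.adjoin_singleton_eq_range_aeval] at hf
    obtain ⟨p, rfl⟩ := hf
    have hpow : ∀ n i, testFunctional h (eigMap i) (cosPi ^ n) = 0 := by
      intro n
      induction n with
      | zero =>
        intro i
        rw [testFunctional_apply, pow_zero, mul_one]
        exact hh i
      | succ n ih =>
        intro i
        have : eigMap i * cosPi ^ (n + 1) = (cosPi * eigMap i) * cosPi ^ n := by ring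
        rw [testFunctional_apply, this, cosPi_mul_eigMap]
        have e := fun j => (testFunctional_apply h (eigMap j) (cosPi ^ n)).symm.trans (ih j)
        split_ifs
        · rw [smul_mul_assoc, sub_mul, map_smul, map_sub, inner_smul_right, inner_sub_right, e, e]
          simp
        · rw [smul_mul_assoc, add_mul, map_smul, map_add, inner_smul_right, inner_add_right, e, e]
          simp
    intro i
    induction p using Polynomial.induction_on' with
    | add p q hp hq =>
      change testFunctional h (eigMap i) (Polynomial.aeval cosPi (p + q)) = 0
      rw [map_add, map_add]
      exact (congrArg₂ (· + ·) hp hq).trans (add_zero 0)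
    | monomial n a =>
      change testFunctional h (eigMap i) (Polynomial.aeval cosPi (Polynomial.monomial n a)) = 0
      rw [Polynomial.aeval_monomial, ← Algebra.smul_def, map_smul, hpow, smul_zero]
  have hall : ∀ f : C(I, ℝ), testFunctional h (eigMap 0) f = 0 := by
    intro f
    have hcl : f ∈ closure (Algebra.adjoin ℝ {cosPi} : Set C(I, ℝ)) := by
      rw [← Subalgebra.topologicalClosure_coe, adjoin_cosPi_dense]; trivial
    exact closure_minimal (fun g hg => hadj g hg 0)
      (isClosed_eq (testFunctional h (eigMap 0)).continuous continuous_const) hcl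
  -- hence `h e_0` is orthogonal to all continuous functions
  set M : C(I, ℝ) := eigMap 0 with hM
  have hmem : MemLp (fun θ => M θ * h θ) 2 (volume : Measure I) := by
    refine (Lp.memLp h).of_le_mul (c := ‖M‖)
      (M.continuous.aestronglyMeasurable.mul (Lp.aestronglyMeasurable h)) (ae_of_all _ fun θ => ?_)
    rw [norm_mul]
    gcongr
    exact M.norm_coe_le_norm θ
  have hzero : hmem.toLp = 0 := by
    have hd : DenseRange (ContinuousMap.toLp (E := ℝ) 2 (volume : Measure I) ℝ) :=
      ContinuousMap.toLp_denseRange ℝ volume ℝ (by simp)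
    refine hd.eq_zero_of_inner_left (𝕜 := ℝ) ?_
    intro f
    refine Eq.trans ?_ (hall f)
    rw [testFunctional_apply, L2.inner_def, L2.inner_def]
    refine integral_congr_ae ?_
    filter_upwards [hmem.coeFn_toLp, ContinuousMap.coeFn_toLp (p := 2) (𝕜 := ℝ) volume f,
      ContinuousMap.coeFn_toLp (p := 2) (𝕜 := ℝ) volume (M * f)] with θ h1 h2 h3
    rw [h1, h2, h3]
    simp only [RCLike.inner_apply, conj_trivial, ContinuousMap.mul_apply]
    ring
  have hae : ∀ᵐ θ : I, M θ * h θ = 0 := by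
    have := hmem.coeFn_toLp
    rw [hzero] at this
    filter_upwards [this, Lp.coeFn_zero ℝ 2 (volume : Measure I)] with θ h1 h2
    rw [← h1, h2]; rfl
  rw [Lp.eq_zero_iff_ae_eq_zero]
  have hne : ∀ᵐ θ : I, θ ≠ 0 := by
    simp [ae_iff]
  filter_upwards [hae, hne] with θ h1 h2
  refine (mul_eq_zero.1 h1).resolve_left fun h0 => ?_
  have hθ : (0 : ℝ) < θ := lt_of_le_of_ne θ.2.1 fun h => h2 (Subtype.ext h.symm)
  have hpos : 0 < Real.sin (√(eigval 0) * θ) := by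
    have hpi := Real.pi_pos
    rw [sqrt_eigval]
    refine Real.sin_pos_of_pos_of_lt_pi (by positivity) ?_
    have := θ.2.2
    simp only [Nat.cast_zero]
    nlinarith
  have h0' : Real.sqrt 2 * Real.sin (√(eigval 0) * θ) = 0 := h0
  exact (mul_pos (by positivity) hpos).ne' h0'

/-- The eigenfunctions `e_i` as a Hilbert basis of `L`. -/
def eigBasis : HilbertBasis ℕ ℝ L2unit :=
  HilbertBasis.mkOfOrthogonalEqBot orthonormal_eigL (by
    rw [Submodule.eq_bot_iff]
    intro h hh
    refine eq_zero_of_inner_eigL_eq_zero h fun i => ?_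
    rw [Submodule.mem_orthogonal'] at hh
    exact hh _ (Submodule.subset_span ⟨i, rfl⟩))

@[simp] lemma eigBasis_apply (i : ℕ) : eigBasis i = eigL i := by
  simp [eigBasis]

/-! ### The primitive of a square integrable function -/

lemma integrable_L2unit (h : L2unit) : Integrable (h : I → ℝ) volume :=
  (Lp.memLp h).integrable (by norm_num)

/-- `∫₀^x h`. -/
def primitiveFun (h : L2unit) (x : ℝ) : ℝ := ∫ θ : I in {θ : I | (θ : ℝ) ≤ x}, h θ

lemma measurableSet_le_coe (x : ℝ) : MeasurableSet {θ : I | (θ : ℝ) ≤ x} :=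
  measurableSet_le (by fun_prop) measurable_const

/-- Dominated convergence: the indicator of θ ≤ y is continuous in y at x except on the null set θ =
x. -/
lemma continuous_primitiveFun (h : L2unit) : Continuous (primitiveFun h) := by
  have e : primitiveFun h = fun x => ∫ θ : I, {θ : I | (θ : ℝ) ≤ x}.indicator h θ := by
    ext x; rw [primitiveFun, integral_indicator (measurableSet_le_coe x)]
  rw [e, continuous_iff_continuousAt]
  intro x
  refine continuousAt_of_dominated (bound := fun θ => ‖h θ‖)
    (Eventually.of_forall fun y =>
      ((Lp.aestronglyMeasurable h).indicator (measurableSet_le_coe y)))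
    (Eventually.of_forall fun y => ae_of_all _ fun θ => norm_indicator_le_norm_self _ _)
    (integrable_L2unit h).norm ?_
  have hne : ∀ᵐ θ : I, (θ : ℝ) ≠ x := by
    by_cases hx : x ∈ I
    · have : ∀ᵐ θ : I, θ ≠ ⟨x, hx⟩ := by simp [ae_iff]
      filter_upwards [this] with θ hθ h
      exact hθ (Subtype.ext h)
    · exact ae_of_all _ fun θ h => hx (h ▸ θ.2)
  filter_upwards [hne] with θ hθ
  rcases lt_or_gt_of_ne hθ with hlt | hlt
  · refine (continuousAt_const (y := h θ)).congr ?_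
    filter_upwards [lt_mem_nhds hlt] with y hy
    rw [Set.indicator_of_mem]
    exact hy.le
  · refine (continuousAt_const (y := (0 : ℝ))).congr ?_
    filter_upwards [gt_mem_nhds hlt] with y hy
    rw [Set.indicator_of_notMem]
    exact not_le.2 hy

lemma primitiveFun_add (h k : L2unit) (x : ℝ) :
    primitiveFun (h + k) x = primitiveFun h x + primitiveFun k x := by
  rw [primitiveFun, primitiveFun, primitiveFun,
    ← integral_add (integrable_L2unit h).integrableOn (integrable_L2unit k).integrableOn]
  exact integral_congr_ae (ae_restrict_of_ae (Lp.coeFn_add h k))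

lemma primitiveFun_smul (c : ℝ) (h : L2unit) (x : ℝ) :
    primitiveFun (c • h) x = c * primitiveFun h x := by
  rw [primitiveFun, primitiveFun, ← integral_const_mul]
  exact integral_congr_ae (ae_restrict_of_ae (Lp.coeFn_smul c h))

lemma abs_primitiveFun_le (h : L2unit) (x : ℝ) : |primitiveFun h x| ≤ ‖h‖ := by
  have e := L2.inner_indicatorConstLp_one (𝕜 := ℝ) (measurableSet_le_coe x)
    (measure_ne_top (volume : Measure I) _) h
  rw [primitiveFun, ← e, ← Real.norm_eq_abs]
  refine (norm_inner_le_norm _ _).trans ?_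
  refine mul_le_of_le_one_left (norm_nonneg _) ?_
  rw [norm_indicatorConstLp (by norm_num) (by norm_num)]
  simp only [norm_one, one_mul]
  exact Real.rpow_le_one (by positivity) measureReal_le_one (by norm_num)

/-- The integration operator `h ↦ ∫₀^· h` from `L` to `C`. -/
def primitive : L2unit →L[ℝ] WienerPath :=
  LinearMap.mkContinuous
    { toFun := fun h => ⟨⟨fun θ => primitiveFun h θ,
          (continuous_primitiveFun h).comp continuous_subtype_val⟩, by
        change primitiveFun h ((0 : I) : ℝ) = 0
        have : {θ : I | (θ : ℝ) ≤ ((0 : I) : ℝ)} = {0} := by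
          ext θ
          simp only [Set.mem_singleton_iff]
          exact ⟨fun h => le_antisymm h θ.2.1, fun h => by subst h; exact le_refl (0 : ℝ)⟩
        rw [primitiveFun, this]
        simp⟩
      map_add' := fun h k => path_ext fun θ => primitiveFun_add h k θ
      map_smul' := fun c h => path_ext fun θ => primitiveFun_smul c h θ }
    1 fun h => by
      rw [one_mul]
      exact (ContinuousMap.norm_le _ (norm_nonneg _)).2 fun θ => abs_primitiveFun_le h θ

lemma primitive_apply (h : L2unit) (θ : I) :
    (primitive h : C(I, ℝ)) θ = primitiveFun h θ := rfl

lemma primitiveFun_toLp (f : C(I, ℝ)) (F : ℝ → ℝ) (hF : ∀ θ : I, f θ = F θ) {x : ℝ} (hx : x ∈ I) :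
    primitiveFun (ContinuousMap.toLp 2 (volume : Measure I) ℝ f) x = ∫ u in (0 : ℝ)..x, F u := by
  have h1 : primitiveFun (ContinuousMap.toLp 2 (volume : Measure I) ℝ f) x
      = ∫ θ : I, (Set.Iic x).indicator F θ := by
    rw [primitiveFun, ← integral_indicator (measurableSet_le_coe x)]
    refine integral_congr_ae ?_
    filter_upwards [ContinuousMap.coeFn_toLp (p := 2) (𝕜 := ℝ) (volume : Measure I) f] with θ h
    simp only [Set.indicator, Set.mem_ofPred_eq, Set.mem_Iic, h, hF]
  rw [h1, integral_unitInterval, intervalIntegral.integral_of_le zero_le_one,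
    intervalIntegral.integral_of_le hx.1, setIntegral_indicator measurableSet_Iic]
  congr 2
  ext y
  simp only [Set.mem_inter_iff, Set.mem_Ioc, Set.mem_Iic]
  exact ⟨fun h => ⟨h.1.1, h.2⟩, fun h => ⟨⟨h.1, h.2.trans hx.2⟩, h.2⟩⟩

lemma primitive_cosL (i : ℕ) : primitive (cosL i) = (freq i)⁻¹ • eigPath i := by
  refine path_ext fun θ => ?_
  rw [primitive_apply, cosL, primitiveFun_toLp _ (cosFun i) (fun _ => rfl) θ.2]
  change _ = (freq i)⁻¹ * eigfun i θ
  unfold cosFun eigfun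
  rw [intervalIntegral.integral_const_mul,
    intervalIntegral.integral_comp_mul_left (fun x => Real.cos x) (sqrt_eigval_pos i).ne']
  simp only [mul_zero, integral_cos, Real.sin_zero, sub_zero, smul_eq_mul]
  ring

/-- This turns an operator V on C into the operator V ∘ `primitive` on L. For mollified derivatives
only the latter is bounded uniformly in ε. -/
lemma eigPath_eq (i : ℕ) : eigPath i = freq i • primitive (cosL i) := by
  rw [primitive_cosL, smul_smul, mul_inv_cancel₀ (sqrt_eigval_pos i).ne', one_smul]

/-! ### The covariance operator on the eigenbasis -/

/-- The kernel min(s, x) is the Green function of −d²/dθ² with the boundary conditions of A. The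
integral is split at s = x, and the boundary term at 1 vanishes because cos √λ_i = 0. -/
lemma integral_min_mul_eigfun (i : ℕ) (x : ℝ) (hx : x ∈ I) :
    ∫ s in (0 : ℝ)..1, min s x * eigfun i s = (eigval i)⁻¹ * eigfun i x := by
  have hl := sqrt_eigval_pos i
  have hc : Continuous fun s => min s x * eigfun i s := by unfold eigfun; fun_prop
  rw [← intervalIntegral.integral_add_adjacent_intervals (b := x)
    (hc.intervalIntegrable _ _) (hc.intervalIntegrable _ _)]
  have h1 : ∫ s in (0 : ℝ)..x, min s x * eigfun i s
      = √2 * (Real.sin (freq i * x) / eigval i - x * Real.cos (freq i * x) / freq i) := by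
    have := intervalIntegral.integral_eq_sub_of_hasDerivAt (a := 0) (b := x)
      (f := fun s => √2 * (Real.sin (freq i * s) / eigval i - s * Real.cos (freq i * s) / freq i))
      (f' := fun s => s * eigfun i s) (fun s _ => by
        have hs : HasDerivAt (fun s => Real.sin (freq i * s))
            (Real.cos (freq i * s) * freq i) s := by
          simpa using ((hasDerivAt_id s).const_mul (freq i)).sin
        have hcs : HasDerivAt (fun s => Real.cos (freq i * s))
            (-Real.sin (freq i * s) * freq i) s := by
          simpa using ((hasDerivAt_id s).const_mul (freq i)).cos
        have := ((hs.div_const (eigval i)).sub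
          (((hasDerivAt_id s).mul hcs).div_const (freq i))).const_mul (√2)
        refine this.congr_deriv ?_
        have he : eigval i = freq i * freq i := (Real.mul_self_sqrt (eigval_pos i).le).symm
        change _ = s * (√2 * Real.sin (freq i * s))
        have hl' : 0 < freq i := hl
        obtain ⟨w, hw⟩ : ∃ w, w = freq i := ⟨_, rfl⟩
        rw [← hw] at he hl' ⊢
        rw [he, id]
        field_simp
        ring)
      (by apply Continuous.intervalIntegrable; unfold eigfun; fun_prop)
    rw [intervalIntegral.integral_congr (g := fun s => s * eigfun i s), this]
    · simp
    · intro s hs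
      rw [Set.uIcc_of_le hx.1] at hs
      simp only [min_eq_left hs.2]
  have h2 : ∫ s in x..1, min s x * eigfun i s = √2 * (x * Real.cos (freq i * x) / freq i) := by
    have := intervalIntegral.integral_eq_sub_of_hasDerivAt (a := x) (b := 1)
      (f := fun s => √2 * (-(x * Real.cos (freq i * s) / freq i)))
      (f' := fun s => x * eigfun i s) (fun s _ => by
        have hcs : HasDerivAt (fun s => Real.cos (freq i * s))
            (-Real.sin (freq i * s) * freq i) s := by
          simpa using ((hasDerivAt_id s).const_mul (freq i)).cos
        have := (((hcs.const_mul x).div_const (freq i)).neg).const_mul (√2)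
        refine this.congr_deriv ?_
        change _ = x * (√2 * Real.sin (freq i * s))
        field_simp)
      (by apply Continuous.intervalIntegrable; unfold eigfun; fun_prop)
    rw [intervalIntegral.integral_congr (g := fun s => x * eigfun i s), this]
    · simp [cos_freq]
    · intro s hs
      rw [Set.uIcc_of_le hx.2] at hs
      simp only [min_eq_right hs.1]
  rw [h1, h2, eigfun]
  change _ = (eigval i)⁻¹ * (√2 * Real.sin (freq i * x))
  ring

set_option synthInstance.maxHeartbeats 400000 in
lemma IsWienerMeasure.sFinite (hμ : IsWienerMeasure μ) : SFinite μ := by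
  have := hμ.isProbabilityMeasure
  infer_instance

/-- By Fubini, the covariance operator is the integral operator with kernel θ ∧ θ', so the Green
function computation applies. -/
lemma IsWienerMeasure.covOp_eigL (hμ : IsWienerMeasure μ) (i : ℕ) :
    hμ.covOp (eigL i) = (eigval i)⁻¹ • eigPath i := by
  have := hμ.isProbabilityMeasure
  have := hμ.sFinite
  refine path_ext fun θ => ?_
  have h := hμ.dual_covOp (evalPath θ) (eigL i)
  rw [evalPath_apply] at h
  rw [h]
  change _ = (eigval i)⁻¹ * eigfun i θ
  rw [← integral_min_mul_eigfun i θ θ.2, ← integral_unitInterval (fun s => min s θ * eigfun i s)]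
  have h1 : ∀ ω : WienerPath, inner ℝ (eigL i) (toL ω) * evalPath θ ω
      = ∫ s : I, (eigfun i s * (ω : C(I, ℝ)) s) * (ω : C(I, ℝ)) θ := fun ω => by
    rw [integral_mul_const, eigL, toL, toL, inner_toLp]; rfl
  simp only [h1]
  rw [integral_integral_swap]
  · refine integral_congr_ae (ae_of_all _ fun s => ?_)
    simp only [mul_assoc]
    rw [integral_const_mul, hμ.cov]
    ring
  · have hc : Continuous fun p : WienerPath × I =>
        (eigfun i p.2 * (p.1 : C(I, ℝ)) p.2) * (p.1 : C(I, ℝ)) θ := by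
      have h1 : Continuous fun p : WienerPath × I => (p.1 : C(I, ℝ)) p.2 :=
        (continuous_eval (F := C(I, ℝ))).comp (continuous_subtype_val.prodMap continuous_id)
      have h2 : Continuous fun p : WienerPath × I => (p.1 : C(I, ℝ)) θ :=
        (evalPath θ).continuous.comp continuous_fst
      have h3 : Continuous fun p : WienerPath × I => eigfun i p.2 := by
        unfold eigfun; fun_prop
      exact (h3.mul h1).mul h2
    have hi : Integrable (fun p : WienerPath × I => √2 * ‖p.1‖ ^ 2) (μ.prod volume) :=
      (memLp_one_iff_integrable.1 (hμ.memLp_norm_pow 2 1 (by simp))).comp_fst volume |>.const_mul _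
    refine hi.mono hc.aestronglyMeasurable (ae_of_all _ fun p => ?_)
    have he : |eigfun i p.2| ≤ √2 := by
      rw [eigfun, abs_mul, abs_of_nonneg (Real.sqrt_nonneg 2)]
      exact mul_le_of_le_one_right (Real.sqrt_nonneg 2) (Real.abs_sin_le_one _)
    simp only [Function.uncurry, Real.norm_eq_abs, abs_mul, abs_norm, abs_pow,
      abs_of_nonneg (Real.sqrt_nonneg 2)]
    calc |eigfun i p.2| * |(p.1 : C(I, ℝ)) p.2| * |(p.1 : C(I, ℝ)) θ|
        ≤ √2 * ‖p.1‖ * ‖p.1‖ := by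
          gcongr
          · exact abs_path_le_norm p.1 p.2
          · exact abs_path_le_norm p.1 θ
      _ = _ := by ring

/-! ### Density of the exponentials -/

/-- A functional of polynomial growth and an exponential are both in L⁴, so their product is in L².
-/
instance holderTriple_four_four_two : ENNReal.HolderTriple 4 4 2 where
  inv_add_inv_eq_inv := by
    rw [← two_mul, show (4 : ENNReal) = 2 * 2 by norm_num,
      ENNReal.mul_inv (by simp) (by simp), ← mul_assoc, ENNReal.mul_inv_cancel (by simp) (by simp),
      one_mul]

lemma IsWienerMeasure.memLp_mul_exp (hμ : IsWienerMeasure μ) {f : WienerPath → ℝ}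
    (hf : AEStronglyMeasurable f μ) (n : ℕ) (C : ℝ) (h : ∀ ω, ‖f ω‖ ≤ C * ‖ω‖ ^ n)
    (m : WienerPath →L[ℝ] ℝ) : MemLp (fun ω => f ω * Real.exp (m ω)) 2 μ := by
  have h1 : MemLp f 4 μ := hμ.memLp_of_le_norm_pow hf n C h 4 (by simp)
  have h2 : MemLp (fun ω => Real.exp (m ω)) 4 μ := by
    simpa using hμ.memLp_exp_dual m 4 (by simp)
  exact h2.mul' h1

/-- The positive and negative parts of φ are densities of finite measures with equal exponential
moments in every direction. Analytic continuation equates their characteristic functionals, so the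
two measures coincide, which forces φ = 0. -/
lemma IsWienerMeasure.ae_eq_zero_of_integral_mul_exp (hμ : IsWienerMeasure μ) {φ : WienerPath → ℝ}
    (hφ : MemLp φ 2 μ) (h : ∀ m : WienerPath →L[ℝ] ℝ, ∫ ω, φ ω * Real.exp (m ω) ∂μ = 0) :
    φ =ᵐ[μ] 0 := by
  have := hμ.isProbabilityMeasure
  have hint : ∀ m : WienerPath →L[ℝ] ℝ, Integrable (fun ω => φ ω * Real.exp (m ω)) μ := fun m => by
    have h2 : MemLp (fun ω => Real.exp (m ω)) 2 μ := by simpa using hμ.memLp_exp_dual m 2 (by simp)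
    exact hφ.integrable_mul h2
  have hφi : Integrable φ μ := hφ.integrable (by norm_num)
  set ν₁ := μ.withDensity fun ω => ENNReal.ofReal (φ ω) with hν₁
  set ν₂ := μ.withDensity fun ω => ENNReal.ofReal (-φ ω) with hν₂
  have f1 : IsFiniteMeasure ν₁ := isFiniteMeasure_withDensity_ofReal hφi.2
  have f2 : IsFiniteMeasure ν₂ := isFiniteMeasure_withDensity_ofReal hφi.neg.2
  have hm1 : AEMeasurable (fun ω => ENNReal.ofReal (φ ω)) μ := hφ.1.aemeasurable.ennreal_ofReal
  have hm2 : AEMeasurable (fun ω => ENNReal.ofReal (-φ ω)) μ :=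
    hφ.1.aemeasurable.neg.ennreal_ofReal
  have hmul : ∀ m : WienerPath →L[ℝ] ℝ,
      Integrable (fun ω => max (φ ω) 0 * Real.exp (m ω)) μ ∧
      Integrable (fun ω => max (-φ ω) 0 * Real.exp (m ω)) μ := fun m => by
    refine ⟨(hint m).pos_part.congr (ae_of_all _ fun ω => ?_),
      (hint m).neg_part.congr (ae_of_all _ fun ω => ?_)⟩
    · simp only [max_mul_of_nonneg _ _ (Real.exp_pos _).le, zero_mul]
    · simp only [max_mul_of_nonneg _ _ (Real.exp_pos _).le, zero_mul, neg_mul]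
  have hI1 : ∀ m : WienerPath →L[ℝ] ℝ, Integrable (fun ω => Real.exp (m ω)) ν₁ := fun m => by
    rw [hν₁, integrable_withDensity_iff_integrable_smul₀' hm1 (ae_of_all _ fun _ => by simp)]
    refine (hmul m).1.congr (ae_of_all _ fun ω => ?_)
    simp [ENNReal.toReal_ofReal']
  have hI2 : ∀ m : WienerPath →L[ℝ] ℝ, Integrable (fun ω => Real.exp (m ω)) ν₂ := fun m => by
    rw [hν₂, integrable_withDensity_iff_integrable_smul₀' hm2 (ae_of_all _ fun _ => by simp)]
    refine (hmul m).2.congr (ae_of_all _ fun ω => ?_)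
    simp [ENNReal.toReal_ofReal']
  have hE : ∀ m : WienerPath →L[ℝ] ℝ, ∫ ω, Real.exp (m ω) ∂ν₁ = ∫ ω, Real.exp (m ω) ∂ν₂ := by
    intro m
    rw [hν₁, hν₂, integral_withDensity_eq_integral_toReal_smul₀ hm1 (ae_of_all _ fun _ => by simp),
      integral_withDensity_eq_integral_toReal_smul₀ hm2 (ae_of_all _ fun _ => by simp),
      ← sub_eq_zero]
    simp only [ENNReal.toReal_ofReal', smul_eq_mul]
    rw [← integral_sub (hmul m).1 (hmul m).2]
    refine Eq.trans ?_ (h m)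
    refine integral_congr_ae (ae_of_all _ fun ω => ?_)
    simp only [← sub_mul]
    congr 1
    rcases le_total 0 (φ ω) with h0 | h0
    · rw [max_eq_left h0, max_eq_right (by linarith)]; ring
    · rw [max_eq_right h0, max_eq_left (by linarith)]; ring
  have hν : ν₁ = ν₂ := by
    refine Measure.ext_of_charFunDual (funext fun m => ?_)
    have hmgf : mgf m ν₁ = mgf m ν₂ := by
      ext t; simpa [mgf] using hE (t • m)
    have hset : integrableExpSet m ν₁ = Set.univ := by
      ext t
      simp only [integrableExpSet, Set.mem_ofPred_eq, Set.mem_univ, iff_true]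
      simpa using hI1 (t • m)
    have hzero : ν₁ = 0 ↔ ν₂ = 0 := by
      have h0 := hE 0
      simp only [zero_apply, Real.exp_zero, integral_const, smul_eq_mul,
        mul_one] at h0
      have hu : ν₁ Set.univ = ν₂ Set.univ :=
        (ENNReal.toReal_eq_toReal_iff' (measure_ne_top _ _) (measure_ne_top _ _)).1 h0
      rw [← Measure.measure_univ_eq_zero, hu, Measure.measure_univ_eq_zero]
    have hc := eqOn_complexMGF_of_mgf' hmgf hzero
    rw [hset] at hc
    -- The complex moment generating function at i is the characteristic functional at m.
    have := hc (x := Complex.I) (by simp)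
    simpa [charFunDual_apply, complexMGF, mul_comm] using this
  rw [hν₁, hν₂, withDensity_eq_iff hm1 hm2 (by
    have := measure_ne_top ν₁ Set.univ
    rwa [hν₁, withDensity_apply _ MeasurableSet.univ, Measure.restrict_univ] at this)] at hν
  filter_upwards [hν] with ω hω
  rcases lt_trichotomy (φ ω) 0 with h0 | h0 | h0
  · rw [ENNReal.ofReal_of_nonpos h0.le, eq_comm, ENNReal.ofReal_eq_zero] at hω
    simp only [Pi.zero_apply]; linarith
  · exact h0
  · rw [ENNReal.ofReal_of_nonpos (p := -φ ω) (by linarith), ENNReal.ofReal_eq_zero] at hω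
    simp only [Pi.zero_apply]; linarith

/-! ### Functions with a gradient in the closure of the graph -/

/-- `(f, g)` represents an element of the closure of the graph of `∇` on `Exp(C)`. -/
def HasClosedGrad (μ : Measure WienerPath) (f : WienerPath → ℝ) (g : WienerPath → L2unit) : Prop :=
  ∃ (hf : MemLp f 2 μ) (hg : MemLp g 2 μ),
    (hf.toLp f, hg.toLp g) ∈ (expGraph μ).topologicalClosure

lemma memLp_two_smul_const {f : WienerPath → ℝ} (hf : MemLp f 2 μ) (k : L2unit) :
    MemLp (fun ω => f ω • k) 2 μ :=
  hf.of_le_mul (c := ‖k‖) (hf.1.smul_const k) (ae_of_all _ fun ω => by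
    rw [norm_smul, mul_comm])

lemma IsWienerMeasure.memLp_exp_pairing (hμ : IsWienerMeasure μ) (k : L2unit) :
    MemLp (fun ω : WienerPath => Real.exp (inner ℝ k (toL ω))) 2 μ := by
  simpa using hμ.memLp_exp_dual (innerDual k) 2 (by simp)

/-- `(exp ⟨k, ·⟩, exp ⟨k, ·⟩ k)`, an element of the graph of `∇`. -/
def IsWienerMeasure.expPair (hμ : IsWienerMeasure μ) (k : WienerPath) :
    Lp ℝ 2 μ × Lp L2unit 2 μ :=
  ((hμ.memLp_exp_pairing (toL k)).toLp _,
    (memLp_two_smul_const (hμ.memLp_exp_pairing (toL k)) (toL k)).toLp _)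

lemma hasGradientAt_exp_inner (k x : L2unit) :
    HasGradientAt (fun x : L2unit => Real.exp (inner ℝ x k)) (Real.exp (inner ℝ x k) • k) x := by
  rw [hasGradientAt_iff_hasFDerivAt]
  have h : HasFDerivAt (fun x : L2unit => inner ℝ k x) (innerSL ℝ k) x := (innerSL ℝ k).hasFDerivAt
  have h2 := h.exp
  simp only [real_inner_comm] at h2 ⊢
  refine h2.congr_fderiv ?_
  ext y
  simp

lemma IsWienerMeasure.expPair_mem (hμ : IsWienerMeasure μ) (k : WienerPath) :
    hμ.expPair k ∈ expGraph μ := by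
  refine Submodule.subset_span ⟨_, Submodule.subset_span ⟨k, rfl⟩, ?_, ?_⟩
  · refine (MemLp.coeFn_toLp (hμ.memLp_exp_pairing (toL k))).trans (ae_of_all _ fun ω => ?_)
    simp only [real_inner_comm]
  · refine (MemLp.coeFn_toLp (memLp_two_smul_const (hμ.memLp_exp_pairing (toL k))
        (toL k))).trans (ae_of_all _ fun ω => ?_)
    have h := (hasGradientAt_exp_inner (toL k) (toL ω)).gradient
    rw [real_inner_comm] at h
    exact h.symm

/-- Differentiability is carried through the induction because the gradient is additive only on
differentiable functions. -/
lemma IsWienerMeasure.exists_mem_span_expPair (hμ : IsWienerMeasure μ) {f : L2unit → ℝ}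
    (hf : f ∈ expSpace) : Differentiable ℝ f ∧ ∃ p ∈ Submodule.span ℝ (Set.range hμ.expPair),
      (p.1 : WienerPath → ℝ) =ᵐ[μ] (fun ω => f (toL ω)) ∧
      (p.2 : WienerPath → L2unit) =ᵐ[μ] (fun ω => gradient f (toL ω)) := by
  induction hf using Submodule.span_induction with
  | mem f hf =>
    obtain ⟨k, rfl⟩ := hf
    refine ⟨fun x => (hasGradientAt_exp_inner (toL k) x).differentiableAt, hμ.expPair k,
      Submodule.subset_span ⟨k, rfl⟩, ?_, ?_⟩
    · refine (MemLp.coeFn_toLp (hμ.memLp_exp_pairing (toL k))).trans (ae_of_all _ fun ω => ?_)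
      simp only [real_inner_comm]
    · refine (MemLp.coeFn_toLp (memLp_two_smul_const (hμ.memLp_exp_pairing (toL k))
        (toL k))).trans (ae_of_all _ fun ω => ?_)
      have h := (hasGradientAt_exp_inner (toL k) (toL ω)).gradient
      rw [real_inner_comm] at h
      exact h.symm
  | zero =>
    refine ⟨differentiable_const 0, 0, Submodule.zero_mem _, Lp.coeFn_zero _ _ _, ?_⟩
    refine (Lp.coeFn_zero _ _ _).trans (ae_of_all _ fun ω => ?_)
    simp [gradient]
  | add f g _ _ hf hg =>
    obtain ⟨df, p, hp, hp1, hp2⟩ := hf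
    obtain ⟨dg, q, hq, hq1, hq2⟩ := hg
    refine ⟨df.add dg, p + q, Submodule.add_mem _ hp hq, ?_, ?_⟩
    · filter_upwards [Lp.coeFn_add p.1 q.1, hp1, hq1] with ω h1 h2 h3
      rw [Prod.fst_add, h1, Pi.add_apply, h2, h3]; rfl
    · filter_upwards [Lp.coeFn_add p.2 q.2, hp2, hq2] with ω h1 h2 h3
      rw [Prod.snd_add, h1, Pi.add_apply, h2, h3, gradient, gradient, gradient,
        fderiv_add (df _) (dg _), map_add]
  | smul c f _ hf =>
    obtain ⟨df, p, hp, hp1, hp2⟩ := hf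
    refine ⟨df.const_smul c, c • p, Submodule.smul_mem _ c hp, ?_, ?_⟩
    · filter_upwards [Lp.coeFn_smul c p.1, hp1] with ω h1 h2
      rw [Prod.smul_fst, h1, Pi.smul_apply, h2]; rfl
    · filter_upwards [Lp.coeFn_smul c p.2, hp2] with ω h1 h2
      rw [Prod.smul_snd, h1, Pi.smul_apply, h2, gradient, gradient, fderiv_const_smul (df _),
        map_smulₛₗ]
      rfl

/-- With this, a statement that is linear and closed in the pair needs checking only on single
exponentials. -/
lemma IsWienerMeasure.expGraph_eq (hμ : IsWienerMeasure μ) :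
    expGraph μ = Submodule.span ℝ (Set.range hμ.expPair) := by
  refine le_antisymm (Submodule.span_le.2 ?_) (Submodule.span_le.2 ?_)
  · rintro p ⟨f, hf, hp1, hp2⟩
    obtain ⟨-, q, hq, hq1, hq2⟩ := hμ.exists_mem_span_expPair hf
    have : p = q := Prod.ext (Lp.ext (hp1.trans hq1.symm)) (Lp.ext (hp2.trans hq2.symm))
    exact this ▸ hq
  · rintro _ ⟨k, rfl⟩
    exact hμ.expPair_mem k

/-- An integration by parts formula on `Exp(C)` extends to the closure of the graph. -/
lemma IsWienerMeasure.integral_inner_eq_of_mem (hμ : IsWienerMeasure μ) {x : WienerPath → L2unit}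
    {y : WienerPath → ℝ} (hx : MemLp x 2 μ) (hy : MemLp y 2 μ)
    (h : ∀ k : WienerPath, ∫ ω, inner ℝ (toL k) (x ω) * Real.exp (inner ℝ (toL k) (toL ω)) ∂μ
      = ∫ ω, y ω * Real.exp (inner ℝ (toL k) (toL ω)) ∂μ)
    {p : Lp ℝ 2 μ × Lp L2unit 2 μ} (hp : p ∈ (expGraph μ).topologicalClosure) :
    ∫ ω, inner ℝ (p.2 ω) (x ω) ∂μ = ∫ ω, p.1 ω * y ω ∂μ := by
  -- The defect of the formula is a continuous linear functional of the pair, so its kernel is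
  -- closed and it suffices that the kernel contains the generators.
  set Λ : (Lp ℝ 2 μ × Lp L2unit 2 μ) →L[ℝ] ℝ :=
    (innerSL ℝ (hx.toLp x)).comp (ContinuousLinearMap.snd ℝ _ _)
      - (innerSL ℝ (hy.toLp y)).comp (ContinuousLinearMap.fst ℝ _ _) with hΛ
  have hΛa : ∀ q, Λ q = ∫ ω, inner ℝ (q.2 ω) (x ω) ∂μ - ∫ ω, q.1 ω * y ω ∂μ := by
    intro q
    simp only [hΛ, sub_apply, ContinuousLinearMap.comp_apply,
      ContinuousLinearMap.coe_snd', ContinuousLinearMap.coe_fst', innerSL_apply_apply]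
    rw [L2.inner_def (𝕜 := ℝ) (hx.toLp x) q.2, L2.inner_def (𝕜 := ℝ) (hy.toLp y) q.1]
    congr 1
    · refine integral_congr_ae ?_
      filter_upwards [hx.coeFn_toLp] with ω h1
      rw [h1, real_inner_comm]
    · refine integral_congr_ae ?_
      filter_upwards [hy.coeFn_toLp] with ω h1
      rw [h1]; simp
  have hle : (expGraph μ).topologicalClosure ≤ LinearMap.ker (Λ : _ →ₗ[ℝ] ℝ) := by
    refine Submodule.topologicalClosure_minimal _ ?_ Λ.isClosed_ker
    rw [hμ.expGraph_eq, Submodule.span_le]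
    rintro _ ⟨k, rfl⟩
    rw [SetLike.mem_coe, LinearMap.mem_ker]
    change Λ (hμ.expPair k) = 0
    rw [hΛa, sub_eq_zero]
    refine Eq.trans ?_ ((h k).trans ?_)
    · refine integral_congr_ae ?_
      filter_upwards [(memLp_two_smul_const (hμ.memLp_exp_pairing (toL k)) (toL k)).coeFn_toLp]
        with ω h1
      rw [IsWienerMeasure.expPair, h1, real_inner_smul_left, mul_comm]
    · refine integral_congr_ae ?_
      filter_upwards [(hμ.memLp_exp_pairing (toL k)).coeFn_toLp] with ω h1
      rw [IsWienerMeasure.expPair, h1, mul_comm]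
  have := hle hp
  rw [LinearMap.mem_ker] at this
  exact sub_eq_zero.1 ((hΛa p).symm.trans this)

/-- Integrate by parts along the fields e^m e_i, for m in the dual of C. If the function component
is zero, then ⟨e_i, p.2⟩ is orthogonal to every exponential, hence zero for each i. -/
lemma IsWienerMeasure.closable (hμ : IsWienerMeasure μ) :
    ∀ p ∈ (expGraph μ).topologicalClosure, p.1 = 0 → p.2 = 0 := by
  intro p hp hp1
  have hi : ∀ i, ∀ᵐ ω ∂μ, inner ℝ (eigL i) (p.2 ω) = 0 := by
    intro i
    have hmem : MemLp (fun ω => inner ℝ (eigL i) (p.2 ω)) 2 μ :=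
      (Lp.memLp p.2).const_inner (eigL i)
    refine hμ.ae_eq_zero_of_integral_mul_exp hmem fun m => ?_
    have hem : MemLp (fun ω => Real.exp (m ω)) 2 μ := by simpa using hμ.memLp_exp_dual m 2 (by simp)
    -- The Gaussian divergence of the field e^m e_i; the factor λ_i inverts Q on e_i.
    have hy : MemLp (fun ω => (eigval i * inner ℝ (eigL i) (toL ω)) * Real.exp (m ω)
        - m (eigPath i) * Real.exp (m ω)) 2 μ := by
      refine (hμ.memLp_mul_exp ?_ 1 (eigval i * ‖innerDual (eigL i)‖) (fun ω => ?_) m).sub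
        (hem.const_mul _)
      · exact ((innerDual (eigL i)).continuous.const_smul (eigval i)).aestronglyMeasurable
      · rw [norm_mul, Real.norm_of_nonneg (eigval_pos i).le, mul_assoc, pow_one]
        have := (eigval_pos i).le
        gcongr
        exact (innerDual (eigL i)).le_opNorm ω
    have key := hμ.integral_inner_eq_of_mem (memLp_two_smul_const hem (eigL i)) hy (fun k => ?_) hp
    · rw [hp1] at key
      have h0 : ∫ ω, (0 : Lp ℝ 2 μ) ω * ((eigval i * inner ℝ (eigL i) (toL ω)) * Real.exp (m ω)
        - m (eigPath i) * Real.exp (m ω)) ∂μ = 0 := by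
        rw [← integral_zero WienerPath ℝ (μ := μ)]
        refine integral_congr_ae ?_
        filter_upwards [Lp.coeFn_zero ℝ 2 μ] with ω h1
        rw [h1]; simp
      rw [h0] at key
      rw [← key]
      refine integral_congr_ae (ae_of_all _ fun ω => ?_)
      simp only [real_inner_smul_right]
      rw [real_inner_comm, mul_comm]
    · have h1 := hμ.integral_dual_mul_exp (m + innerDual (toL k)) (innerDual (eigL i))
      have h2 := hμ.dual_covOp (m + innerDual (toL k)) (eigL i)
      rw [hμ.covOp_eigL, map_smul, smul_eq_mul] at h2
      have h3 : ∀ ω, innerDual (eigL i) ω * (m + innerDual (toL k)) ω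
        = (m + innerDual (toL k)) ω * innerDual (eigL i) ω := fun ω => mul_comm _ _
      simp only [← innerDual_apply] at h2 ⊢
      simp only [h3] at h2
      rw [← h2] at h1
      have hexp : ∀ ω, Real.exp (m ω) * Real.exp (innerDual (toL k) ω)
        = Real.exp ((m + innerDual (toL k)) ω) := fun ω => by
        rw [← Real.exp_add]; rfl
      have e1 : ∀ ω, inner ℝ (toL k) (Real.exp (m ω) • eigL i) * Real.exp (innerDual (toL k) ω)
        = innerDual (toL k) (eigPath i) * Real.exp ((m + innerDual (toL k)) ω) := fun ω => by
        rw [real_inner_smul_right, ← hexp, innerDual_apply, innerDual_apply]; ring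
      have e2 : ∀ ω, ((eigval i * innerDual (eigL i) ω) * Real.exp (m ω)
        - m (eigPath i) * Real.exp (m ω)) * Real.exp (innerDual (toL k) ω)
        = eigval i * (innerDual (eigL i) ω * Real.exp ((m + innerDual (toL k)) ω))
          - m (eigPath i) * Real.exp ((m + innerDual (toL k)) ω) := fun ω => by
        rw [← hexp]; ring
      have hI := hμ.integrable_exp_dual (m + innerDual (toL k))
      have hI2 : Integrable
          (fun ω => innerDual (eigL i) ω * Real.exp ((m + innerDual (toL k)) ω)) μ := by
        have := hμ.memLp_mul_exp (f := innerDual (eigL i)) (by fun_prop) 1 ‖innerDual (eigL i)‖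
          (fun ω => by rw [pow_one]; exact (innerDual (eigL i)).le_opNorm ω) (m + innerDual (toL k))
        have hprob := hμ.isProbabilityMeasure
        exact this.integrable (by norm_num)
      simp only [e1, e2]
      rw [integral_const_mul, integral_sub (hI2.const_mul _) (hI.const_mul _), integral_const_mul,
        integral_const_mul, h1]
      have := (eigval_pos i).ne'
      simp only [add_apply]
      field_simp
      ring
  have hall := ae_all_iff.2 hi
  rw [Lp.eq_zero_iff_ae_eq_zero]
  filter_upwards [hall] with ω hω
  refine eq_zero_of_inner_eigL_eq_zero _ fun i => ?_
  rw [real_inner_comm]; exact hω i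

/-! ### Quadratic functionals belong to the domain -/

lemma tendsto_toLp_of_dominated {Ω E : Type*} [MeasurableSpace Ω] {ν : Measure Ω}
    [NormedAddCommGroup E] [InnerProductSpace ℝ E] {f : ℕ → Ω → E} {g : Ω → E} {b : Ω → ℝ}
    (hf : ∀ n, MemLp (f n) 2 ν) (hg : MemLp g 2 ν) (hb : MemLp b 2 ν)
    (hle : ∀ n ω, ‖f n ω‖ ≤ b ω) (hlim : ∀ ω, Tendsto (fun n => f n ω) atTop (𝓝 (g ω))) :
    Tendsto (fun n => (hf n).toLp (f n)) atTop (𝓝 (hg.toLp g)) := by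
  rw [tendsto_iff_norm_sub_tendsto_zero]
  have hnorm : ∀ n, ‖(hf n).toLp (f n) - hg.toLp g‖ ^ 2 = ∫ ω, ‖f n ω - g ω‖ ^ 2 ∂ν := by
    intro n
    rw [← real_inner_self_eq_norm_sq, ← MemLp.toLp_sub, L2.inner_def]
    refine integral_congr_ae ?_
    filter_upwards [((hf n).sub hg).coeFn_toLp] with ω h
    rw [h, real_inner_self_eq_norm_sq]; rfl
  have hgle : ∀ ω, ‖g ω‖ ≤ b ω := fun ω => le_of_tendsto' (hlim ω).norm fun n => hle n ω
  have hlim2 : Tendsto (fun n => ∫ ω, ‖f n ω - g ω‖ ^ 2 ∂ν) atTop (𝓝 (∫ ω, (0 : ℝ) ∂ν)) := by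
    refine tendsto_integral_of_dominated_convergence (fun ω => (2 * b ω) ^ 2)
      (fun n => (((hf n).1.sub hg.1).norm.pow 2)) ?_ (fun n => ae_of_all _ fun ω => ?_)
      (ae_of_all _ fun ω => ?_)
    · exact (hb.const_mul 2).integrable_sq
    · rw [norm_pow, norm_norm]
      gcongr
      calc ‖f n ω - g ω‖ ≤ ‖f n ω‖ + ‖g ω‖ := norm_sub_le _ _
        _ ≤ 2 * b ω := by linarith [hle n ω, hgle ω]
    · have := ((hlim ω).sub_const (g ω)).norm.pow 2
      simpa using this
  simp only [integral_zero, ← hnorm] at hlim2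
  have := hlim2.sqrt
  simpa using this

lemma HasClosedGrad.add {f f' : WienerPath → ℝ} {g g' : WienerPath → L2unit}
    (h : HasClosedGrad μ f g) (h' : HasClosedGrad μ f' g') :
    HasClosedGrad μ (fun ω => f ω + f' ω) (fun ω => g ω + g' ω) := by
  obtain ⟨hf, hg, hm⟩ := h
  obtain ⟨hf', hg', hm'⟩ := h'
  exact ⟨hf.add hf', hg.add hg', Submodule.add_mem _ hm hm'⟩

lemma HasClosedGrad.const_smul {f : WienerPath → ℝ} {g : WienerPath → L2unit}
    (h : HasClosedGrad μ f g) (c : ℝ) :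
    HasClosedGrad μ (fun ω => c * f ω) (fun ω => c • g ω) := by
  obtain ⟨hf, hg, hm⟩ := h
  exact ⟨hf.const_smul c, hg.const_smul c, Submodule.smul_mem _ c hm⟩

lemma HasClosedGrad.zero : HasClosedGrad μ (fun _ => 0) (fun _ => 0) :=
  ⟨MemLp.zero', MemLp.zero', Submodule.zero_mem _⟩

lemma HasClosedGrad.sum {ι : Type*} (s : Finset ι) {f : ι → WienerPath → ℝ}
    {g : ι → WienerPath → L2unit} (h : ∀ i ∈ s, HasClosedGrad μ (f i) (g i)) :
    HasClosedGrad μ (fun ω => ∑ i ∈ s, f i ω) (fun ω => ∑ i ∈ s, g i ω) := by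
  classical
  induction s using Finset.induction_on with
  | empty => simpa using HasClosedGrad.zero
  | insert a s ha ih =>
    simp only [Finset.sum_insert ha]
    exact (h a (Finset.mem_insert_self a s)).add
      (ih fun i hi => h i (Finset.mem_insert_of_mem hi))

/-- The passage from exponentials to polynomials, and then to infinite-rank quadratic forms: the
closed graph contains dominated pointwise limits. -/
lemma HasClosedGrad.of_tendsto {f : ℕ → WienerPath → ℝ} {g : ℕ → WienerPath → L2unit}
    {f' : WienerPath → ℝ} {g' : WienerPath → L2unit} {b c : WienerPath → ℝ}
    (h : ∀ n, HasClosedGrad μ (f n) (g n)) (hf' : MemLp f' 2 μ) (hg' : MemLp g' 2 μ)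
    (hb : MemLp b 2 μ) (hc : MemLp c 2 μ)
    (hfb : ∀ n ω, ‖f n ω‖ ≤ b ω) (hgc : ∀ n ω, ‖g n ω‖ ≤ c ω)
    (hf : ∀ ω, Tendsto (fun n => f n ω) atTop (𝓝 (f' ω)))
    (hg : ∀ ω, Tendsto (fun n => g n ω) atTop (𝓝 (g' ω))) :
    HasClosedGrad μ f' g' := by
  choose hf1 hg1 hm using h
  refine ⟨hf', hg', ?_⟩
  have hcl : IsClosed ((expGraph μ).topologicalClosure : Set (Lp ℝ 2 μ × Lp L2unit 2 μ)) :=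
    Submodule.isClosed_topologicalClosure _
  exact hcl.mem_of_tendsto ((tendsto_toLp_of_dominated hf1 hf' hb hfb hf).prodMk_nhds
    (tendsto_toLp_of_dominated hg1 hg' hc hgc hg)) (Eventually.of_forall hm)

lemma IsWienerMeasure.hasClosedGrad_exp (hμ : IsWienerMeasure μ) (k : WienerPath) :
    HasClosedGrad μ (fun ω => Real.exp (inner ℝ (toL k) (toL ω)))
      (fun ω => Real.exp (inner ℝ (toL k) (toL ω)) • toL k) :=
  ⟨_, _, Submodule.le_topologicalClosure _ (hμ.expPair_mem k)⟩

lemma IsWienerMeasure.hasClosedGrad_one (hμ : IsWienerMeasure μ) :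
    HasClosedGrad μ (fun _ => 1) (fun _ => 0) := by
  have h0 : toL 0 = 0 := map_zero toLCLM
  have := hμ.hasClosedGrad_exp 0
  simpa only [h0, inner_zero_left, Real.exp_zero, smul_zero] using this

lemma abs_sinh_le (x : ℝ) : |Real.sinh x| ≤ |x| * Real.exp |x| := by
  rw [Real.abs_sinh, Real.sinh_eq]
  have h0 := abs_nonneg x
  have h1 := Real.add_one_le_exp (-2 * |x|)
  have h2 : Real.exp (-|x|) = Real.exp |x| * Real.exp (-2 * |x|) := by
    rw [← Real.exp_add]; congr 1; ring
  rw [h2]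
  nlinarith [Real.exp_pos |x|]

lemma abs_sinh_mul_div_le {s : ℝ} (hs : 0 < s) (hs1 : s ≤ 1) (v : ℝ) :
    |Real.sinh (s * v) / s| ≤ |v| * Real.exp |v| := by
  rw [abs_div, abs_of_pos hs, div_le_iff₀ hs]
  refine (abs_sinh_le _).trans ?_
  rw [abs_mul, abs_of_pos hs]
  have : Real.exp (s * |v|) ≤ Real.exp |v| :=
    Real.exp_le_exp.2 (mul_le_of_le_one_left (abs_nonneg v) hs1)
  calc s * |v| * Real.exp (s * |v|) ≤ s * |v| * Real.exp |v| := by gcongr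
    _ = _ := by ring

lemma tendsto_sinh_mul_div (v : ℝ) {s : ℕ → ℝ} (hs : ∀ n, 0 < s n)
    (hlim : Tendsto s atTop (𝓝 0)) :
    Tendsto (fun n => Real.sinh (s n * v) / s n) atTop (𝓝 v) := by
  have hd : HasDerivAt (fun t : ℝ => Real.sinh (t * v)) v 0 := by
    have := ((hasDerivAt_id (0 : ℝ)).mul_const v).sinh
    simpa using this
  have h := hd.tendsto_slope_zero
  have hs' : Tendsto s atTop (𝓝[≠] 0) :=
    tendsto_nhdsWithin_iff.2 ⟨hlim, Eventually.of_forall fun n => (hs n).ne'⟩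
  refine (h.comp hs').congr fun n => ?_
  simp [div_eq_inv_mul]

lemma IsWienerMeasure.memLp_pow_mul_exp_abs (hμ : IsWienerMeasure μ) (m : WienerPath →L[ℝ] ℝ)
    (n : ℕ) (C : ℝ) :
    MemLp (fun ω => C * (|m ω| ^ n * Real.exp |m ω|)) 2 μ := by
  have hc : Continuous fun ω => |m ω| ^ n := m.continuous.abs.pow n
  have hb : ∀ ω, ‖|m ω| ^ n‖ ≤ ‖m‖ ^ n * ‖ω‖ ^ n := fun ω => by
    rw [norm_pow, Real.norm_eq_abs, abs_abs, ← mul_pow]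
    gcongr
    exact m.le_opNorm ω
  have h1 := hμ.memLp_mul_exp hc.aestronglyMeasurable n _ hb m
  have h2 := hμ.memLp_mul_exp hc.aestronglyMeasurable n _ hb (-m)
  refine (MemLp.mono (f := fun ω => |m ω| ^ n * Real.exp |m ω|) (h1.add h2) ?_
    (ae_of_all _ fun ω => ?_)).const_mul C
  · exact (hc.mul (Real.continuous_exp.comp m.continuous.abs)).aestronglyMeasurable
  · rw [Real.norm_of_nonneg (by positivity)]
    refine le_trans ?_ (le_abs_self _)
    simp only [Pi.add_apply, ← mul_add]
    gcongr
    rcases abs_cases (m ω) with ⟨h, -⟩ | ⟨h, -⟩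
    · rw [h]; linarith [Real.exp_pos ((-m) ω)]
    · rw [h]
      have : Real.exp (-(m ω)) = Real.exp ((-m) ω) := rfl
      linarith [Real.exp_pos (m ω)]

/-- With m = ⟨k,·⟩, the square m² is the limit of the second differences (e^{sm} + e^{-sm} − 2)/s²
as s → 0. Writing these as (2 sinh(sm/2)/s)², with gradient (2 sinh(sm)/s) k, gives bounds uniform
in s ≤ 1. -/
lemma IsWienerMeasure.hasClosedGrad_inner_sq (hμ : IsWienerMeasure μ) (k : WienerPath) :
    HasClosedGrad μ (fun ω => inner ℝ (toL k) (toL ω) ^ 2)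
      (fun ω => (2 * inner ℝ (toL k) (toL ω)) • toL k) := by
  set m : WienerPath →L[ℝ] ℝ := innerDual (toL k) with hm
  set s : ℕ → ℝ := fun n => 1 / ((n : ℝ) + 1) with hs
  have hs0 : ∀ n, 0 < s n := fun n => by positivity
  have hs1 : ∀ n, s n ≤ 1 := fun n => by
    rw [hs]; simp only; rw [div_le_one (by positivity)]; linarith [n.cast_nonneg (α := ℝ)]
  have hlim : Tendsto s atTop (𝓝 0) := tendsto_one_div_add_atTop_nhds_zero_nat
  have hgr : ∀ n, HasClosedGrad μ (fun ω => (2 * (Real.sinh (s n * (m ω / 2)) / s n)) ^ 2)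
      (fun ω => (2 * (Real.sinh (s n * m ω) / s n)) • toL k) := by
    intro n
    have h1 := hμ.hasClosedGrad_exp (s n • k)
    have h2 := hμ.hasClosedGrad_exp (-(s n) • k)
    have h3 := (((h1.add h2).add (hμ.hasClosedGrad_one.const_smul (-2))).const_smul
      ((s n) ^ 2)⁻¹)
    have e : ∀ c : ℝ, toL (c • k) = c • toL k := fun c => map_smul toLCLM c k
    have hsn := (hs0 n).ne'
    convert h3 using 1
    · ext ω
      simp only [e, real_inner_smul_left]
      change _ = ((s n) ^ 2)⁻¹ * (Real.exp (s n * m ω) + Real.exp (-s n * m ω) + -2 * 1)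
      rw [Real.sinh_eq]
      have e1 : Real.exp (s n * m ω) = Real.exp (s n * (m ω / 2)) ^ 2 := by
        rw [← Real.exp_nat_mul]; congr 1; push_cast; ring
      have e2 : Real.exp (-s n * m ω) = Real.exp (-(s n * (m ω / 2))) ^ 2 := by
        rw [← Real.exp_nat_mul]; congr 1; push_cast; ring
      have e3 : Real.exp (s n * (m ω / 2)) * Real.exp (-(s n * (m ω / 2))) = 1 := by
        rw [← Real.exp_add]; simp
      rw [e1, e2]
      generalize Real.exp (s n * (m ω / 2)) = a at *
      generalize Real.exp (-(s n * (m ω / 2))) = b at *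
      field_simp
      linear_combination (-2) * e3
    · ext1 ω
      simp only [e, real_inner_smul_left, smul_zero, add_zero]
      change _ = ((s n) ^ 2)⁻¹ • (Real.exp (s n * m ω) • s n • toL k
        + Real.exp (-s n * m ω) • -s n • toL k)
      rw [smul_smul, smul_smul, ← add_smul, smul_smul, Real.sinh_eq]
      congr 1
      rw [neg_mul]
      field_simp
      ring
  have hmem : MemLp (fun ω => inner ℝ (toL k) (toL ω) ^ 2) 2 μ := by
    refine hμ.memLp_of_le_norm_pow (m.continuous.pow 2).aestronglyMeasurable 2 (‖m‖ ^ 2)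
      (fun ω => ?_) 2 (by simp)
    rw [Pi.pow_apply, norm_pow, ← mul_pow]
    gcongr
    exact m.le_opNorm ω
  have hmem1 : MemLp (fun ω => 2 * inner ℝ (toL k) (toL ω)) 2 μ := by
    refine (hμ.memLp_of_le_norm_pow m.continuous.aestronglyMeasurable 1 ‖m‖
      (fun ω => ?_) 2 (by simp)).const_mul 2
    rw [pow_one]
    exact m.le_opNorm ω
  refine HasClosedGrad.of_tendsto hgr hmem (memLp_two_smul_const hmem1 _)
    (hμ.memLp_pow_mul_exp_abs m 2 1) (hμ.memLp_pow_mul_exp_abs m 1 (2 * ‖toL k‖))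
    (fun n ω => ?_) (fun n ω => ?_) (fun ω => ?_) (fun ω => ?_)
  · rw [norm_pow, Real.norm_eq_abs, abs_mul, abs_two]
    have h := abs_sinh_mul_div_le (hs0 n) (hs1 n) (m ω / 2)
    rw [abs_div (m ω), abs_two] at h
    have h2 : (2 * |Real.sinh (s n * (m ω / 2)) / s n|) ^ 2
        ≤ (2 * (|m ω| / 2 * Real.exp (|m ω| / 2))) ^ 2 := by gcongr
    refine h2.trans (le_of_eq ?_)
    have : Real.exp |m ω| = Real.exp (|m ω| / 2) ^ 2 := by
      rw [← Real.exp_nat_mul]; congr 1; push_cast; ring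
    rw [this]; ring
  · rw [norm_smul, norm_mul, Real.norm_eq_abs, Real.norm_eq_abs, abs_two]
    have h := abs_sinh_mul_div_le (hs0 n) (hs1 n) (m ω)
    calc 2 * |Real.sinh (s n * m ω) / s n| * ‖toL k‖
        ≤ 2 * (|m ω| * Real.exp |m ω|) * ‖toL k‖ := by gcongr
      _ = _ := by ring
  · have := ((tendsto_sinh_mul_div (m ω / 2) hs0 hlim).const_mul 2).pow 2
    refine this.trans (le_of_eq ?_)
    congr 1
    change _ = (m ω) ^ 2; ring
  · exact ((tendsto_sinh_mul_div (m ω) hs0 hlim).const_mul 2).smul_const _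

/-- Polarization of the square. -/
lemma IsWienerMeasure.hasClosedGrad_inner_mul (hμ : IsWienerMeasure μ) (k l : WienerPath) :
    HasClosedGrad μ (fun ω => inner ℝ (toL k) (toL ω) * inner ℝ (toL l) (toL ω))
      (fun ω => inner ℝ (toL k) (toL ω) • toL l + inner ℝ (toL l) (toL ω) • toL k) := by
  have e : toL (k + l) = toL k + toL l := map_add toLCLM k l
  have h := ((hμ.hasClosedGrad_inner_sq (k + l)).add
    (((hμ.hasClosedGrad_inner_sq k).add (hμ.hasClosedGrad_inner_sq l)).const_smul (-1))).const_smul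
    (1 / 2)
  convert h using 1
  · ext ω; rw [e, inner_add_left]; ring
  · ext1 ω
    rw [e, inner_add_left]
    module

section Quadratic

variable {H : Type*} [NormedAddCommGroup H] [InnerProductSpace ℝ H] [CompleteSpace H]

/-- The orthogonal projection on the span of the first `n` eigenfunctions. -/
def eigProj (n : ℕ) (x : L2unit) : L2unit := ∑ i ∈ Finset.range n, inner ℝ (eigL i) x • eigL i

lemma tendsto_eigProj (x : L2unit) : Tendsto (fun n => eigProj n x) atTop (𝓝 x) := by
  have h := (eigBasis.hasSum_repr x).tendsto_sum_nat
  simpa only [eigBasis.repr_apply_apply, eigBasis_apply, eigProj] using h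

lemma norm_eigProj_le (n : ℕ) (x : L2unit) : ‖eigProj n x‖ ≤ ‖x‖ := by
  refine le_of_sq_le_sq ?_ (norm_nonneg x)
  have h : ‖eigProj n x‖ ^ 2 = ∑ i ∈ Finset.range n, ‖inner ℝ (eigL i) x‖ ^ 2 := by
    rw [← real_inner_self_eq_norm_sq, eigProj, orthonormal_eigL.inner_sum]
    simp [pow_two]
  rw [h]
  exact orthonormal_eigL.sum_inner_products_le x

lemma tendsto_eigProj_of_tendsto {u : ℕ → L2unit} {x : L2unit} (hu : Tendsto u atTop (𝓝 x)) :
    Tendsto (fun n => eigProj n (u n)) atTop (𝓝 x) := by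
  have h1 : Tendsto (fun n => eigProj n (u n - x)) atTop (𝓝 0) :=
    squeeze_zero_norm (fun n => norm_eigProj_le n _) (tendsto_iff_norm_sub_tendsto_zero.1 hu)
  have h2 := h1.add (tendsto_eigProj x)
  rw [zero_add] at h2
  refine h2.congr fun n => ?_
  simp only [eigProj, inner_sub_right, sub_smul, Finset.sum_sub_distrib, sub_add_cancel]

open ContinuousLinearMap in
-- Let P_n be the projection on the first n eigenfunctions, which are paths in C. The form ‖S P_n
-- ω‖² is a finite sum of products of pairings, with gradient 2 P_n S*S P_n ω. Both converge
-- pointwise and are dominated because P_n is a contraction.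
lemma IsWienerMeasure.hasClosedGrad_norm_sq (hμ : IsWienerMeasure μ) (S : L2unit →L[ℝ] H) :
    HasClosedGrad μ (fun ω => ‖S (toL ω)‖ ^ 2)
      (fun ω => (2 : ℝ) • (adjoint S) (S (toL ω))) := by
  have hgr : ∀ n, HasClosedGrad μ (fun ω => ‖S (eigProj n (toL ω))‖ ^ 2)
      (fun ω => (2 : ℝ) • eigProj n ((adjoint S) (S (eigProj n (toL ω))))) := by
    intro n
    have h := HasClosedGrad.sum (Finset.range n) fun i _ =>
      HasClosedGrad.sum (Finset.range n) fun j _ =>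
        (hμ.hasClosedGrad_inner_mul (eigPath i) (eigPath j)).const_smul
          (inner ℝ (S (eigL i)) (S (eigL j)))
    convert h using 1
    · ext ω
      rw [← real_inner_self_eq_norm_sq, eigProj, map_sum, sum_inner]
      refine Finset.sum_congr rfl fun i _ => ?_
      rw [inner_sum]
      refine Finset.sum_congr rfl fun j _ => ?_
      rw [map_smul, map_smul, real_inner_smul_left, real_inner_smul_right]
      ring
    · ext1 ω
      simp only [smul_add, Finset.sum_add_distrib]
      have key : eigProj n ((adjoint S) (S (eigProj n (toL ω)))) = ∑ i ∈ Finset.range n,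
          ∑ j ∈ Finset.range n, inner ℝ (S (eigL i)) (S (eigL j)) •
            inner ℝ (eigL j) (toL ω) • eigL i := by
        conv_lhs => rw [eigProj]
        refine Finset.sum_congr rfl fun i _ => ?_
        rw [adjoint_inner_right, eigProj, map_sum, inner_sum, Finset.sum_smul]
        refine Finset.sum_congr rfl fun j _ => ?_
        rw [map_smul, real_inner_smul_right, smul_smul, mul_comm]
      have key2 : ∑ i ∈ Finset.range n, ∑ j ∈ Finset.range n,
          inner ℝ (S (eigL i)) (S (eigL j)) • inner ℝ (eigL i) (toL ω) • eigL j
          = eigProj n ((adjoint S) (S (eigProj n (toL ω)))) := by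
        rw [key, Finset.sum_comm]
        refine Finset.sum_congr rfl fun i _ => Finset.sum_congr rfl fun j _ => ?_
        rw [real_inner_comm]
      rw [two_smul]
      nth_rewrite 1 [← key2]
      rw [key]
  have hS : ∀ n ω, ‖S (eigProj n (toL ω))‖ ≤ ‖S‖ * ‖ω‖ := fun n ω => by
    refine (S.le_opNorm _).trans ?_
    gcongr
    exact (norm_eigProj_le n _).trans (norm_toL_le ω)
  have hb : ∀ (n : ℕ) (C : ℝ), MemLp (fun ω : WienerPath => C * ‖ω‖ ^ n) 2 μ := fun n C =>
    (hμ.memLp_norm_pow n 2 (by simp)).const_mul C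
  have hS' : ∀ ω : WienerPath, ‖S (toL ω)‖ ≤ ‖S‖ * ‖ω‖ := fun ω => by
    refine (S.le_opNorm _).trans ?_
    gcongr
    exact norm_toL_le ω
  have hSc : Continuous fun ω => S (toL ω) := S.continuous.comp continuous_toL
  refine HasClosedGrad.of_tendsto hgr
    (hμ.memLp_of_le_norm_pow (hSc.norm.pow 2).aestronglyMeasurable 2 (‖S‖ ^ 2) (fun ω => ?_) 2
      (by simp))
    (hμ.memLp_of_le_norm_pow
      (((adjoint S).continuous.comp hSc).const_smul (2 : ℝ)).aestronglyMeasurable 1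
      (2 * (‖S‖ * ‖S‖)) (fun ω => ?_) 2 (by simp))
    (hb 2 (‖S‖ ^ 2)) (hb 1 (2 * (‖S‖ * ‖S‖))) (fun n ω => ?_) (fun n ω => ?_) (fun ω => ?_)
    (fun ω => ?_)
  · rw [Pi.pow_apply, norm_pow, norm_norm, ← mul_pow]; gcongr; exact hS' ω
  · rw [Pi.smul_apply, norm_smul, pow_one, Real.norm_eq_abs, abs_two, mul_assoc, mul_assoc]
    gcongr
    refine ((adjoint S).le_opNorm _).trans ?_
    rw [LinearIsometryEquiv.norm_map]
    gcongr; exact hS' ω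
  · rw [norm_pow, norm_norm, ← mul_pow]; gcongr; exact hS n ω
  · rw [norm_smul, pow_one, Real.norm_eq_abs, abs_two, mul_assoc, mul_assoc]
    gcongr
    refine (norm_eigProj_le n _).trans (((adjoint S).le_opNorm _).trans ?_)
    rw [LinearIsometryEquiv.norm_map]
    gcongr; exact hS n ω
  · exact ((S.continuous.tendsto _).comp (tendsto_eigProj (toL ω))).norm.pow 2
  · refine Tendsto.const_smul ?_ _
    exact tendsto_eigProj_of_tendsto (((adjoint S).continuous.tendsto _).comp
      ((S.continuous.tendsto _).comp (tendsto_eigProj (toL ω))))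

end Quadratic

/-! ### The Ornstein–Uhlenbeck kernel -/

lemma eigval_eq_sq (i : ℕ) : eigval i = freq i ^ 2 := (Real.sq_sqrt (eigval_pos i).le).symm

lemma one_le_eigval (i : ℕ) : 1 ≤ eigval i := by
  rw [eigval]
  have h := Real.pi_gt_three
  have hi : (0 : ℝ) ≤ i := i.cast_nonneg
  nlinarith [mul_nonneg hi hi, mul_nonneg (sq_nonneg Real.pi) hi,
    mul_nonneg (sq_nonneg Real.pi) (mul_nonneg hi hi)]

lemma summable_eigval_mul_exp {t : ℝ} (ht : 0 < t) :
    Summable fun i : ℕ => eigval i * Real.exp (-(eigval i * t)) := by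
  refine Summable.of_nonneg_of_le (fun i => mul_nonneg (eigval_pos i).le (Real.exp_pos _).le)
    (fun i => ?_) (summable_inv_eigval.mul_left (2 / t ^ 2))
  have h := eigval_pos i
  -- From e^x ≥ x²/2 it follows that λ e^{-λt} ≤ (2/t²) λ⁻¹, which is summable.
  have h2 := Real.pow_div_factorial_le_exp (eigval i * t) (by positivity) 2
  rw [Real.exp_neg, ← div_eq_mul_inv, div_le_iff₀ (Real.exp_pos _)]
  refine le_trans (le_of_eq ?_) (mul_le_mul_of_nonneg_left h2 (by positivity))
  norm_num [Nat.factorial]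
  field_simp

lemma summable_exp_eigval {t : ℝ} (ht : 0 < t) :
    Summable fun i : ℕ => Real.exp (-(eigval i * t)) := by
  refine Summable.of_nonneg_of_le (fun i => (Real.exp_pos _).le) (fun i => ?_)
    (summable_eigval_mul_exp ht)
  exact le_mul_of_one_le_left (Real.exp_pos _).le (one_le_eigval i)

lemma norm_eigL (i : ℕ) : ‖eigL i‖ = 1 := orthonormal_eigL.1 i

lemma norm_eigPath_le (i : ℕ) : ‖eigPath i‖ ≤ 2 := by
  change ‖(eigPath i : C(I, ℝ))‖ ≤ 2
  refine (ContinuousMap.norm_le _ (by norm_num)).2 fun θ => ?_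
  change |Real.sqrt 2 * Real.sin _| ≤ 2
  rw [abs_mul, abs_of_nonneg (Real.sqrt_nonneg 2)]
  have h1 : Real.sqrt 2 ≤ 2 := by rw [Real.sqrt_le_left (by norm_num)]; norm_num
  calc Real.sqrt 2 * _ ≤ 2 * 1 := by
        gcongr; exact Real.abs_sin_le_one _
    _ = 2 := by norm_num

lemma norm_innerDual_le (h : L2unit) : ‖innerDual h‖ ≤ ‖h‖ := by
  refine ContinuousLinearMap.opNorm_le_bound _ (norm_nonneg _) fun ω => ?_
  rw [innerDual_apply]
  refine (norm_inner_le_norm _ _).trans ?_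
  gcongr
  exact norm_toL_le ω

/-- The operator `y ↦ ∑ c_i ⟨y, e_i⟩ e_i` on paths. -/
def diagOp (c : ℕ → ℝ) : WienerPath →L[ℝ] WienerPath :=
  ∑' i, c i • (innerDual (eigL i)).smulRight (eigPath i)

lemma hasSum_diagOp {c : ℕ → ℝ} (hc : Summable fun i => |c i|) :
    HasSum (fun i => c i • (innerDual (eigL i)).smulRight (eigPath i)) (diagOp c) := by
  refine Summable.hasSum (Summable.of_norm_bounded (hc.mul_right 2) fun i => ?_)
  rw [norm_smul, Real.norm_eq_abs]
  gcongr
  rw [ContinuousLinearMap.norm_smulRight_apply]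
  calc ‖innerDual (eigL i)‖ * ‖eigPath i‖ ≤ 1 * 2 :=
        mul_le_mul ((norm_innerDual_le _).trans (norm_eigL i).le) (norm_eigPath_le i)
          (norm_nonneg _) zero_le_one
    _ = 2 := by norm_num

lemma hasSum_diagOp_apply {c : ℕ → ℝ} (hc : Summable fun i => |c i|) (y : WienerPath) :
    HasSum (fun i => (c i * inner ℝ (eigL i) (toL y)) • eigPath i) (diagOp c y) := by
  have h := (hasSum_diagOp hc).mapL (ContinuousLinearMap.apply ℝ WienerPath y)
  refine h.congr_fun ?_
  intro i
  simp [mul_smul]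

lemma pairing_eigPath (y : WienerPath) (i : ℕ) :
    pairing y (eigPath i) = inner ℝ (eigL i) (toL y) := real_inner_comm _ _

lemma diagOp_eigPath {c : ℕ → ℝ} (hc : Summable fun i => |c i|) (i : ℕ) :
    diagOp c (eigPath i) = c i • eigPath i := by
  refine (hasSum_diagOp_apply hc (eigPath i)).unique ?_
  have h := hasSum_ite_eq i (c i • eigPath i)
  refine h.congr_fun fun j => ?_
  rw [inner_eigL]
  split_ifs with h
  · rw [h, mul_one]
  · simp

lemma summable_abs_heat {t : ℝ} (ht : 0 < t) :
    Summable fun i : ℕ => |Real.exp (-(eigval i * t / 2))| := by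
  simpa only [Real.abs_exp, mul_div_assoc] using summable_exp_eigval (half_pos ht)

lemma heat_eq_diagOp {t : ℝ} (ht : 0 < t) (z : WienerPath) :
    heat t z = diagOp (fun i => Real.exp (-(eigval i * t / 2))) z := by
  rw [heat]
  simp only [pairing_eigPath]
  exact (hasSum_diagOp_apply (summable_abs_heat ht) z).tsum_eq

/-- The weight of `e_i` in `1 - (1 - e^{2tA})^{1/2}`. -/
def noiseWeight (t : ℝ) (i : ℕ) : ℝ := 1 - Real.sqrt (1 - Real.exp (-(eigval i * t)))

/-- For 0 ≤ a ≤ 1 one has 0 ≤ 1 − √(1 − a) ≤ a; here a = e^{-λ_i t}. -/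
lemma summable_abs_noiseWeight {t : ℝ} (ht : 0 < t) : Summable fun i => |noiseWeight t i| := by
  refine Summable.of_nonneg_of_le (fun i => abs_nonneg _) (fun i => ?_) (summable_exp_eigval ht)
  have h1 : Real.exp (-(eigval i * t)) ≤ 1 := by
    rw [Real.exp_le_one_iff]; nlinarith [eigval_pos i]
  have h0 := Real.exp_pos (-(eigval i * t))
  rw [noiseWeight]
  set a := Real.exp (-(eigval i * t))
  have h2 : Real.sqrt (1 - a) ≤ 1 := by rw [Real.sqrt_le_one]; linarith
  rw [abs_of_nonneg (by linarith)]
  have h3 := Real.sq_sqrt (show 0 ≤ 1 - a by linarith)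
  nlinarith [Real.sqrt_nonneg (1 - a)]

lemma noiseOp_eq_diagOp {t : ℝ} (ht : 0 < t) (y : WienerPath) :
    noiseOp t y = y - diagOp (noiseWeight t) y := by
  rw [noiseOp]
  simp only [pairing_eigPath]
  rw [← (hasSum_diagOp_apply (summable_abs_noiseWeight ht) y).tsum_eq]
  rfl

/-- Equivalently (1 − w)² = 1 − e^{-λ_i t}. This is how the choice of square root enters the
covariance of the noise. -/
lemma two_mul_noiseWeight_sub_sq {t : ℝ} (ht : 0 < t) (i : ℕ) :
    2 * noiseWeight t i - noiseWeight t i ^ 2 = Real.exp (-(eigval i * t)) := by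
  have h1 : Real.exp (-(eigval i * t)) ≤ 1 := by
    rw [Real.exp_le_one_iff]; nlinarith [eigval_pos i]
  rw [noiseWeight]
  linear_combination -(Real.sq_sqrt (show 0 ≤ 1 - Real.exp (-(eigval i * t)) by linarith))

section

variable {H : Type*} [NormedAddCommGroup H] [InnerProductSpace ℝ H]

lemma IsWienerMeasure.integrable_inner (hμ : IsWienerMeasure μ)
    (U V : WienerPath →L[ℝ] H) : Integrable (fun y => inner ℝ (U y) (V y)) μ := by
  refine hμ.integrable_of_le_norm_pow
    (U.continuous.inner V.continuous).aestronglyMeasurable 2 (‖U‖ * ‖V‖) fun y => ?_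
  refine (norm_inner_le_norm _ _).trans ?_
  calc ‖U y‖ * ‖V y‖ ≤ (‖U‖ * ‖y‖) * (‖V‖ * ‖y‖) := by
        gcongr
        · exact U.le_opNorm y
        · exact V.le_opNorm y
    _ = _ := by ring

variable [CompleteSpace H]

/-- Each mode contributes c_i ⟨U Q e_i, V e_i⟩ with Q e_i = e_i/λ_i. Summation and expectation may
be exchanged because the i-th term is at most a constant times |c_i| ‖y‖². -/
lemma IsWienerMeasure.hasSum_integral_inner_diagOp (hμ : IsWienerMeasure μ)
    (U V : WienerPath →L[ℝ] H) {c : ℕ → ℝ} (hc : Summable fun i => |c i|) :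
    HasSum (fun i => c i * (eigval i)⁻¹ * inner ℝ (U (eigPath i)) (V (eigPath i)))
      (∫ y, inner ℝ (U y) (V (diagOp c y)) ∂μ) := by
  have := hμ.isProbabilityMeasure
  have hint : ∀ i, Integrable (fun y => inner ℝ (eigL i) (toL y) • U y) μ := fun i => by
    refine hμ.integrable_of_le_norm_pow
      (((innerDual (eigL i)).continuous.smul U.continuous).aestronglyMeasurable) 2 ‖U‖ fun y => ?_
    rw [norm_smul]
    have h1 : ‖innerDual (eigL i) y‖ ≤ 1 * ‖y‖ :=
      ((innerDual (eigL i)).le_opNorm y).trans (by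
        gcongr; exact (norm_innerDual_le _).trans (norm_eigL i).le)
    calc _ ≤ (1 * ‖y‖) * (‖U‖ * ‖y‖) := by
          gcongr
          · exact h1
          · exact U.le_opNorm y
      _ = _ := by ring
  set F : ℕ → WienerPath → ℝ := fun i y =>
    c i * inner ℝ (inner ℝ (eigL i) (toL y) • U y) (V (eigPath i)) with hF
  have hFint : ∀ i, Integrable (F i) μ := fun i => ((hint i).inner_const _).const_mul _
  have hFle : ∀ i y, ‖F i y‖ ≤ |c i| * (2 * ‖U‖ * ‖V‖ * ‖y‖ ^ 2) := fun i y => by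
    rw [hF]
    simp only
    rw [norm_mul, Real.norm_eq_abs]
    gcongr
    refine (norm_inner_le_norm _ _).trans ?_
    rw [norm_smul]
    have h1 : ‖innerDual (eigL i) y‖ ≤ 1 * ‖y‖ :=
      ((innerDual (eigL i)).le_opNorm y).trans (by
        gcongr; exact (norm_innerDual_le _).trans (norm_eigL i).le)
    calc _ ≤ ((1 * ‖y‖) * (‖U‖ * ‖y‖)) * (‖V‖ * 2) := by
          gcongr
          · exact h1
          · exact U.le_opNorm y
          · exact (V.le_opNorm _).trans (by gcongr; exact norm_eigPath_le i)
      _ = _ := by ring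
  have hsum : Summable fun i => ∫ y, ‖F i y‖ ∂μ := by
    refine Summable.of_nonneg_of_le (fun i => integral_nonneg fun y => norm_nonneg _)
      (fun i => ?_) (hc.mul_right (∫ y, 2 * ‖U‖ * ‖V‖ * ‖y‖ ^ 2 ∂μ))
    rw [← integral_const_mul]
    refine integral_mono (hFint i).norm ?_ (hFle i)
    exact (((hμ.memLp_norm_pow 2 1 (by simp)).integrable le_rfl).const_mul _).const_mul _
  have h := hasSum_integral_of_summable_integral_norm hFint hsum
  have e1 : ∀ y, ∑' i, F i y = inner ℝ (U y) (V (diagOp c y)) := fun y => by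
    have h1 := ((hasSum_diagOp_apply hc y).mapL V).mapL (innerSL ℝ (U y))
    refine (h1.congr_fun fun i => ?_).tsum_eq
    simp only [hF, map_smul, innerSL_apply_apply, real_inner_smul_left, smul_eq_mul]
    ring
  simp only [e1] at h
  refine h.congr_fun fun i => ?_
  rw [hF]
  simp only
  rw [integral_const_mul]
  have e2 : ∀ y, inner ℝ (inner ℝ (eigL i) (toL y) • U y) (V (eigPath i))
      = inner ℝ (V (eigPath i)) (inner ℝ (eigL i) (toL y) • U y) := fun y => real_inner_comm _ _
  simp only [e2]
  rw [integral_inner (hint i), ← hμ.map_covOp, hμ.covOp_eigL, map_smul, real_inner_smul_right,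
    real_inner_comm, mul_assoc]

/-- The norm of `V` applied to the noise part of the Ornstein–Uhlenbeck kernel. -/
lemma IsWienerMeasure.integral_norm_sq_noiseOp (hμ : IsWienerMeasure μ)
    (V : WienerPath →L[ℝ] H) {t : ℝ} (ht : 0 < t) :
    ∫ y, ‖V (noiseOp t y)‖ ^ 2 ∂μ = ∫ y, ‖V y‖ ^ 2 ∂μ
      - ∑' i, Real.exp (-(eigval i * t)) * ((eigval i)⁻¹ * ‖V (eigPath i)‖ ^ 2) := by
  have hc := summable_abs_noiseWeight ht
  set W := diagOp (noiseWeight t) with hW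
  have e : ∀ y, ‖V (noiseOp t y)‖ ^ 2
      = ‖V y‖ ^ 2 - (2 * inner ℝ (V y) (V (W y)) - inner ℝ ((V.comp W) y) (V (W y))) := fun y => by
    rw [noiseOp_eq_diagOp ht, map_sub, norm_sub_sq_real, ContinuousLinearMap.comp_apply,
      real_inner_self_eq_norm_sq]
    ring
  have i1 : Integrable (fun y => ‖V y‖ ^ 2) μ := by
    simpa only [real_inner_self_eq_norm_sq] using hμ.integrable_inner V V
  have i2 : Integrable (fun y => 2 * inner ℝ (V y) (V (W y))) μ :=
    (hμ.integrable_inner V (V.comp W)).const_mul 2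
  have i3 : Integrable (fun y => inner ℝ ((V.comp W) y) (V (W y))) μ :=
    hμ.integrable_inner (V.comp W) (V.comp W)
  have i4 : Integrable
    (fun y => 2 * inner ℝ (V y) (V (W y)) - inner ℝ ((V.comp W) y) (V (W y))) μ := i2.sub i3
  simp only [e]
  rw [integral_sub i1 i4, integral_sub i2 i3, integral_const_mul]
  congr 1
  -- As W multiplies e_i by its weight w_i, the two series combine with coefficient 2w_i − w_i² =
  -- e^{-λ_i t}.
  have h := ((hμ.hasSum_integral_inner_diagOp V V hc).mul_left 2).sub
    (hμ.hasSum_integral_inner_diagOp (V.comp W) V hc)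
  rw [← h.tsum_eq]
  congr 1
  ext i
  rw [ContinuousLinearMap.comp_apply, hW, diagOp_eigPath hc, map_smul, real_inner_smul_left,
    real_inner_self_eq_norm_sq, ← two_mul_noiseWeight_sub_sq ht]
  ring

lemma continuous_noiseOp {t : ℝ} (ht : 0 < t) : Continuous (noiseOp t) := by
  have : noiseOp t = fun y => y - diagOp (noiseWeight t) y := funext (noiseOp_eq_diagOp ht)
  rw [this]
  exact continuous_id.sub (diagOp _).continuous

/-- The Ornstein–Uhlenbeck semigroup on quadratic functionals. -/
lemma IsWienerMeasure.integrable_and_ouSemigroup_norm_sq (hμ : IsWienerMeasure μ)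
    (V : WienerPath →L[ℝ] H) (a : ℝ) {t : ℝ} (ht : 0 < t) (z : WienerPath) :
    Integrable (fun ω => ‖V ω‖ ^ 2 - a) (ouKernel μ t z) ∧
    ouSemigroup μ t (fun ω => ‖V ω‖ ^ 2 - a) z = ‖V (heat t z)‖ ^ 2 + ∫ y, ‖V y‖ ^ 2 ∂μ - a
      - ∑' i, Real.exp (-(eigval i * t)) * ((eigval i)⁻¹ * ‖V (eigPath i)‖ ^ 2) := by
  have := hμ.isProbabilityMeasure
  have hcont : Continuous fun y => heat t z + noiseOp t y :=
    continuous_const.add (continuous_noiseOp ht)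
  have hG : Continuous fun ω => ‖V ω‖ ^ 2 - a := (V.continuous.norm.pow 2).sub continuous_const
  set N : WienerPath →L[ℝ] WienerPath := .id ℝ WienerPath - diagOp (noiseWeight t) with hN
  have eN : ∀ y, noiseOp t y = N y := fun y => by rw [noiseOp_eq_diagOp ht]; rfl
  -- The cross term of the expanded square is linear in y and has mean zero.
  have e : ∀ y, ‖V (heat t z + noiseOp t y)‖ ^ 2 - a = (‖V (heat t z)‖ ^ 2 - a)
      + ((2 : ℝ) • ((innerSL ℝ (V (heat t z))).comp (V.comp N)) y + ‖V (noiseOp t y)‖ ^ 2) :=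
    fun y => by
    rw [map_add, norm_add_sq_real, eN]
    simp
    ring
  have i1 : Integrable (fun _ : WienerPath => ‖V (heat t z)‖ ^ 2 - a) μ := integrable_const _
  have i2 : Integrable (fun y => (2 : ℝ) • ((innerSL ℝ (V (heat t z))).comp (V.comp N)) y) μ := by
    refine Integrable.smul (2 : ℝ) (hμ.integrable_of_le_norm_pow
      (ContinuousLinearMap.continuous _).aestronglyMeasurable 1
      ‖(innerSL ℝ (V (heat t z))).comp (V.comp N)‖ fun y => ?_)
    rw [pow_one]
    exact ContinuousLinearMap.le_opNorm _ y
  have i3 : Integrable (fun y => ‖V (noiseOp t y)‖ ^ 2) μ := by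
    simpa only [real_inner_self_eq_norm_sq, eN, ContinuousLinearMap.comp_apply] using
      hμ.integrable_inner (V.comp N) (V.comp N)
  have i4 : Integrable (fun y => (2 : ℝ) • ((innerSL ℝ (V (heat t z))).comp (V.comp N)) y
      + ‖V (noiseOp t y)‖ ^ 2) μ := i2.add i3
  constructor
  · rw [ouKernel, integrable_map_measure hG.aestronglyMeasurable hcont.aemeasurable]
    refine (i1.add i4).congr (ae_of_all _ fun y => ?_)
    exact (e y).symm
  · rw [ouSemigroup, ouKernel, integral_map hcont.aemeasurable hG.aestronglyMeasurable]
    simp only [e]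
    rw [integral_add i1 i4, integral_add i2 i3, integral_smul, hμ.integral_dual,
      hμ.integral_norm_sq_noiseOp V ht, integral_const]
    simp
    ring

end

/-! ### The derivative of the heat flow -/

/-- `∂_θ z(t, ·)` as an element of `L`, for `t > 0`. -/
def heatDeriv (t : ℝ) (x : L2unit) : L2unit :=
  ∑' i, (freq i * Real.exp (-(eigval i * t / 2)) * inner ℝ (eigL i) x) • cosL i

lemma freq_pos (i : ℕ) : 0 < freq i := sqrt_eigval_pos i

lemma freq_le_eigval (i : ℕ) : freq i ≤ eigval i := by
  have h := one_le_eigval i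
  rw [eigval_eq_sq] at h ⊢
  nlinarith [freq_pos i]

lemma norm_cosL (i : ℕ) : ‖cosL i‖ = 1 := orthonormal_cosL.1 i

lemma summable_freq_mul_exp {t : ℝ} (ht : 0 < t) :
    Summable fun i : ℕ => freq i * Real.exp (-(eigval i * t / 2)) := by
  refine Summable.of_nonneg_of_le (fun i => mul_nonneg (freq_pos i).le (Real.exp_pos _).le)
    (fun i => ?_) (summable_eigval_mul_exp (half_pos ht))
  rw [mul_div_assoc]
  gcongr
  exact freq_le_eigval i

lemma hasSum_heatDeriv {t : ℝ} (ht : 0 < t) (x : L2unit) :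
    HasSum (fun i => (freq i * Real.exp (-(eigval i * t / 2)) * inner ℝ (eigL i) x) • cosL i)
      (heatDeriv t x) := by
  refine Summable.hasSum (Summable.of_norm_bounded
    ((summable_freq_mul_exp ht).mul_right ‖x‖) fun i => ?_)
  have hi := freq_pos i
  rw [norm_smul, norm_cosL, mul_one, norm_mul, Real.norm_of_nonneg (by positivity)]
  gcongr
  refine (norm_inner_le_norm _ _).trans ?_
  rw [norm_eigL, one_mul]

lemma heat_eq_primitive {t : ℝ} (ht : 0 < t) (z : WienerPath) :
    heat t z = primitive (heatDeriv t (toL z)) := by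
  rw [heat_eq_diagOp ht]
  refine (hasSum_diagOp_apply (summable_abs_heat ht) z).unique ?_
  refine ((hasSum_heatDeriv ht (toL z)).mapL primitive).congr_fun fun i => ?_
  rw [map_smul, eigPath_eq, smul_smul]
  congr 1
  ring

/-! ### The heat derivative as a square integrable function of time. -/

/-- Lebesgue measure on the time axis `(0, ∞)`. -/
abbrev timeVol : Measure ℝ := volume.restrict (Set.Ioi 0)

lemma integral_exp_neg_mul_timeVol {a : ℝ} (ha : 0 < a) :
    ∫ t, Real.exp (-(a * t)) ∂timeVol = a⁻¹ := by
  have h := integral_exp_mul_Ioi (a := -a) (by linarith) 0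
  simpa [neg_mul, neg_div] using h

lemma integrable_exp_neg_mul_timeVol {a : ℝ} (ha : 0 < a) :
    Integrable (fun t => Real.exp (-(a * t))) timeVol := by
  have h := integrableOn_exp_mul_Ioi (a := -a) (by linarith) 0
  simp only [neg_mul] at h
  exact h

lemma memLp_heatMode (i : ℕ) :
    MemLp (fun t => (freq i * Real.exp (-(eigval i * t / 2))) • cosL i) 2 timeVol := by
  have h : MemLp (fun t => freq i * Real.exp (-(eigval i * t / 2))) 2 timeVol := by
    refine MemLp.const_mul ?_ _
    rw [memLp_two_iff_integrable_sq (by fun_prop)]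
    refine (integrable_exp_neg_mul_timeVol (eigval_pos i)).congr (ae_of_all _ fun t => ?_)
    simp only
    rw [← Real.exp_nat_mul]
    congr 1
    push_cast
    ring
  exact h.of_le_mul (c := ‖cosL i‖) (h.1.smul_const _) (ae_of_all _ fun t => by
    rw [norm_smul, mul_comm])

/-- The derivative of the heat flow started from `e_i`, as a function of time. -/
def heatMode (i : ℕ) : Lp L2unit 2 timeVol := (memLp_heatMode i).toLp _

lemma coeFn_heatMode (i : ℕ) : (heatMode i : ℝ → L2unit) =ᵐ[timeVol]
    fun t => (freq i * Real.exp (-(eigval i * t / 2))) • cosL i := (memLp_heatMode i).coeFn_toLp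

/-- The factor 2/(λ_i + λ_j) is the time integral of e^{-(λ_i + λ_j)t/2}; it is what makes the
Lyapunov identity below hold. -/
lemma inner_compLp_heatMode (T : L2unit →L[ℝ] L2unit) (i j : ℕ) :
    inner ℝ (T.compLp (heatMode i)) (T.compLp (heatMode j))
      = freq i * freq j * (2 / (eigval i + eigval j)) * inner ℝ (T (cosL i)) (T (cosL j)) := by
  have ha : 0 < (eigval i + eigval j) / 2 := by linarith [eigval_pos i, eigval_pos j]
  have h : ∫ t, freq i * freq j * inner ℝ (T (cosL i)) (T (cosL j))
      * Real.exp (-((eigval i + eigval j) / 2 * t)) ∂timeVol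
      = freq i * freq j * (2 / (eigval i + eigval j)) * inner ℝ (T (cosL i)) (T (cosL j)) := by
    rw [integral_const_mul, integral_exp_neg_mul_timeVol ha, inv_div]
    ring
  rw [← h, L2.inner_def]
  refine integral_congr_ae ?_
  filter_upwards [T.coeFn_compLp (heatMode i), T.coeFn_compLp (heatMode j), coeFn_heatMode i,
    coeFn_heatMode j] with t h1 h2 h3 h4
  rw [h1, h2, h3, h4, map_smul, map_smul, real_inner_smul_left, real_inner_smul_right]
  have : Real.exp (-((eigval i + eigval j) / 2 * t))
      = Real.exp (-(eigval i * t / 2)) * Real.exp (-(eigval j * t / 2)) := by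
    rw [← Real.exp_add]; congr 1; ring
  rw [this]
  ring

lemma compLp_id (f : Lp L2unit 2 timeVol) :
    (ContinuousLinearMap.id ℝ L2unit).compLp f = f := by
  refine Lp.ext ?_
  filter_upwards [(ContinuousLinearMap.id ℝ L2unit).coeFn_compLp f] with t h
  rw [h]; rfl

/-- Orthogonality is inherited from the cosines in space; the normalization is λ_i ∫₀^∞ e^{-λ_i t}
dt = 1. -/
lemma orthonormal_heatMode : Orthonormal ℝ heatMode := by
  rw [orthonormal_iff_ite]
  intro i j
  have h := inner_compLp_heatMode (.id ℝ L2unit) i j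
  rw [compLp_id, compLp_id] at h
  rw [h]
  simp only [ContinuousLinearMap.id_apply]
  rw [inner_cosL]
  split_ifs with hij
  · subst hij
    have := eigval_pos i
    rw [← pow_two, ← eigval_eq_sq]
    field_simp
    norm_num
  · simp

/-- The isometry of `L` into `L²((0,∞); L)` which sends `z` to `t ↦ ∂_θ z(t, ·)`. -/
def heatLift : L2unit →ₗᵢ[ℝ] Lp L2unit 2 timeVol :=
  orthonormal_heatMode.orthogonalFamily.linearIsometry.comp eigBasis.repr.toLinearIsometry

lemma hasSum_heatLift (x : L2unit) :
    HasSum (fun i => inner ℝ (eigL i) x • heatMode i) (heatLift x) := by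
  have h := orthonormal_heatMode.orthogonalFamily.hasSum_linearIsometry (eigBasis.repr x)
  simp only [LinearIsometry.toSpanSingleton_apply, eigBasis.repr_apply_apply, eigBasis_apply] at h
  exact h

lemma heatLift_eigL (i : ℕ) : heatLift (eigL i) = heatMode i := by
  refine (hasSum_heatLift (eigL i)).unique ?_
  refine (hasSum_ite_eq i (heatMode i)).congr_fun fun j => ?_
  rw [inner_eigL]
  split_ifs <;> simp [*]

/-- The series for `heatLift x` converges in L² of time, so a subsequence of partial sums converges
for a.e. t. At each t > 0 the partial sums also converge in L to `heatDeriv t x`, and the limits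
agree. -/
lemma coeFn_heatLift (x : L2unit) :
    (heatLift x : ℝ → L2unit) =ᵐ[timeVol] fun t => heatDeriv t x := by
  have h := (hasSum_heatLift x).tendsto_sum_nat
  obtain ⟨ns, hns, hae⟩ := (tendstoInMeasure_of_tendsto_Lp h).exists_seq_tendsto_ae
  have hmode : ∀ᵐ t ∂timeVol, ∀ n, (∑ i ∈ Finset.range n, inner ℝ (eigL i) x • heatMode i :
      Lp L2unit 2 timeVol) t = ∑ i ∈ Finset.range n,
        (freq i * Real.exp (-(eigval i * t / 2)) * inner ℝ (eigL i) x) • cosL i := by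
    rw [ae_all_iff]
    intro n
    induction n with
    | zero =>
      filter_upwards [Lp.coeFn_zero L2unit 2 timeVol] with t ht
      rw [Finset.sum_range_zero, Finset.sum_range_zero, ht, Pi.zero_apply]
    | succ n ih =>
      rw [Finset.sum_range_succ]
      filter_upwards [ih, Lp.coeFn_add (∑ i ∈ Finset.range n, inner ℝ (eigL i) x • heatMode i)
        (inner ℝ (eigL n) x • heatMode n), Lp.coeFn_smul (inner ℝ (eigL n) x) (heatMode n),
        coeFn_heatMode n] with t h1 h2 h3 h4
      rw [h2, Pi.add_apply, h1, h3, Pi.smul_apply, h4, Finset.sum_range_succ, smul_smul,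
        mul_comm (inner ℝ (eigL n) x)]
  filter_upwards [hae, hmode, ae_restrict_mem measurableSet_Ioi] with t h1 h2 ht
  simp only [h2] at h1
  exact tendsto_nhds_unique h1
    ((hasSum_heatDeriv ht x).tendsto_sum_nat.comp hns.tendsto_atTop)

/-- The operator `z ↦ (t ↦ T ∂_θ z(t, ·))` from `L` to `L²((0,∞); L)`. -/
def quadLift (T : L2unit →L[ℝ] L2unit) : L2unit →L[ℝ] Lp L2unit 2 timeVol :=
  (T.compLpL 2 timeVol).comp heatLift.toContinuousLinearMap

lemma quadLift_apply (T : L2unit →L[ℝ] L2unit) (x : L2unit) :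
    quadLift T x = T.compLp (heatLift x) := rfl

lemma norm_quadLift_le (T : L2unit →L[ℝ] L2unit) (x : L2unit) : ‖quadLift T x‖ ≤ ‖T‖ * ‖x‖ := by
  rw [quadLift_apply]
  exact (T.norm_compLp_le _).trans_eq (by rw [heatLift.norm_map])

lemma coeFn_quadLift (T : L2unit →L[ℝ] L2unit) (x : L2unit) :
    (quadLift T x : ℝ → L2unit) =ᵐ[timeVol] fun t => T (heatDeriv t x) := by
  filter_upwards [T.coeFn_compLp (heatLift x), coeFn_heatLift x] with t h1 h2
  rw [quadLift_apply, h1, h2]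

lemma integrable_norm_sq_heatDeriv (T : L2unit →L[ℝ] L2unit) (x : L2unit) :
    Integrable (fun t => ‖T (heatDeriv t x)‖ ^ 2) timeVol := by
  refine ((Lp.memLp (quadLift T x)).integrable_norm_pow (by norm_num)).congr ?_
  filter_upwards [coeFn_quadLift T x] with t h
  rw [h]

lemma integral_norm_sq_heatDeriv (T : L2unit →L[ℝ] L2unit) (x : L2unit) :
    ∫ t, ‖T (heatDeriv t x)‖ ^ 2 ∂timeVol = ‖quadLift T x‖ ^ 2 := by
  rw [← real_inner_self_eq_norm_sq, L2.inner_def]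
  refine integral_congr_ae ?_
  filter_upwards [coeFn_quadLift T x] with t h
  rw [h, real_inner_self_eq_norm_sq]

lemma inner_quadLift_eigL (T : L2unit →L[ℝ] L2unit) (i j : ℕ) :
    inner ℝ (quadLift T (eigL i)) (quadLift T (eigL j))
      = freq i * freq j * (2 / (eigval i + eigval j)) * inner ℝ (T (cosL i)) (T (cosL j)) := by
  rw [quadLift_apply, quadLift_apply, heatLift_eigL, heatLift_eigL, inner_compLp_heatMode]

lemma inner_quadLift_id (x y : L2unit) :
    inner ℝ (quadLift (.id ℝ L2unit) x) (quadLift (.id ℝ L2unit) y) = inner ℝ x y := by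
  rw [quadLift_apply, quadLift_apply, compLp_id, compLp_id, heatLift.inner_map_map]

/-- The time integral of `∑ e^{-λ_i t} a_i`, for bounded nonnegative `a_i`. -/
lemma integrable_and_integral_tsum_exp_mul {a : ℕ → ℝ} (ha : ∀ i, 0 ≤ a i) {C : ℝ} (haC : ∀ i, a i ≤ C) :
    Integrable (fun t => ∑' i, Real.exp (-(eigval i * t)) * a i) timeVol ∧
    ∫ t, ∑' i, Real.exp (-(eigval i * t)) * a i ∂timeVol = ∑' i, (eigval i)⁻¹ * a i := by
  have hint : ∀ i, Integrable (fun t => Real.exp (-(eigval i * t)) * a i) timeVol := fun i =>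
    (integrable_exp_neg_mul_timeVol (eigval_pos i)).mul_const _
  have e : ∀ i, ∫ t, Real.exp (-(eigval i * t)) * a i ∂timeVol = (eigval i)⁻¹ * a i := fun i => by
    rw [integral_mul_const, integral_exp_neg_mul_timeVol (eigval_pos i)]
  have en : ∀ i, ∫ t, ‖Real.exp (-(eigval i * t)) * a i‖ ∂timeVol = (eigval i)⁻¹ * a i :=
    fun i => by
    rw [← e]
    congr 1
    ext t
    exact Real.norm_of_nonneg (mul_nonneg (Real.exp_pos _).le (ha i))
  have hs : Summable fun i => (eigval i)⁻¹ * a i := by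
    refine Summable.of_nonneg_of_le (fun i => mul_nonneg (inv_pos.2 (eigval_pos i)).le (ha i))
      (fun i => ?_) (summable_inv_eigval.mul_right C)
    have := eigval_pos i
    gcongr
    exact haC i
  have h : ∫ t, ∑' i, Real.exp (-(eigval i * t)) * a i ∂timeVol = ∑' i, (eigval i)⁻¹ * a i := by
    rw [← integral_tsum_of_summable_integral_norm hint (by simpa only [en] using hs)]
    simp only [e]
  refine ⟨?_, h⟩
  -- A non-integrable function has Bochner integral 0, so a nonzero value proves integrability. The
  -- value 0 forces every a_i to vanish.
  by_cases h0 : ∑' i, (eigval i)⁻¹ * a i = 0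
  · have h1 : ∀ i, a i = 0 := fun i => by
      have h2 := (hasSum_zero_iff_of_nonneg fun i =>
        mul_nonneg (inv_pos.2 (eigval_pos i)).le (ha i)).1 (h0 ▸ hs.hasSum)
      exact (mul_eq_zero.1 (congrFun h2 i)).resolve_left (inv_pos.2 (eigval_pos i)).ne'
    simp only [h1, mul_zero, tsum_zero]
    exact integrable_zero _ _ _
  · exact Integrable.of_integral_ne_zero (h ▸ h0)

/-! ### Quadratic functionals and their potentials -/

lemma clm_eq_of_eigL {E : Type*} [NormedAddCommGroup E] [NormedSpace ℝ E]
    {A B : L2unit →L[ℝ] E} (h : ∀ i, A (eigL i) = B (eigL i)) : A = B := by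
  refine ContinuousLinearMap.ext fun x => ?_
  have hx := eigBasis.hasSum_repr x
  refine (hx.mapL A).unique ((hx.mapL B).congr_fun fun i => ?_)
  rw [map_smul, map_smul, eigBasis_apply, h]

lemma IsWienerMeasure.toL_covOp_eigL (hμ : IsWienerMeasure μ) (i : ℕ) :
    toL (hμ.covOp (eigL i)) = (eigval i)⁻¹ • eigL i := by
  rw [hμ.covOp_eigL, ← toLCLM_apply, map_smul]; rfl

/-- A Lyapunov identity in polarized form. With T = V ∘ `primitive`, on e_i, e_j both sides equal 2
(λ_i λ_j)^{-1/2} ⟨T f_i, T f_j⟩, since (1/λ_i + 1/λ_j) · 2/(λ_i + λ_j) = 2/(λ_i λ_j). The polarized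
form allows extension from the basis in one variable at a time. -/
lemma IsWienerMeasure.two_mul_inner_map_covOp (hμ : IsWienerMeasure μ)
    (V : WienerPath →L[ℝ] L2unit) (k l : L2unit) :
    2 * inner ℝ (V (hμ.covOp k)) (V (hμ.covOp l))
      = inner ℝ (quadLift (V.comp primitive) k) (quadLift (V.comp primitive) (toL (hμ.covOp l)))
      + inner ℝ (quadLift (V.comp primitive) l)
        (quadLift (V.comp primitive) (toL (hμ.covOp k))) := by
  set S := quadLift (V.comp primitive) with hS
  have hV : ∀ i, V (eigPath i) = freq i • (V.comp primitive) (cosL i) := fun i => by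
    rw [eigPath_eq, map_smul]; rfl
  set VQ := V.comp hμ.covOp
  set SQ := S.comp (toLCLM.comp hμ.covOp)
  have key : ∀ i j, 2 * inner ℝ (VQ (eigL i)) (VQ (eigL j))
      = inner ℝ (SQ (eigL j)) (S (eigL i)) + inner ℝ (S (eigL j)) (SQ (eigL i)) := fun i j => by
    simp only [VQ, SQ, ContinuousLinearMap.comp_apply, toLCLM_apply, hμ.toL_covOp_eigL]
    simp only [hμ.covOp_eigL, map_smul, hV, real_inner_smul_left, real_inner_smul_right]
    rw [real_inner_comm (S (eigL i)), inner_quadLift_eigL]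
    have hi := eigval_pos i
    have hj := eigval_pos j
    have : eigval i + eigval j ≠ 0 := by positivity
    field_simp
  have h1 : ∀ j, (2 : ℝ) • (innerSL ℝ (VQ (eigL j))).comp VQ
      = (innerSL ℝ (SQ (eigL j))).comp S + (innerSL ℝ (S (eigL j))).comp SQ := fun j => by
    refine clm_eq_of_eigL fun i => ?_
    have := key i j
    simp only [smul_apply, add_apply, ContinuousLinearMap.comp_apply, innerSL_apply_apply,
      smul_eq_mul] at this ⊢
    rw [real_inner_comm, this]
  have h2 : (2 : ℝ) • (innerSL ℝ (VQ k)).comp VQ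
      = (innerSL ℝ (S k)).comp SQ + (innerSL ℝ (SQ k)).comp S := by
    refine clm_eq_of_eigL fun j => ?_
    have := DFunLike.congr_fun (h1 j) k
    simp only [smul_apply, add_apply, ContinuousLinearMap.comp_apply, innerSL_apply_apply,
      smul_eq_mul] at this ⊢
    rw [real_inner_comm, this, real_inner_comm, real_inner_comm (S (eigL j))]
  have h3 := DFunLike.congr_fun h2 l
  simp only [smul_apply, add_apply, ContinuousLinearMap.comp_apply, innerSL_apply_apply,
    smul_eq_mul, VQ, SQ, toLCLM_apply] at h3
  rw [h3, real_inner_comm (S l)]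

lemma IsWienerMeasure.norm_sq_map_covOp (hμ : IsWienerMeasure μ)
    (V : WienerPath →L[ℝ] L2unit) (k : L2unit) :
    ‖V (hμ.covOp k)‖ ^ 2 = inner ℝ (quadLift (V.comp primitive) k)
      (quadLift (V.comp primitive) (toL (hμ.covOp k))) := by
  have h := hμ.two_mul_inner_map_covOp V k k
  rw [real_inner_self_eq_norm_sq] at h
  linarith

/-- The functional `ω ↦ ‖V ω‖² - 𝔼 ‖V B‖²`. -/
def centredSquare (μ : Measure WienerPath) (V : WienerPath →L[ℝ] L2unit) (ω : WienerPath) : ℝ :=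
  ‖V ω‖ ^ 2 - ∫ ω', ‖V ω'‖ ^ 2 ∂μ

lemma IsWienerMeasure.memLp_centredSquare (hμ : IsWienerMeasure μ)
    (V : WienerPath →L[ℝ] L2unit) : MemLp (centredSquare μ V) 2 μ := by
  have := hμ.isProbabilityMeasure
  refine MemLp.sub ?_ (memLp_const _)
  refine hμ.memLp_of_le_norm_pow (V.continuous.norm.pow 2).aestronglyMeasurable 2 (‖V‖ ^ 2)
    (fun ω => ?_) 2 (by simp)
  rw [Pi.pow_apply, norm_pow, norm_norm, ← mul_pow]
  gcongr
  exact V.le_opNorm ω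

lemma IsWienerMeasure.integral_centredSquare (hμ : IsWienerMeasure μ)
    (V : WienerPath →L[ℝ] L2unit) : ∫ ω, centredSquare μ V ω ∂μ = 0 := by
  have := hμ.isProbabilityMeasure
  have h : Integrable (fun ω => ‖V ω‖ ^ 2) μ := by
    simpa only [real_inner_self_eq_norm_sq] using hμ.integrable_inner V V
  simp only [centredSquare]
  rw [integral_sub h (integrable_const _), integral_const]
  simp

lemma inv_eigval_mul_norm_sq (V : WienerPath →L[ℝ] L2unit) (i : ℕ) :
    (eigval i)⁻¹ * ‖V (eigPath i)‖ ^ 2 = ‖(V.comp primitive) (cosL i)‖ ^ 2 := by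
  have h := eigval_pos i
  rw [eigPath_eq, map_smul, norm_smul, mul_pow, Real.norm_eq_abs, sq_abs, ← eigval_eq_sq,
    ContinuousLinearMap.comp_apply]
  field_simp

lemma norm_sq_map_cosL_le (T : L2unit →L[ℝ] L2unit) (i : ℕ) : ‖T (cosL i)‖ ^ 2 ≤ ‖T‖ ^ 2 := by
  gcongr
  exact (T.le_opNorm _).trans (by rw [norm_cosL, mul_one])

lemma IsWienerMeasure.ouSemigroup_centredSquare_sub (hμ : IsWienerMeasure μ)
    (V : WienerPath →L[ℝ] L2unit) {t : ℝ} (ht : 0 < t) (z : WienerPath) :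
    ouSemigroup μ t (centredSquare μ V) z - ∫ ω, centredSquare μ V ω ∂μ
      = ‖(V.comp primitive) (heatDeriv t (toL z))‖ ^ 2
        - ∑' i, Real.exp (-(eigval i * t)) * ‖(V.comp primitive) (cosL i)‖ ^ 2 := by
  rw [hμ.integral_centredSquare, sub_zero]
  have h := (hμ.integrable_and_ouSemigroup_norm_sq V (∫ ω', ‖V ω'‖ ^ 2 ∂μ) ht z).2
  rw [heat_eq_primitive ht] at h
  simp only [inv_eigval_mul_norm_sq] at h
  refine h.trans ?_
  rw [ContinuousLinearMap.comp_apply]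
  ring

lemma IsWienerMeasure.integrable_centredSquare_ouKernel (hμ : IsWienerMeasure μ)
    (V : WienerPath →L[ℝ] L2unit) {t : ℝ} (ht : 0 < t) (z : WienerPath) :
    Integrable (centredSquare μ V) (ouKernel μ t z) :=
  (hμ.integrable_and_ouSemigroup_norm_sq V _ ht z).1

/-- `∑ ‖T f_i‖² / λ_i`, where `f_i` is the normalized derivative of `e_i`. -/
def potentialConst (T : L2unit →L[ℝ] L2unit) : ℝ := ∑' i, (eigval i)⁻¹ * ‖T (cosL i)‖ ^ 2

lemma IsWienerMeasure.integrableOn_ouSemigroup (hμ : IsWienerMeasure μ)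
    (V : WienerPath →L[ℝ] L2unit) (z : WienerPath) :
    IntegrableOn (fun t => ouSemigroup μ t (centredSquare μ V) z
      - ∫ ω, centredSquare μ V ω ∂μ) (Set.Ioi 0) := by
  have h := (integrable_norm_sq_heatDeriv (V.comp primitive) (toL z)).sub
    (integrable_and_integral_tsum_exp_mul (fun i => sq_nonneg ‖(V.comp primitive) (cosL i)‖)
      (norm_sq_map_cosL_le _)).1
  refine h.congr ?_
  filter_upwards [ae_restrict_mem measurableSet_Ioi] with t ht
  exact (hμ.ouSemigroup_centredSquare_sub V ht z).symm

/-- Although V acts only on C, its potential is a bounded quadratic form on L up to a constant: heat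
smoothing followed by time integration absorbs one derivative. -/
lemma IsWienerMeasure.potential_centredSquare (hμ : IsWienerMeasure μ)
    (V : WienerPath →L[ℝ] L2unit) (z : WienerPath) :
    potential μ (centredSquare μ V) z
      = ‖quadLift (V.comp primitive) (toL z)‖ ^ 2 - potentialConst (V.comp primitive) := by
  have h := integrable_and_integral_tsum_exp_mul (fun i => sq_nonneg ‖(V.comp primitive) (cosL i)‖)
      (norm_sq_map_cosL_le _)
  rw [potentialConst, ← h.2, ← integral_norm_sq_heatDeriv,
    ← integral_sub (integrable_norm_sq_heatDeriv _ _) h.1, potential]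
  refine setIntegral_congr_fun measurableSet_Ioi fun t ht => ?_
  exact hμ.ouSemigroup_centredSquare_sub V ht z

open ContinuousLinearMap in
/-- Integration by parts against a centred quadratic functional. -/
lemma IsWienerMeasure.integral_mul_centredSquare (hμ : IsWienerMeasure μ)
    (V : WienerPath →L[ℝ] L2unit) {p : Lp ℝ 2 μ × Lp L2unit 2 μ}
    (hp : p ∈ (expGraph μ).topologicalClosure) :
    ∫ ω, p.1 ω * centredSquare μ V ω ∂μ = ∫ ω, inner ℝ (p.2 ω)
      (adjoint (quadLift (V.comp primitive)) (quadLift (V.comp primitive) (toL ω))) ∂μ := by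
  have := hμ.isProbabilityMeasure
  set S := quadLift (V.comp primitive) with hS
  set A : WienerPath →L[ℝ] L2unit := (adjoint S).comp (S.comp toLCLM) with hA
  have hx : MemLp (fun ω => A ω) 2 μ :=
    hμ.memLp_of_le_norm_pow A.continuous.aestronglyMeasurable 1 ‖A‖
      (fun ω => by rw [pow_one]; exact A.le_opNorm ω) 2 (by simp)
  refine (hμ.integral_inner_eq_of_mem hx (hμ.memLp_centredSquare V) (fun k => ?_) hp).symm
  have h1 := hμ.integral_dual_mul_exp (innerDual (toL k)) ((innerSL ℝ (toL k)).comp A)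
  simp only [innerDual_apply, ContinuousLinearMap.comp_apply, innerSL_apply_apply] at h1
  have h2 := hμ.dual_covOp ((innerSL ℝ (toL k)).comp A) (toL k)
  simp only [ContinuousLinearMap.comp_apply, innerSL_apply_apply] at h2
  rw [h1, ← h2]
  -- Under the tilt by exp⟨k,·⟩ the left side carries the mean shift of ⟨k, A ω⟩ and the right side
  -- that of ‖V ω‖²; the Lyapunov identity on the diagonal equates them.
  have h3 : inner ℝ (toL k) (A (hμ.covOp (toL k))) = ‖V (hμ.covOp (toL k))‖ ^ 2 := by
    rw [hμ.norm_sq_map_covOp, hA, ContinuousLinearMap.comp_apply, adjoint_inner_right]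
    rfl
  have h4 := hμ.integral_norm_sq_mul_exp eigBasis V (toL k)
  have i1 := hμ.integrable_norm_sq_mul_exp V (innerDual (toL k))
  have i2 := (hμ.integrable_exp_dual (innerDual (toL k))).const_mul (∫ ω', ‖V ω'‖ ^ 2 ∂μ)
  simp only [innerDual_apply] at i1 i2
  simp only [centredSquare, sub_mul]
  rw [integral_sub i1 i2, h4, integral_const_mul, h3]
  ring

lemma IsWienerMeasure.hasClosedGrad_const (hμ : IsWienerMeasure μ) (c : ℝ) :
    HasClosedGrad μ (fun _ => c) (fun _ => 0) := by
  simpa using hμ.hasClosedGrad_one.const_smul c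

open ContinuousLinearMap in
lemma IsWienerMeasure.hasClosedGrad_potential (hμ : IsWienerMeasure μ)
    (V : WienerPath →L[ℝ] L2unit) :
    HasClosedGrad μ (potential μ (centredSquare μ V)) (fun ω => (2 : ℝ) •
      adjoint (quadLift (V.comp primitive)) (quadLift (V.comp primitive) (toL ω))) := by
  have h := (hμ.hasClosedGrad_norm_sq (quadLift (V.comp primitive))).add
    (hμ.hasClosedGrad_const (-potentialConst (V.comp primitive)))
  convert h using 1
  · ext z
    rw [hμ.potential_centredSquare, sub_eq_add_neg]
  · ext1 z
    rw [add_zero]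

/-! ### Mollified derivatives -/

lemma continuous_extend (ω : WienerPath) : Continuous (extend ω) :=
  (ω : C(I, ℝ)).continuous.comp continuous_projIcc

lemma abs_extend_le (ω : WienerPath) (s : ℝ) : |extend ω s| ≤ ‖ω‖ := abs_path_le_norm ω _

lemma extend_add (ω η : WienerPath) (s : ℝ) : extend (ω + η) s = extend ω s + extend η s := rfl

lemma extend_smul (c : ℝ) (ω : WienerPath) (s : ℝ) : extend (c • ω) s = c * extend ω s := rfl

/-- The derivative of `g * ω`. -/
def convDeriv (g : ℝ → ℝ) (ω : WienerPath) : ℝ → ℝ :=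
  convolution (extend ω) (deriv g) (ContinuousLinearMap.lsmul ℝ ℝ) volume

lemma convDeriv_apply (g : ℝ → ℝ) (ω : WienerPath) (θ : ℝ) :
    convDeriv g ω θ = ∫ s, extend ω s * deriv g (θ - s) := rfl

section Kernel

variable {g : ℝ → ℝ}

lemma continuous_convDeriv (hg : ContDiff ℝ 1 g) (hgc : HasCompactSupport g) (ω : WienerPath) :
    Continuous (convDeriv g ω) :=
  hgc.deriv.continuous_convolution_right _ (continuous_extend ω).locallyIntegrable
    (hg.continuous_deriv le_rfl)

lemma integrable_deriv_kernel (hg : ContDiff ℝ 1 g) (hgc : HasCompactSupport g) :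
    Integrable (deriv g) :=
  (hg.continuous_deriv le_rfl).integrable_of_hasCompactSupport hgc.deriv

lemma integrable_extend_mul_deriv (hg : ContDiff ℝ 1 g) (hgc : HasCompactSupport g)
    (ω : WienerPath) (θ : ℝ) : Integrable fun s => extend ω s * deriv g (θ - s) :=
  ((integrable_deriv_kernel hg hgc).comp_sub_left θ).bdd_mul
    (continuous_extend ω).aestronglyMeasurable (ae_of_all _ fun s => abs_extend_le ω s)

lemma abs_convDeriv_le (hg : ContDiff ℝ 1 g) (hgc : HasCompactSupport g) (ω : WienerPath)
    (θ : ℝ) : |convDeriv g ω θ| ≤ (∫ s, |deriv g s|) * ‖ω‖ := by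
  rw [convDeriv_apply, ← integral_sub_left_eq_self (fun s => |deriv g s|) volume θ,
    ← integral_mul_const, ← Real.norm_eq_abs]
  refine norm_integral_le_of_norm_le
    (((integrable_deriv_kernel hg hgc).abs.comp_sub_left θ).mul_const _) (ae_of_all _ fun s => ?_)
  rw [norm_mul, Real.norm_eq_abs, Real.norm_eq_abs, mul_comm]
  gcongr
  exact abs_extend_le ω s

/-- `ω ↦ (g * ω)'` as an operator into the continuous functions on `[0,1]`. -/
def convDerivC (hg : ContDiff ℝ 1 g) (hgc : HasCompactSupport g) : WienerPath →L[ℝ] C(I, ℝ) :=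
  LinearMap.mkContinuous
    { toFun := fun ω => ⟨fun θ => convDeriv g ω θ,
        (continuous_convDeriv hg hgc ω).comp continuous_subtype_val⟩
      map_add' := fun ω η => by
        ext θ
        change convDeriv g (ω + η) θ = convDeriv g ω θ + convDeriv g η θ
        simp only [convDeriv_apply, extend_add, add_mul]
        exact integral_add (integrable_extend_mul_deriv hg hgc ω θ)
          (integrable_extend_mul_deriv hg hgc η θ)
      map_smul' := fun c ω => by
        ext θ
        change convDeriv g (c • ω) θ = c * convDeriv g ω θ
        simp only [convDeriv_apply, extend_smul, mul_assoc]
        exact integral_const_mul _ _ }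
    (∫ s, |deriv g s|) fun ω => by
      refine (ContinuousMap.norm_le _ (mul_nonneg (integral_nonneg fun s => abs_nonneg _)
        (norm_nonneg ω))).2 fun θ => ?_
      exact abs_convDeriv_le hg hgc ω θ

lemma convDerivC_apply (hg : ContDiff ℝ 1 g) (hgc : HasCompactSupport g) (ω : WienerPath)
    (θ : I) : convDerivC hg hgc ω θ = convDeriv g ω θ := rfl

/-- `ω ↦ (g * ω)'` as an operator into `L`. -/
def convDerivL (hg : ContDiff ℝ 1 g) (hgc : HasCompactSupport g) : WienerPath →L[ℝ] L2unit :=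
  (ContinuousMap.toLp 2 (volume : Measure I) ℝ).comp (convDerivC hg hgc)

lemma norm_sq_convDerivL (hg : ContDiff ℝ 1 g) (hgc : HasCompactSupport g) (ω : WienerPath) :
    ‖convDerivL hg hgc ω‖ ^ 2 = ∫ θ : I, convDeriv g ω θ ^ 2 := by
  rw [← real_inner_self_eq_norm_sq, convDerivL, ContinuousLinearMap.comp_apply, inner_toLp]
  simp only [convDerivC_apply, pow_two]

/-- Fubini's theorem for the renormalized square of a mollified derivative. -/
lemma IsWienerMeasure.integral_convDeriv_sq_sub (hμ : IsWienerMeasure μ) (hg : ContDiff ℝ 1 g)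
    (hgc : HasCompactSupport g) (ω : WienerPath) :
    ∫ θ : I, (convDeriv g ω θ ^ 2 - ∫ ω', convDeriv g ω' θ ^ 2 ∂μ)
      = centredSquare μ (convDerivL hg hgc) ω := by
  have := hμ.isProbabilityMeasure
  have := hμ.sFinite
  have hc : Continuous fun p : I × WienerPath => convDerivC hg hgc p.2 p.1 ^ 2 := by fun_prop
  have hint : Integrable (fun p : I × WienerPath => convDeriv g p.2 p.1 ^ 2)
      ((volume : Measure I).prod μ) := by
    have hb : Integrable (fun p : I × WienerPath => ((∫ s, |deriv g s|) * ‖p.2‖) ^ 2)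
        ((volume : Measure I).prod μ) := by
      have h1 : Integrable (fun ω : WienerPath => ((∫ s, |deriv g s|) * ‖ω‖) ^ 2) μ := by
        simp only [mul_pow]
        exact ((hμ.memLp_norm_pow 2 1 (by simp)).integrable le_rfl).const_mul _
      simpa using (integrable_const (1 : ℝ)).mul_prod h1
    refine hb.mono' hc.aestronglyMeasurable (ae_of_all _ fun p => ?_)
    rw [norm_pow, Real.norm_eq_abs]
    gcongr
    exact abs_convDeriv_le hg hgc p.2 p.1
  have h1 : Integrable (fun θ : I => convDeriv g ω θ ^ 2) :=
    (((continuous_convDeriv hg hgc ω).comp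
      continuous_subtype_val).pow 2).integrable_of_hasCompactSupport
      (HasCompactSupport.of_compactSpace _)
  rw [integral_sub h1 hint.integral_prod_left, integral_integral_swap hint, centredSquare]
  simp only [norm_sq_convDerivL]

/-- A primitive is a superposition of unit steps. Clamping s to [0,1] changes the condition r ≤ s
only for r = 0, a null set. -/
lemma extend_primitive (h : L2unit) (s : ℝ) :
    extend (primitive h) s = ∫ r : I, h r * (Set.Ici (r : ℝ)).indicator 1 s := by
  rw [_root_.extend, primitive_apply, primitiveFun, ← integral_indicator (measurableSet_le_coe _)]
  refine integral_congr_ae ?_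
  have hne : ∀ᵐ r : I, r ≠ 0 := by simp [ae_iff]
  filter_upwards [hne] with r hr
  have hr0 : 0 < (r : ℝ) := unitInterval.pos_iff_ne_zero.2 hr
  have : (r : ℝ) ≤ Set.projIcc 0 1 zero_le_one s ↔ (r : ℝ) ≤ s := by
    rw [Set.coe_projIcc]
    refine ⟨fun h => ?_, fun h => le_max_of_le_right (le_min r.2.2 h)⟩
    rcases le_max_iff.1 h with h | h
    · exact absurd h (not_le.2 hr0)
    · exact h.trans (min_le_right _ _)
  simp only [Set.indicator, Set.mem_ofPred_eq, this, Set.mem_Ici]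
  split_ifs <;> simp

lemma integral_Ici_deriv_sub (hg : ContDiff ℝ 1 g) (hgc : HasCompactSupport g) (θ r : ℝ) :
    ∫ s in Set.Ici r, deriv g (θ - s) = g (θ - r) := by
  have h := HasCompactSupport.integral_Ioi_deriv_eq (f := fun s => g (θ - s)) (by fun_prop)
    (hgc.comp_homeomorph (Homeomorph.subLeft θ)) r
  have e : ∀ s, deriv (fun s => g (θ - s)) s = - deriv g (θ - s) := fun s => deriv_comp_const_sub ..
  simp only [e, integral_neg, neg_inj] at h
  rw [integral_Ici_eq_integral_Ioi, h]

/-- The derivative of the mollification of a primitive is the mollification of the function. -/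
lemma convDeriv_primitive (hg : ContDiff ℝ 1 g) (hgc : HasCompactSupport g) (h : L2unit) (θ : ℝ) :
    convDeriv g (primitive h) θ = ∫ r : I, g (θ - r) * h r := by
  have hint : Integrable (fun p : ℝ × I => deriv g (θ - p.1) * h p.2
      * (Set.Ici (p.2 : ℝ)).indicator 1 p.1) (volume.prod volume) := by
    have h1 := ((integrable_deriv_kernel hg hgc).comp_sub_left θ).mul_prod (integrable_L2unit h)
    refine h1.mul_bdd (c := 1) ?_ (ae_of_all _ fun p => ?_)
    · have hm : MeasurableSet {p : ℝ × I | (p.2 : ℝ) ≤ p.1} :=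
        measurableSet_le (by fun_prop) (by fun_prop)
      have : (fun p : ℝ × I => (Set.Ici (p.2 : ℝ)).indicator (1 : ℝ → ℝ) p.1)
          = {p : ℝ × I | (p.2 : ℝ) ≤ p.1}.indicator 1 := by
        ext p; simp [Set.indicator]
      rw [this]
      exact (measurable_one.indicator hm).aestronglyMeasurable
    · refine (norm_indicator_le_norm_self _ _).trans ?_
      simp
  rw [convDeriv_apply]
  -- After Fubini each unit step at r is differentiated separately, and its mollified derivative is
  -- g(θ − r).
  have e : ∀ s, extend (primitive h) s * deriv g (θ - s)
      = ∫ r : I, deriv g (θ - s) * h r * (Set.Ici (r : ℝ)).indicator 1 s := fun s => by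
    rw [extend_primitive, mul_comm, ← integral_const_mul]
    simp only [mul_assoc]
  simp only [e]
  rw [integral_integral_swap hint]
  congr 1
  ext r
  rw [← integral_Ici_deriv_sub hg hgc, ← integral_mul_const, ← integral_indicator measurableSet_Ici]
  congr 1
  ext s
  by_cases hs : s ∈ Set.Ici (r : ℝ) <;> simp [Set.indicator, hs]

/-- Mollification by a probability density is a contraction of `L`. -/
lemma norm_convDerivL_primitive_le (hg : ContDiff ℝ 1 g) (hgc : HasCompactSupport g)
    (h0 : ∀ x, 0 ≤ g x) (h1 : ∫ x, g x = 1) (h : L2unit) :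
    ‖convDerivL hg hgc (primitive h)‖ ≤ ‖h‖ := by
  have hgi : Integrable g := hg.continuous.integrable_of_hasCompactSupport hgc
  obtain ⟨C, hC⟩ := hgc.exists_bound_of_continuous hg.continuous
  have hL1 := integrable_L2unit h
  have hL2 : Integrable (fun r : I => h r ^ 2) := (Lp.memLp h).integrable_sq
  have hker : ∀ F : ℝ → ℝ, Integrable F → (∀ x, 0 ≤ F x) → ∫ r : I, F r ≤ ∫ x, F x := by
    intro F hF hF0
    rw [integral_unitInterval, intervalIntegral.integral_of_le zero_le_one]
    exact setIntegral_le_integral hF (ae_of_all _ hF0)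
  have hprod : Integrable (fun p : I × I => g (p.1 - p.2) * h p.2 ^ 2) (volume.prod volume) := by
    have := (integrable_const (1 : ℝ) (μ := (volume : Measure I))).mul_prod hL2
    simp only [one_mul] at this
    exact this.bdd_mul (c := C)
      (hg.continuous.comp
        (by fun_prop : Continuous fun p : I × I => (p.1 : ℝ) - p.2)).aestronglyMeasurable
      (ae_of_all _ fun p => hC _)
  have hsec : ∀ θ : I, Integrable (fun r : I => g (θ - r) * h r ^ 2) := fun θ =>
    hL2.bdd_mul (c := C) (by fun_prop) (ae_of_all _ fun p => hC _)
  -- Jensen for a kernel whose mass on [0,1] is at most 1: with w the value on the left before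
  -- squaring, integrate g(θ − r)(h(r) − w)² ≥ 0 over r.
  have hpt : ∀ θ : I, convDeriv g (primitive h) θ ^ 2 ≤ ∫ r : I, g (θ - r) * h r ^ 2 := by
    intro θ
    set w := convDeriv g (primitive h) θ with hw
    have hgk : Integrable (fun r : I => g (θ - r)) :=
      (by fun_prop : Continuous fun r : I => g (θ - r)).integrable_of_hasCompactSupport
        (HasCompactSupport.of_compactSpace _)
    have hgh : Integrable (fun r : I => g (θ - r) * h r) :=
      hL1.bdd_mul (c := C) (by fun_prop) (ae_of_all _ fun p => hC _)
    have hk : ∫ r : I, g (θ - r) ≤ 1 := by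
      refine (hker (fun r => g (θ - r)) (hgi.comp_sub_left _) fun r => h0 _).trans_eq ?_
      rw [integral_sub_left_eq_self g volume, h1]
    have hw2 : ∫ r : I, (g (θ - r) * h r) * (2 * w) = 2 * w ^ 2 := by
      rw [integral_mul_const, ← convDeriv_primitive hg hgc]; ring
    have hle : ∫ r : I, (g (θ - r) * h r) * (2 * w)
        ≤ ∫ r : I, (g (θ - r) * h r ^ 2 + g (θ - r) * w ^ 2) := by
      refine integral_mono (hgh.mul_const _) ((hsec θ).add (hgk.mul_const _)) fun r => ?_
      simp only
      nlinarith [mul_nonneg (h0 (θ - r)) (sq_nonneg (h r - w))]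
    rw [hw2, integral_add (hsec θ) (hgk.mul_const _), integral_mul_const] at hle
    nlinarith [mul_le_mul_of_nonneg_right hk (sq_nonneg w)]
  refine le_of_sq_le_sq ?_ (norm_nonneg h)
  rw [norm_sq_convDerivL]
  calc ∫ θ : I, convDeriv g (primitive h) θ ^ 2
      ≤ ∫ θ : I, ∫ r : I, g (θ - r) * h r ^ 2 := by
        refine integral_mono ?_ hprod.integral_prod_left hpt
        exact (((continuous_convDeriv hg hgc _).comp
          continuous_subtype_val).pow 2).integrable_of_hasCompactSupport
          (HasCompactSupport.of_compactSpace _)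
    _ = ∫ r : I, ∫ θ : I, g (θ - r) * h r ^ 2 := integral_integral_swap hprod
    _ ≤ ∫ r : I, h r ^ 2 := by
        refine integral_mono hprod.integral_prod_right hL2 fun r => ?_
        simp only
        rw [integral_mul_const]
        refine mul_le_of_le_one_left (sq_nonneg _) ?_
        refine (hker (fun x => g (x - r)) (hgi.comp_sub_right _) fun r => h0 _).trans_eq ?_
        rw [integral_sub_right_eq_self g, h1]
    _ = ‖h‖ ^ 2 := by
        rw [← real_inner_self_eq_norm_sq, L2.inner_def]
        congr 1
        ext r
        rw [real_inner_self_eq_norm_sq, Real.norm_eq_abs, sq_abs]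

end Kernel

/-! ### The rescaled mollifier -/

/-- `ρ_ε = ε⁻¹ ρ(·/ε)`. -/
def kern (ρ : ℝ → ℝ) (ε u : ℝ) : ℝ := 1 / ε * ρ (u / ε)

variable {ρ : ℝ → ℝ}

lemma IsMollifier.contDiff_kern (hρ : IsMollifier ρ) (ε : ℝ) : ContDiff ℝ 1 (kern ρ ε) := by
  have h : ContDiff ℝ 1 ρ := hρ.smooth.of_le (by exact_mod_cast le_top)
  exact contDiff_const.mul (h.comp (contDiff_id.div_const ε))

lemma IsMollifier.kern_eq_zero (hρ : IsMollifier ρ) {ε u : ℝ} (hu : |ε| ≤ |u|) :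
    kern ρ ε u = 0 := by
  -- At ε = 0 the convention 1/0 = 0 makes the kernel vanish, so the operators below exist for every
  -- real ε.
  rcases eq_or_ne ε 0 with rfl | hε
  · simp [kern]
  suffices h : u / ε ∉ tsupport ρ by
    rw [kern, image_eq_zero_of_notMem_tsupport h, mul_zero]
  intro h
  have h2 := hρ.support h
  rw [Set.mem_Ioo, ← abs_lt, abs_div, div_lt_one (abs_pos.2 hε)] at h2
  linarith

lemma IsMollifier.hasCompactSupport_kern (hρ : IsMollifier ρ) (ε : ℝ) :
    HasCompactSupport (kern ρ ε) := by
  refine HasCompactSupport.intro (isCompact_Icc (a := -|ε|) (b := |ε|)) fun u hu => ?_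
  refine hρ.kern_eq_zero (le_of_not_ge fun h => hu ?_)
  exact abs_le.1 h

lemma IsMollifier.kern_nonneg (hρ : IsMollifier ρ) {ε : ℝ} (hε : 0 < ε) (u : ℝ) :
    0 ≤ kern ρ ε u := mul_nonneg (by positivity) (hρ.nonneg _)

lemma IsMollifier.integral_kern (hρ : IsMollifier ρ) {ε : ℝ} (hε : 0 < ε) :
    ∫ u, kern ρ ε u = 1 := by
  simp only [kern]
  rw [integral_const_mul, Measure.integral_comp_div, hρ.integral, abs_of_pos hε, smul_eq_mul]
  field_simp

lemma IsMollifier.deriv_mollify (hρ : IsMollifier ρ) (ε : ℝ) (ω : WienerPath) (θ : ℝ) :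
    deriv (mollify ρ ε ω) θ = convDeriv (kern ρ ε) ω θ := by
  -- Evenness of ρ turns the correlation with ρ_ε into a convolution.
  have e : mollify ρ ε ω = convolution (extend ω) (kern ρ ε)
      (ContinuousLinearMap.lsmul ℝ ℝ) volume := by
    ext θ
    rw [mollify, convolution_lsmul]
    congr 1
    ext s
    rw [hρ.symm, smul_eq_mul, mul_comm, kern, ← neg_div, neg_sub]
  rw [e]
  exact ((hρ.hasCompactSupport_kern ε).hasDerivAt_convolution_right _
    (continuous_extend ω).locallyIntegrable (hρ.contDiff_kern ε) θ).deriv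

/-- `ω ↦ ω'_ε` as an operator from `C` to `L`. -/
def IsMollifier.mollOp (hρ : IsMollifier ρ) (ε : ℝ) : WienerPath →L[ℝ] L2unit :=
  convDerivL (hρ.contDiff_kern ε) (hρ.hasCompactSupport_kern ε)

lemma IsMollifier.renSquare_eq (hρ : IsMollifier ρ) (hμ : IsWienerMeasure μ) (ε : ℝ) :
    renSquare μ ρ ε = centredSquare μ (hρ.mollOp ε) := by
  ext ω
  rw [renSquare, IsMollifier.mollOp, ← hμ.integral_convDeriv_sq_sub]
  simp only [hρ.deriv_mollify]
  exact (integral_unitInterval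
    (fun θ => convDeriv (kern ρ ε) ω θ ^ 2 - ∫ ω', convDeriv (kern ρ ε) ω' θ ^ 2 ∂μ)).symm

/-- The bound uniform in ε on which the limit rests; on C itself the available bound ∫ |ρ_ε'| is of
order 1/ε. -/
lemma IsMollifier.norm_mollOp_primitive_le (hρ : IsMollifier ρ) {ε : ℝ} (hε : 0 < ε) :
    ‖(hρ.mollOp ε).comp primitive‖ ≤ 1 :=
  ContinuousLinearMap.opNorm_le_bound _ zero_le_one fun h => by
    rw [one_mul]
    exact norm_convDerivL_primitive_le _ _ (hρ.kern_nonneg hε) (hρ.integral_kern hε) h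

lemma abs_cosFun_le (i : ℕ) (x : ℝ) : |cosFun i x| ≤ 2 := by
  rw [cosFun, abs_mul, abs_of_nonneg (Real.sqrt_nonneg 2)]
  have h1 : Real.sqrt 2 ≤ 2 := by rw [Real.sqrt_le_left (by norm_num)]; norm_num
  calc Real.sqrt 2 * _ ≤ 2 * 1 := by
        gcongr; exact Real.abs_cos_le_one _
    _ = 2 := by norm_num

lemma continuous_cosFun (i : ℕ) : Continuous (cosFun i) := by unfold cosFun; fun_prop

lemma IsMollifier.convDeriv_primitive_cosL (hρ : IsMollifier ρ) (ε : ℝ) (i : ℕ) (θ : ℝ) :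
    convDeriv (kern ρ ε) (primitive (cosL i)) θ
      = convolution (kern ρ ε) ((Set.Ioc 0 1).indicator (cosFun i))
        (ContinuousLinearMap.lsmul ℝ ℝ) volume θ := by
  rw [convDeriv_primitive (hρ.contDiff_kern ε) (hρ.hasCompactSupport_kern ε),
    convolution_lsmul_swap]
  have h1 : ∫ r : I, kern ρ ε (θ - r) * cosL i r = ∫ r : I, kern ρ ε (θ - r) * cosFun i r := by
    refine integral_congr_ae ?_
    filter_upwards [ContinuousMap.coeFn_toLp (p := 2) (𝕜 := ℝ) (volume : Measure I) (cosMap i)]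
      with r h
    rw [cosL, h]; rfl
  rw [h1, integral_unitInterval (fun r => kern ρ ε (θ - r) * cosFun i r),
    intervalIntegral.integral_of_le zero_le_one, ← integral_indicator measurableSet_Ioc]
  congr 1
  ext r
  simp only [Set.indicator, smul_eq_mul]
  split_ifs <;> simp

lemma IsMollifier.abs_convDeriv_primitive_cosL_le (hρ : IsMollifier ρ) {ε : ℝ} (hε : 0 < ε)
    (i : ℕ) (θ : ℝ) : |convDeriv (kern ρ ε) (primitive (cosL i)) θ| ≤ 2 := by
  have hint : Integrable (kern ρ ε) :=
    (hρ.contDiff_kern ε).continuous.integrable_of_hasCompactSupport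
    (hρ.hasCompactSupport_kern ε)
  rw [hρ.convDeriv_primitive_cosL, convolution_lsmul, ← Real.norm_eq_abs]
  have h : ∫ t, kern ρ ε t * 2 = 2 := by
    rw [integral_mul_const, hρ.integral_kern hε, one_mul]
  rw [← h]
  refine norm_integral_le_of_norm_le (hint.mul_const 2) (ae_of_all _ fun t => ?_)
  rw [norm_smul, Real.norm_of_nonneg (hρ.kern_nonneg hε t)]
  gcongr
  · exact hρ.kern_nonneg hε t
  · exact (norm_indicator_le_norm_self _ _).trans (abs_cosFun_le i _)

/-- Approximation of the identity at a point of continuity. Endpoints are excluded because the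
extension of f_i by zero jumps at 0. -/
lemma IsMollifier.tendsto_convDeriv_primitive_cosL (hρ : IsMollifier ρ) (i : ℕ) {θ : ℝ}
    (hθ : θ ∈ Set.Ioo (0 : ℝ) 1) :
    Tendsto (fun ε => convDeriv (kern ρ ε) (primitive (cosL i)) θ) (𝓝[>] 0)
      (𝓝 (cosFun i θ)) := by
  simp only [hρ.convDeriv_primitive_cosL]
  refine convolution_tendsto_right (l := 𝓝[>] (0 : ℝ)) (φ := fun ε => kern ρ ε)
    (g := fun _ => (Set.Ioc 0 1).indicator (cosFun i)) (k := fun _ => θ) ?_ ?_ ?_ ?_ ?_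
    tendsto_const_nhds
  · filter_upwards [self_mem_nhdsWithin] with ε hε u using hρ.kern_nonneg hε u
  · filter_upwards [self_mem_nhdsWithin] with ε hε using hρ.integral_kern hε
  · rw [tendsto_smallSets_iff]
    intro t ht
    obtain ⟨δ, hδ, hb⟩ := Metric.mem_nhds_iff.1 ht
    have hlt : ∀ᶠ ε : ℝ in 𝓝[>] 0, ε < δ := nhdsWithin_le_nhds (gt_mem_nhds hδ)
    filter_upwards [self_mem_nhdsWithin, hlt] with ε hε hεδ u hu
    refine hb (mem_ball_zero_iff.2 ?_)
    by_contra hcon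
    refine hu (hρ.kern_eq_zero ?_)
    rw [abs_of_pos hε]
    rw [Real.norm_eq_abs] at hcon
    linarith
  · exact Eventually.of_forall fun _ =>
      (continuous_cosFun i).aestronglyMeasurable.indicator measurableSet_Ioc
  · have h : Tendsto ((Set.Ioc 0 1).indicator (cosFun i)) (𝓝 θ) (𝓝 (cosFun i θ)) := by
      refine ((continuous_cosFun i).tendsto θ).congr' ?_
      filter_upwards [isOpen_Ioo.mem_nhds hθ] with x hx
      rw [Set.indicator_of_mem (Set.Ioo_subset_Ioc_self hx)]
    exact h.comp tendsto_snd

/-- The mollified derivative of a path with derivative `f_i` tends to `f_i`. -/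
lemma IsMollifier.tendsto_mollOp_primitive_cosL (hρ : IsMollifier ρ) (i : ℕ) :
    Tendsto (fun ε => (hρ.mollOp ε).comp primitive (cosL i)) (𝓝[>] 0) (𝓝 (cosL i)) := by
  rw [tendsto_iff_norm_sub_tendsto_zero]
  have hnorm : ∀ ε, ‖(hρ.mollOp ε).comp primitive (cosL i) - cosL i‖
      = Real.sqrt (∫ θ : I, (convDeriv (kern ρ ε) (primitive (cosL i)) θ - cosFun i θ) ^ 2) := by
    intro ε
    rw [← Real.sqrt_sq (norm_nonneg _), ← real_inner_self_eq_norm_sq]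
    have : (hρ.mollOp ε).comp primitive (cosL i) - cosL i = ContinuousMap.toLp (E := ℝ) 2
        (volume : Measure I) ℝ (convDerivC (hρ.contDiff_kern ε) (hρ.hasCompactSupport_kern ε)
          (primitive (cosL i)) - cosMap i) := by
      rw [map_sub]; rfl
    rw [this, inner_toLp]
    congr 2
    ext θ
    rw [pow_two]; rfl
  simp only [hnorm]
  suffices h : Tendsto (fun ε => ∫ θ : I,
      (convDeriv (kern ρ ε) (primitive (cosL i)) θ - cosFun i θ) ^ 2) (𝓝[>] 0)
      (𝓝 (∫ θ : I, (0 : ℝ))) by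
    simpa using h.sqrt
  refine tendsto_integral_filter_of_dominated_convergence (fun _ => (4 : ℝ) ^ 2)
    (Eventually.of_forall fun ε => ?_) ?_ (integrable_const _) ?_
  · exact ((((continuous_convDeriv (hρ.contDiff_kern ε) (hρ.hasCompactSupport_kern ε) _).sub
      (continuous_cosFun i)).comp continuous_subtype_val).pow 2).aestronglyMeasurable
  · filter_upwards [self_mem_nhdsWithin] with ε hε
    refine ae_of_all _ fun θ => ?_
    rw [norm_pow]
    gcongr
    have h1 := hρ.abs_convDeriv_primitive_cosL_le hε i θ
    have h2 := abs_cosFun_le i θ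
    refine (norm_sub_le _ _).trans ?_
    rw [Real.norm_eq_abs, Real.norm_eq_abs]
    linarith
  · have hne0 : ∀ᵐ r : I, r ≠ 0 := by simp [ae_iff]
    have hne1 : ∀ᵐ r : I, r ≠ 1 := by simp [ae_iff]
    filter_upwards [hne0, hne1] with θ h0 h1
    have hθ : (θ : ℝ) ∈ Set.Ioo (0 : ℝ) 1 :=
      ⟨unitInterval.pos_iff_ne_zero.2 h0, unitInterval.lt_one_iff_ne_one.2 h1⟩
    have h := ((hρ.tendsto_convDeriv_primitive_cosL i hθ).sub_const (cosFun i θ)).pow 2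
    simpa using h

/-! ### The limiting functional -/

lemma continuous_tsum_mul {a : ℕ → ℝ} {v : ℕ → ℝ → ℝ} (ha : Summable fun i => |a i|)
    (hv : ∀ i, Continuous (v i)) {C : ℝ} (hC : ∀ i x, |v i x| ≤ C) :
    Continuous fun x => ∑' i, a i * v i x := by
  refine continuous_tsum (fun i => continuous_const.mul (hv i)) (ha.mul_right C) fun i x => ?_
  rw [norm_mul, Real.norm_eq_abs, Real.norm_eq_abs]
  gcongr
  exact hC i x

lemma summable_mul_of_abs_le {a b : ℕ → ℝ} (ha : Summable fun i => |a i|) {C : ℝ}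
    (hC : ∀ i, |b i| ≤ C) : Summable fun i => a i * b i :=
  Summable.of_norm_bounded (ha.mul_right C) fun i => by
    rw [norm_mul, Real.norm_eq_abs, Real.norm_eq_abs]
    gcongr
    exact hC i

/-- Lebesgue measure on `(0,1)`. -/
abbrev spaceVol : Measure ℝ := volume.restrict (Set.Ioo 0 1)

lemma aestronglyMeasurable_tsum_mul {u v : ℕ → ℝ → ℝ} (hu : ∀ i, Continuous (u i))
    (hs : ∀ t, 0 < t → Summable fun i => |u i t|)
    (hv : ∀ i, Continuous (v i)) {C : ℝ} (hC : ∀ i x, |v i x| ≤ C) :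
    AEStronglyMeasurable (fun p : ℝ × ℝ => ∑' i, u i p.1 * v i p.2) (timeVol.prod spaceVol) := by
  refine aestronglyMeasurable_of_tendsto_ae atTop
    (f := fun n (p : ℝ × ℝ) => ∑ i ∈ Finset.range n, u i p.1 * v i p.2) (fun n => ?_) ?_
  · exact (continuous_finsetSum _ fun i _ => ((hu i).comp continuous_fst).mul
      ((hv i).comp continuous_snd)).aestronglyMeasurable
  · rw [Measure.prod_restrict]
    filter_upwards [ae_restrict_mem (measurableSet_Ioi.prod measurableSet_Ioo)] with p hp
    exact (summable_mul_of_abs_le (hs p.1 hp.1) fun i => hC i p.2).hasSum.tendsto_sum_nat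

lemma integral_spaceVol (f : ℝ → ℝ) : ∫ x, f x ∂spaceVol = ∫ x in (0 : ℝ)..1, f x := by
  rw [intervalIntegral.integral_of_le zero_le_one, integral_Ioc_eq_integral_Ioo]

lemma integrable_spaceVol {f : ℝ → ℝ} (hf : Continuous f) : Integrable f spaceVol :=
  (hf.integrableOn_Icc (a := 0) (b := 1)).mono_set Set.Ioo_subset_Icc_self

lemma hasDerivAt_eigfun (i : ℕ) (x : ℝ) : HasDerivAt (eigfun i) (freq i * cosFun i x) x := by
  unfold eigfun cosFun
  have h := ((((hasDerivAt_id x).const_mul (freq i)).sin).const_mul (Real.sqrt 2))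
  refine h.congr_deriv ?_
  simp only [id]
  ring

/-- The coefficients of `∂_θ z(t, ·)`. -/
def heatCoeff (z : WienerPath) (i : ℕ) (t : ℝ) : ℝ :=
  freq i * Real.exp (-(eigval i * t / 2)) * inner ℝ (eigL i) (toL z)

lemma summable_heatCoeff (z : WienerPath) {t : ℝ} (ht : 0 < t) :
    Summable fun i => |heatCoeff z i t| := by
  refine Summable.of_nonneg_of_le (fun i => abs_nonneg _) (fun i => ?_)
    ((summable_freq_mul_exp ht).mul_right ‖toL z‖)
  have hi := freq_pos i
  rw [heatCoeff, abs_mul, abs_of_nonneg (by positivity)]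
  gcongr
  refine (abs_real_inner_le_norm _ _).trans ?_
  rw [norm_eigL, one_mul]

/-- `∂_θ z(t, θ)`. -/
def heatSlope (z : WienerPath) (t θ : ℝ) : ℝ := ∑' i, heatCoeff z i t * cosFun i θ

lemma continuous_heatSlope (z : WienerPath) {t : ℝ} (ht : 0 < t) : Continuous (heatSlope z t) :=
  continuous_tsum_mul (summable_heatCoeff z ht) continuous_cosFun abs_cosFun_le

/-- Termwise differentiation of the eigenfunction series. It is restricted to interior points
because `extend` is constant outside [0,1], where the series is not. -/
lemma deriv_extend_heat (z : WienerPath) {t : ℝ} (ht : 0 < t) {θ : ℝ}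
    (hθ : θ ∈ Set.Ioo (0 : ℝ) 1) : deriv (extend (heat t z)) θ = heatSlope z t θ := by
  have e : ∀ y ∈ Set.Ioo (0 : ℝ) 1, extend (heat t z) y
      = ∑' i, Real.exp (-(eigval i * t / 2)) * inner ℝ (eigL i) (toL z) * eigfun i y := by
    intro y hy
    have h := (hasSum_diagOp_apply (summable_abs_heat ht) z).mapL
      (evalPath ⟨y, Set.Ioo_subset_Icc_self hy⟩)
    rw [heat_eq_diagOp ht, _root_.extend, Set.projIcc_of_mem _ (Set.Ioo_subset_Icc_self hy),
      ← evalPath_apply, ← h.tsum_eq]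
    rfl
  have hu : Summable fun i => |heatCoeff z i t| * 2 := (summable_heatCoeff z ht).mul_right 2
  have hd := hasDerivAt_tsum hu (g := fun i y => Real.exp (-(eigval i * t / 2))
      * inner ℝ (eigL i) (toL z) * eigfun i y) (g' := fun i y => heatCoeff z i t * cosFun i y)
    (y₀ := 0) (fun i y => ((hasDerivAt_eigfun i y).const_mul _).congr_deriv (by rw [heatCoeff]; ring))
    (fun i y => by
      rw [norm_mul, Real.norm_eq_abs, Real.norm_eq_abs]
      gcongr
      exact abs_cosFun_le i y) (by simp [eigfun]) θ
  refine (hd.congr_of_eventuallyEq ?_).deriv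
  filter_upwards [isOpen_Ioo.mem_nhds hθ] with y hy using e y hy

/-- The pointwise series and the L-valued series are both images of one series converging uniformly
on [0,1]. -/
lemma integral_heatSlope_sq (z : WienerPath) {t : ℝ} (ht : 0 < t) :
    ∫ x, heatSlope z t x ^ 2 ∂spaceVol = ‖heatDeriv t (toL z)‖ ^ 2 := by
  have hs : Summable fun i => heatCoeff z i t • cosMap i := by
    refine Summable.of_norm_bounded ((summable_heatCoeff z ht).mul_right 2) fun i => ?_
    rw [norm_smul, Real.norm_eq_abs]
    gcongr
    exact (ContinuousMap.norm_le _ (by norm_num)).2 fun θ => abs_cosFun_le i θ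
  set m : C(I, ℝ) := ∑' i, heatCoeff z i t • cosMap i with hm
  have h1 : heatDeriv t (toL z) = ContinuousMap.toLp (E := ℝ) 2 (volume : Measure I) ℝ m := by
    refine (hasSum_heatDeriv ht (toL z)).unique ?_
    refine (hs.hasSum.mapL (ContinuousMap.toLp (E := ℝ) 2 (volume : Measure I) ℝ)).congr_fun
      fun i => ?_
    rw [map_smul]; rfl
  have h2 : ∀ θ : I, m θ = heatSlope z t θ := fun θ =>
    ((hs.hasSum.mapL (ContinuousMap.evalCLM ℝ θ)).tsum_eq).symm
  rw [h1, ← real_inner_self_eq_norm_sq, inner_toLp, integral_spaceVol,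
    ← integral_unitInterval fun x => heatSlope z t x ^ 2]
  simp only [h2, pow_two]

lemma integrable_heatSlope_sq (z : WienerPath) :
    Integrable (fun p : ℝ × ℝ => heatSlope z p.1 p.2 ^ 2) (timeVol.prod spaceVol) := by
  have hm : AEStronglyMeasurable (fun p : ℝ × ℝ => heatSlope z p.1 p.2)
      (timeVol.prod spaceVol) :=
    aestronglyMeasurable_tsum_mul (fun i => by unfold heatCoeff; fun_prop)
      (fun t ht => summable_heatCoeff z ht) continuous_cosFun abs_cosFun_le
  have hm2 : AEStronglyMeasurable (fun p : ℝ × ℝ => heatSlope z p.1 p.2 ^ 2)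
    (timeVol.prod spaceVol) := hm.pow 2
  rw [integrable_prod_iff hm2]
  constructor
  · filter_upwards [ae_restrict_mem measurableSet_Ioi] with t ht
    exact integrable_spaceVol ((continuous_heatSlope z ht).pow 2)
  · refine (integrable_norm_sq_heatDeriv (.id ℝ L2unit) (toL z)).congr ?_
    filter_upwards [ae_restrict_mem measurableSet_Ioi] with t ht
    simp only [norm_pow, Real.norm_eq_abs, sq_abs]
    rw [integral_heatSlope_sq z ht]; rfl

lemma abs_cosFun_sq_le (i : ℕ) (x : ℝ) : |cosFun i x ^ 2| ≤ 4 := by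
  rw [abs_pow]
  calc |cosFun i x| ^ 2 ≤ 2 ^ 2 := by gcongr; exact abs_cosFun_le i x
    _ = 4 := by norm_num

lemma cZero_eq (t θ : ℝ) :
    cZero t θ = ∑' i, Real.exp (-(eigval i * t)) * cosFun i θ ^ 2 := by
  rw [cZero]
  congr 1
  ext i
  have h := eigval_pos i
  rw [(hasDerivAt_eigfun i θ).deriv, mul_pow, ← eigval_eq_sq]
  field_simp

lemma summable_abs_exp_eigval {t : ℝ} (ht : 0 < t) :
    Summable fun i : ℕ => |Real.exp (-(eigval i * t))| := by
  simpa only [Real.abs_exp] using summable_exp_eigval ht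

lemma continuous_cZero {t : ℝ} (ht : 0 < t) : Continuous (cZero t) := by
  have : cZero t = fun θ => ∑' i, Real.exp (-(eigval i * t)) * cosFun i θ ^ 2 :=
    funext (cZero_eq t)
  rw [this]
  exact continuous_tsum_mul (v := fun i x => cosFun i x ^ 2) (summable_abs_exp_eigval ht)
    (fun i => (continuous_cosFun i).pow 2) abs_cosFun_sq_le

lemma cZero_nonneg (t θ : ℝ) : 0 ≤ cZero t θ := by
  rw [cZero_eq]
  exact tsum_nonneg fun i => mul_nonneg (Real.exp_pos _).le (sq_nonneg _)

lemma integral_cZero {t : ℝ} (ht : 0 < t) :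
    ∫ x, cZero t x ∂spaceVol = ∑' i, Real.exp (-(eigval i * t)) * 1 := by
  have e : ∀ i, ∫ x, Real.exp (-(eigval i * t)) * cosFun i x ^ 2 ∂spaceVol
      = Real.exp (-(eigval i * t)) * 1 := fun i => by
    rw [integral_const_mul, integral_spaceVol, ← integral_unitInterval fun x => cosFun i x ^ 2]
    have h := inner_cosL i i
    rw [cosL, inner_toLp, if_pos rfl] at h
    rw [← h]
    simp only [pow_two]
    rfl
  have hint : ∀ i, Integrable (fun x => Real.exp (-(eigval i * t)) * cosFun i x ^ 2) spaceVol :=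
    fun i => integrable_spaceVol (continuous_const.mul ((continuous_cosFun i).pow 2))
  have h := integral_tsum_of_summable_integral_norm hint (by
    have en : ∀ i x, ‖Real.exp (-(eigval i * t)) * cosFun i x ^ 2‖
        = Real.exp (-(eigval i * t)) * cosFun i x ^ 2 := fun i x =>
      Real.norm_of_nonneg (mul_nonneg (Real.exp_pos _).le (sq_nonneg _))
    simp only [en, e, mul_one]
    exact summable_exp_eigval ht)
  simp only [e] at h
  simp only [cZero_eq]
  exact h.symm

lemma integrable_cZero :
    Integrable (fun p : ℝ × ℝ => cZero p.1 p.2) (timeVol.prod spaceVol) := by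
  have hm : AEStronglyMeasurable (fun p : ℝ × ℝ => cZero p.1 p.2) (timeVol.prod spaceVol) := by
    simp only [cZero_eq]
    exact aestronglyMeasurable_tsum_mul (u := fun i t => Real.exp (-(eigval i * t)))
      (v := fun i x => cosFun i x ^ 2) (fun i => by fun_prop)
      (fun t ht => summable_abs_exp_eigval ht) (fun i => (continuous_cosFun i).pow 2)
      abs_cosFun_sq_le
  rw [integrable_prod_iff hm]
  constructor
  · filter_upwards [ae_restrict_mem measurableSet_Ioi] with t ht
    exact integrable_spaceVol (continuous_cZero ht)
  · refine (integrable_and_integral_tsum_exp_mul (a := fun _ => 1) (fun _ => zero_le_one)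
      (fun _ => le_rfl)).1.congr ?_
    filter_upwards [ae_restrict_mem measurableSet_Ioi] with t ht
    simp only [Real.norm_of_nonneg (cZero_nonneg _ _)]
    rw [integral_cZero ht]

/-- For every z the two terms are integrable separately: the square by the isometry, and the
counterterm because ∑ ∫₀^∞ e^{-λ_i t} dt = ∑ 1/λ_i < ∞. -/
lemma integrableOn_limitDensity (z : WienerPath) :
    IntegrableOn (fun p : ℝ × ℝ => limitDensity z p.1 p.2) (Set.Ioi 0 ×ˢ Set.Ioo 0 1) := by
  have h := (integrable_heatSlope_sq z).sub integrable_cZero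
  rw [Measure.prod_restrict] at h
  refine IntegrableOn.congr_fun h (fun p hp => ?_) (measurableSet_Ioi.prod measurableSet_Ioo)
  rw [limitDensity, deriv_extend_heat z hp.1 hp.2]
  rfl

/-- The closed form of 𝓡𝓖_0: the time integral of ‖∂_θ z(t,·)‖² is ‖z‖² by the isometry. -/
lemma integral_limitDensity (z : WienerPath) :
    ∫ t in Set.Ioi (0 : ℝ), ∫ θ in (0 : ℝ)..1, limitDensity z t θ
      = ‖toL z‖ ^ 2 - ∑' i, (eigval i)⁻¹ := by
  have h1 := integrable_and_integral_tsum_exp_mul (a := fun _ => 1) (fun _ => zero_le_one) (fun _ => le_rfl)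
  have h2 := integral_norm_sq_heatDeriv (.id ℝ L2unit) (toL z)
  have h3 : ‖quadLift (.id ℝ L2unit) (toL z)‖ ^ 2 = ‖toL z‖ ^ 2 := by
    rw [← real_inner_self_eq_norm_sq, inner_quadLift_id, real_inner_self_eq_norm_sq]
  simp only [mul_one] at h1
  rw [← h3, ← h2, ← h1.2, ← integral_sub (integrable_norm_sq_heatDeriv _ _) h1.1]
  refine setIntegral_congr_fun measurableSet_Ioi fun t ht => ?_
  have e : ∫ θ in (0 : ℝ)..1, limitDensity z t θ
      = ∫ θ, (heatSlope z t θ ^ 2 - cZero t θ) ∂spaceVol := by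
    rw [← integral_spaceVol]
    refine setIntegral_congr_fun measurableSet_Ioo fun θ hθ => ?_
    rw [limitDensity, deriv_extend_heat z ht hθ]
  have i1 : Integrable (fun θ => heatSlope z t θ ^ 2) spaceVol :=
    integrable_spaceVol ((continuous_heatSlope z ht).pow 2)
  rw [e, integral_sub i1 (integrable_spaceVol (continuous_cZero ht)), integral_heatSlope_sq z ht,
    integral_cZero ht]
  simp only [mul_one]
  rfl

/-! ### Convergence -/

lemma quadLift_sub (T U : L2unit →L[ℝ] L2unit) (x : L2unit) :
    quadLift (T - U) x = quadLift T x - quadLift U x := by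
  refine Lp.ext ?_
  filter_upwards [coeFn_quadLift (T - U) x, coeFn_quadLift T x, coeFn_quadLift U x,
    Lp.coeFn_sub (quadLift T x) (quadLift U x)] with t h1 h2 h3 h4
  rw [h1, h4, Pi.sub_apply, h2, h3, sub_apply]

/-- At i = j the factor λ_i · 2/(2λ_i) is 1, so convergence of T on f_i transfers to its lift on e_i
without loss. -/
lemma norm_quadLift_eigL (T : L2unit →L[ℝ] L2unit) (i : ℕ) :
    ‖quadLift T (eigL i)‖ = ‖T (cosL i)‖ := by
  have h := inner_quadLift_eigL T i i
  have hi := eigval_pos i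
  rw [real_inner_self_eq_norm_sq, real_inner_self_eq_norm_sq, ← pow_two, ← eigval_eq_sq] at h
  rw [← sq_eq_sq₀ (norm_nonneg _) (norm_nonneg _), h]
  field_simp
  ring

lemma quadLift_id (x : L2unit) : quadLift (.id ℝ L2unit) x = heatLift x := by
  rw [quadLift_apply, compLp_id]

/-- Contractions which converge on the `f_i` induce strongly convergent lifts. -/
lemma tendsto_quadLift {ι : Type*} {l : Filter ι} {T : ι → L2unit →L[ℝ] L2unit}
    (hT : ∀ᶠ a in l, ‖T a‖ ≤ 1) (hlim : ∀ i, Tendsto (fun a => T a (cosL i)) l (𝓝 (cosL i)))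
    (x : L2unit) : Tendsto (fun a => quadLift (T a) x) l (𝓝 (heatLift x)) := by
  have hbasis : ∀ i, Tendsto (fun a => quadLift (T a) (eigL i)) l (𝓝 (heatLift (eigL i))) := by
    intro i
    rw [tendsto_iff_norm_sub_tendsto_zero]
    refine (tendsto_iff_norm_sub_tendsto_zero.1 (hlim i)).congr fun a => ?_
    rw [← quadLift_id, ← quadLift_sub, norm_quadLift_eigL]
    rfl
  have hproj : ∀ n, Tendsto (fun a => quadLift (T a) (eigProj n x)) l
      (𝓝 (heatLift (eigProj n x))) := by
    intro n
    simp only [eigProj, map_sum, map_smul]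
    exact tendsto_finsetSum _ fun i _ => (hbasis i).const_smul _
  rw [Metric.tendsto_nhds]
  intro δ hδ
  -- The projection index n is chosen before a; the uniform contraction bound then controls the tail
  -- for all relevant a at once.
  obtain ⟨n, hn⟩ := ((Metric.tendsto_nhds.1 (tendsto_eigProj x)) (δ / 3) (by positivity)).exists
  filter_upwards [hT, Metric.tendsto_nhds.1 (hproj n) (δ / 3) (by positivity)] with a h1 h2
  have h3 : dist (quadLift (T a) x) (quadLift (T a) (eigProj n x)) < δ / 3 := by
    rw [dist_eq_norm, ← map_sub]
    refine (norm_quadLift_le _ _).trans_lt ?_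
    rw [dist_comm, dist_eq_norm] at hn
    exact (mul_le_of_le_one_left (norm_nonneg _) h1).trans_lt hn
  have h4 : dist (heatLift (eigProj n x)) (heatLift x) < δ / 3 := by
    rwa [heatLift.dist_map]
  calc _ ≤ _ := dist_triangle4 _ _ _ _
    _ < δ / 3 + δ / 3 + δ / 3 := by gcongr
    _ = δ := by ring

lemma tendsto_potentialConst {ι : Type*} {l : Filter ι} {T : ι → L2unit →L[ℝ] L2unit}
    (hT : ∀ᶠ a in l, ‖T a‖ ≤ 1) (hlim : ∀ i, Tendsto (fun a => T a (cosL i)) l (𝓝 (cosL i))) :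
    Tendsto (fun a => potentialConst (T a)) l (𝓝 (∑' i, (eigval i)⁻¹)) := by
  refine tendsto_tsum_of_dominated_convergence (bound := fun i => (eigval i)⁻¹)
    summable_inv_eigval (fun i => ?_) ?_
  · have h := ((hlim i).norm.pow 2).const_mul (eigval i)⁻¹
    simpa only [norm_cosL, one_pow, mul_one] using h
  · filter_upwards [hT] with a ha i
    have hi := inv_pos.2 (eigval_pos i)
    rw [Real.norm_of_nonneg (by positivity)]
    refine mul_le_of_le_one_right hi.le ((norm_sq_map_cosL_le (T a) i).trans ?_)
    exact pow_le_one₀ (norm_nonneg _) ha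

section Limits

variable {ι : Type*} {l : Filter ι} {V : ι → WienerPath →L[ℝ] L2unit}

open ContinuousLinearMap in
-- Moving the adjoint across leaves ⟨S_a g, S_a ω⟩, where S_a is the lift of T a. Strong convergence
-- of S_a to an isometry sends this to ⟨g, ω⟩ for each ω, with dominating function ‖g‖ ‖ω‖.
lemma IsWienerMeasure.tendsto_integral_inner_quadLift (hμ : IsWienerMeasure μ)
    [l.IsCountablyGenerated] {T : ι → L2unit →L[ℝ] L2unit} (hT : ∀ᶠ a in l, ‖T a‖ ≤ 1)
    (hlim : ∀ i, Tendsto (fun a => T a (cosL i)) l (𝓝 (cosL i))) (g : Lp L2unit 2 μ) :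
    Tendsto (fun a => ∫ ω, inner ℝ (g ω) (adjoint (quadLift (T a)) (quadLift (T a) (toL ω))) ∂μ)
      l (𝓝 (∫ ω, inner ℝ (g ω) (toL ω) ∂μ)) := by
  refine tendsto_integral_filter_of_dominated_convergence (fun ω => ‖g ω‖ * ‖ω‖)
    (Eventually.of_forall fun a => ?_) ?_ ?_ (ae_of_all _ fun ω => ?_)
  · exact (Lp.aestronglyMeasurable g).inner (((adjoint (quadLift (T a))).continuous.comp
      ((quadLift (T a)).continuous.comp continuous_toL)).aestronglyMeasurable)
  · filter_upwards [hT] with a ha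
    refine ae_of_all _ fun ω => ?_
    rw [adjoint_inner_right]
    refine (norm_inner_le_norm _ _).trans ?_
    have h : ∀ x, ‖quadLift (T a) x‖ ≤ ‖x‖ := fun x =>
      (norm_quadLift_le _ _).trans (mul_le_of_le_one_left (norm_nonneg _) ha)
    gcongr
    · exact h _
    · exact (h _).trans (norm_toL_le ω)
  · exact (Lp.memLp g).norm.integrable_mul (hμ.memLp_norm 2 (by simp))
  · simp only [adjoint_inner_right]
    rw [← heatLift.inner_map_map]
    exact (tendsto_quadLift hT hlim _).inner (tendsto_quadLift hT hlim _)

lemma IsWienerMeasure.tendsto_integral_mul_potential (hμ : IsWienerMeasure μ)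
    [l.IsCountablyGenerated] (hT : ∀ᶠ a in l, ‖(V a).comp primitive‖ ≤ 1)
    (hlim : ∀ i, Tendsto (fun a => (V a).comp primitive (cosL i)) l (𝓝 (cosL i)))
    (f : Lp ℝ 2 μ) :
    Tendsto (fun a => ∫ ω, f ω * potential μ (centredSquare μ (V a)) ω ∂μ) l
      (𝓝 (∫ ω, f ω * (‖toL ω‖ ^ 2 - ∑' i, (eigval i)⁻¹) ∂μ)) := by
  have := hμ.isProbabilityMeasure
  have hc := tendsto_potentialConst hT hlim
  set K := ∑' i, (eigval i)⁻¹ with hK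
  have hcb : ∀ᶠ a in l, |potentialConst ((V a).comp primitive)| ≤ |K| + 1 := by
    filter_upwards [hc.abs.eventually (gt_mem_nhds (lt_add_one |K|))] with a ha using ha.le
  simp only [hμ.potential_centredSquare]
  refine tendsto_integral_filter_of_dominated_convergence
    (fun ω => ‖f ω‖ * (‖ω‖ ^ 2 + (|K| + 1)))
    (Eventually.of_forall fun a => ?_) ?_ ?_ (ae_of_all _ fun ω => ?_)
  · exact (Lp.aestronglyMeasurable f).mul ((((ContinuousLinearMap.continuous _).comp
      continuous_toL).norm.pow 2).sub continuous_const).aestronglyMeasurable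
  · filter_upwards [hT, hcb] with a ha hb
    refine ae_of_all _ fun ω => ?_
    rw [norm_mul]
    gcongr
    refine (norm_sub_le _ _).trans ?_
    rw [norm_pow, norm_norm]
    gcongr
    · exact ((norm_quadLift_le _ _).trans (mul_le_of_le_one_left (norm_nonneg _) ha)).trans
        (norm_toL_le ω)
    · exact hb
  · exact (Lp.memLp f).norm.integrable_mul
      ((hμ.memLp_norm_pow 2 2 (by simp)).add (memLp_const (|K| + 1)))
  · have h := (((tendsto_quadLift hT hlim (toL ω)).norm.pow 2).sub hc).const_mul (f ω)
    rwa [heatLift.norm_map] at h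

end Limits

/-! ### Elements of the domain -/

/-- Closability is used here: only for a single-valued submodule is the graph of `toLinearPMap` the
submodule itself. -/
lemma IsWienerMeasure.mem_closure_gradOp (hμ : IsWienerMeasure μ) (F : DomE μ) :
    ((F : Lp ℝ 2 μ), gradOp μ F) ∈ (expGraph μ).topologicalClosure := by
  rw [← Submodule.toLinearPMap_graph_eq _ hμ.closable]
  exact LinearPMap.mem_graph _ F

lemma IsWienerMeasure.exists_domE (hμ : IsWienerMeasure μ) {f : WienerPath → ℝ}
    {g : WienerPath → L2unit} (h : HasClosedGrad μ f g) :
    ∃ F : DomE μ, ((F : Lp ℝ 2 μ) : WienerPath → ℝ) =ᵐ[μ] f ∧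
      (gradOp μ F : WienerPath → L2unit) =ᵐ[μ] g := by
  obtain ⟨hf, hg, hm⟩ := h
  rw [← Submodule.toLinearPMap_graph_eq _ hμ.closable, LinearPMap.mem_graph_iff] at hm
  obtain ⟨F, h1, h2⟩ := hm
  refine ⟨F, ?_, ?_⟩
  · rw [h1]; exact hf.coeFn_toLp
  · change ((expGraph μ).topologicalClosure.toLinearPMap F : WienerPath → L2unit) =ᵐ[μ] g
    rw [h2]; exact hg.coeFn_toLp

/-- The ½ of the form cancels the 2 in the gradient of a quadratic functional. -/
lemma energy_eq_of_gradOp {F G : DomE μ} {g : WienerPath → L2unit}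
    (h : (gradOp μ G : WienerPath → L2unit) =ᵐ[μ] fun ω => (2 : ℝ) • g ω) :
    energy μ F G = ∫ ω, inner ℝ (gradOp μ F ω) (g ω) ∂μ := by
  rw [energy, ← integral_const_mul]
  refine integral_congr_ae ?_
  filter_upwards [h] with ω hω
  rw [hω, real_inner_smul_right]
  ring

end

/-! ### The theorem. -/

theorem mainTheorem6 (μ : Measure WienerPath) (hμ : IsWienerMeasure μ)
    (ρ : ℝ → ℝ) (hρ : IsMollifier ρ) :
    -- the regularized functionals are in `L²(μ)` and the integrals defining `𝓡𝓖_ε` converge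
    (∀ ε : ℝ, 0 < ε → MemLp (renSquare μ ρ ε) 2 μ ∧
      ∀ᵐ z ∂μ,
        (∀ t : ℝ, 0 < t → Integrable (renSquare μ ρ ε) (ouKernel μ t z)) ∧
        IntegrableOn
          (fun t : ℝ => ouSemigroup μ t (renSquare μ ρ ε) z - ∫ y, renSquare μ ρ ε y ∂μ)
          (Set.Ioi 0)) ∧
    -- the integral defining `𝓡𝓖_0` converges absolutely
    (∀ᵐ z ∂μ, IntegrableOn (fun p : ℝ × ℝ => limitDensity z p.1 p.2)
      (Set.Ioi 0 ×ˢ Set.Ioo 0 1)) ∧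
    ∃ (R : ℝ → DomE μ) (R₀ : DomE μ),
      -- `R ε` is `𝓡𝓖_ε` and `R₀` is `𝓡𝓖_0`; both are in `Dom(𝓔)`
      (∀ ε : ℝ, 0 < ε →
        ((R ε : Lp ℝ 2 μ) : WienerPath → ℝ) =ᵐ[μ] potential μ (renSquare μ ρ ε)) ∧
      ((R₀ : Lp ℝ 2 μ) : WienerPath → ℝ) =ᵐ[μ]
        (fun z => ∫ t in Set.Ioi (0 : ℝ), ∫ θ in (0 : ℝ)..1, limitDensity z t θ) ∧
      -- `𝓡𝓖_ε` converges weakly to `𝓡𝓖_0` in `Dom(𝓔)`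
      (∀ F : DomE μ, Tendsto (fun ε : ℝ => formInner μ F (R ε)) (𝓝[>] 0)
        (𝓝 (formInner μ F R₀))) ∧
      -- the integration by parts formula
      (∀ F : DomE μ,
        Tendsto (fun ε : ℝ => ∫ ω, (F : Lp ℝ 2 μ) ω * renSquare μ ρ ε ω ∂μ) (𝓝[>] 0)
          (𝓝 (∫ ω, inner ℝ (gradOp μ F ω) (toL ω) ∂μ)) ∧
        ∫ ω, inner ℝ (gradOp μ F ω) (toL ω) ∂μ = energy μ F R₀) := by
  have hpos : ∀ᶠ ε : ℝ in 𝓝[>] 0, 0 < ε := self_mem_nhdsWithin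
  have hT : ∀ᶠ ε : ℝ in 𝓝[>] 0, ‖(hρ.mollOp ε).comp primitive‖ ≤ 1 := by
    filter_upwards [hpos] with ε hε using hρ.norm_mollOp_primitive_le hε
  have hlim := hρ.tendsto_mollOp_primitive_cosL
  have hren := hρ.renSquare_eq hμ
  refine ⟨fun ε _ => ?_, ae_of_all _ integrableOn_limitDensity, ?_⟩
  · rw [hren]
    exact ⟨hμ.memLp_centredSquare _, ae_of_all _ fun z =>
      ⟨fun t ht => hμ.integrable_centredSquare_ouKernel _ ht z, hμ.integrableOn_ouSemigroup _ z⟩⟩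
  -- The choice is made for every real ε, including ε ≤ 0, where the operator still exists; only ε >
  -- 0 matters along the filter.
  choose R hR hgradR using fun ε =>
    hμ.exists_domE (hμ.hasClosedGrad_potential (hρ.mollOp ε))
  -- The limit is constructed from its closed form ‖z‖² − ∑ 1/λ_i and matched with the double
  -- integral afterwards.
  obtain ⟨R₀, hR₀, hgradR₀⟩ := hμ.exists_domE ((hμ.hasClosedGrad_norm_sq (.id ℝ L2unit)).add
    (hμ.hasClosedGrad_const (-∑' i, (eigval i)⁻¹)))
  have hgradR₀' : (gradOp μ R₀ : WienerPath → L2unit) =ᵐ[μ] fun ω => (2 : ℝ) • toL ω := by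
    filter_upwards [hgradR₀] with ω h
    rw [h, add_zero, ContinuousLinearMap.adjoint_id]
    rfl
  have henergy : ∀ F : DomE μ, Tendsto (fun ε => energy μ F (R ε)) (𝓝[>] 0)
      (𝓝 (∫ ω, inner ℝ (gradOp μ F ω) (toL ω) ∂μ)) := fun F => by
    simp only [fun ε => energy_eq_of_gradOp (F := F) (hgradR ε)]
    exact hμ.tendsto_integral_inner_quadLift hT hlim (gradOp μ F)
  refine ⟨R, R₀, fun ε _ => ?_, ?_, fun F => ?_, fun F => ⟨?_, ?_⟩⟩
  · rw [hren]; exact hR ε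
  · filter_upwards [hR₀] with z h
    rw [h, integral_limitDensity, sub_eq_add_neg]
    rfl
  · simp only [formInner]
    rw [energy_eq_of_gradOp hgradR₀']
    -- The L² part and the energy part of the inner product converge separately.
    refine Tendsto.add ?_ (henergy F)
    have h := hμ.tendsto_integral_mul_potential hT hlim (F : Lp ℝ 2 μ)
    have e : ∀ ε, ∫ ω, (F : Lp ℝ 2 μ) ω * (R ε : Lp ℝ 2 μ) ω ∂μ
        = ∫ ω, (F : Lp ℝ 2 μ) ω * potential μ (centredSquare μ (hρ.mollOp ε)) ω ∂μ := fun ε =>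
      integral_congr_ae (by filter_upwards [hR ε] with ω hω; rw [hω])
    have e₀ : ∫ ω, (F : Lp ℝ 2 μ) ω * (R₀ : Lp ℝ 2 μ) ω ∂μ
        = ∫ ω, (F : Lp ℝ 2 μ) ω * (‖toL ω‖ ^ 2 - ∑' i, (eigval i)⁻¹) ∂μ :=
      integral_congr_ae (by filter_upwards [hR₀] with ω hω; rw [hω, sub_eq_add_neg]; rfl)
    simpa only [e, e₀] using h
  -- For each ε the expectation equals the integral in the limit lemma exactly, by integration by
  -- parts, so nothing beyond the limit already proved is needed.
  · refine (hμ.tendsto_integral_inner_quadLift hT hlim (gradOp μ F)).congr fun ε => ?_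
    rw [hren]
    exact (hμ.integral_mul_centredSquare (hρ.mollOp ε) (hμ.mem_closure_gradOp F)).symm
  · exact (energy_eq_of_gradOp hgradR₀').symm
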